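/- **Trees.** A tree $T$ here is a locally finite planar rooted tree, finite or infinite, whose root has degree $1$; $|T|$ is its number of edges, $\sigma_v$ the degree of a vertex $v$, and $|B_R(T)|$ the number of edges of the subgraph spanned by the vertices at graph distance at most $R$ from the root. Let $w_n\ge 0$ $(n\ge 1)$ be weights with $w_1>0$ and $w_n>0$ for some $n\ge 3$, and put $w(T)=\prod_{v\neq \mathrm{root}}w_{\sigma_v}$ for finite $T$, $$Z_N=\sum_{|T|=N}w(T),\qquad Z(\zeta)=\sum_{N\ge1} Z_N\zeta^N,\qquad \phi(z)=\sum_{n\ge 1}w_nz^{n-1}.$$ Let $\zeta_0$ and $z_c$ be the radii of convergence of $Z$ and $\phi$, and $Z_0=\lim_{\zeta\uparrow\zeta_0}Z(\zeta)$. Assume $z_c>0$ and the genericity condition $Z_0<z_c$. Let $p_n=\zeta_0w_{n+1}Z_0^{n-1}$ and $f(s)=\sum_{n\ge 0}p_ns^n$. For $Z_N\neq0$ let $\nu_N$ be the probability measure $\nu_N(T)=Z_N^{-1}w(T)$ on trees with $N$ edges. There is a unique probability measure $\nu$ on the set of infinite trees such that, for every $R$ and every tree $T$, the $\nu_N$-probability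 of coinciding with $T$ up to height $R$ converges, as $N\to\infty$ through the $N$ with $Z_N\ne0$, to the corresponding $\nu$-probability. For this $\nu$: 1. for all $R\ge 0$, $|B_R|$ is $\nu$-integrable and $$\langle|B_R|\rangle_\nu=\tfrac12 f''(1)R(R-1)+R ;$$ in particular $\ln\langle |B_R|\rangle_\nu/\ln R\to2$ as $R\to\infty$; 2. there are constants $C_1,C_2>0$ such that $\nu$-almost surely, for all sufficiently large $R$ (depending on $T$), $$C_1(\ln R)^{-2}R^2\le|B_R(T)|\le C_2R^2(\ln R)^3 ;$$ 3. $\nu$-almost surely, $d_h=\lim_{R\to\infty}\ln|B_R(T)|/\ln R$ exists and equals $2$. **Causal triangulations.** An infinite causal triangulation is a rooted triangulation $G$ of the plane, with a marked edge at its root (the central vertex), in which, for each $k\ge1$, the vertices at distance $k$ from the root span a cycle (cycles with one or two edges being allowed). Let $\beta^{-1}$ be the map from infinite trees to infinite causal triangulations that deletes the root and its edge, so that its neighbour becomes the central vertex, marks the rightmost edge from the central vertex, joins the vertices at each distance $k\ge1$ from the central vertex into a cycle in their cyclic order, and adds, for every noncentral vertex $v$, one edge from $v$ to the next cycle, to the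 right of all tree edges from $v$ to its children and crossing no other edge. Let $\nu$ be the above measure for the weights $w_n=1$ (it exists and is unique), and let $\rho$ be the law of $\beta^{-1}(T)$ for $T$ distributed by $\nu$, i.e. $\rho(A)=\nu(\beta(A))$ (the uniform infinite causal triangulation). With $|B_R(G)|$ the number of edges of the subgraph spanned by the vertices at distance at most $R$ from the central vertex, $|B_R|$ is $\rho$-integrable for every $R$, and 4. $\langle|B_R|\rangle_\rho\sim R^2$ as $R\to\infty$, in the sense that the ratio of the two sides is bounded above and below by positive constants for large $R$; in particular $\ln\langle |B_R|\rangle_\rho/\ln R\to2$; 5. there are constants $C_1',C_2'>0$ such that $\rho$-almost surely, for all sufficiently large $R$ (depending on $G$), $C_1'(\ln R)^{-2}R^2\le|B_R(G)|\le C_2'R^2(\ln R)^3$; 6. $\rho$-almost surely, $d_h=\lim_{R\to\infty}\ln|B_R(G)|/\ln R$ exists and equals $2$. -/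

import Mathlib

open Filter Topology MeasureTheory
open scoped ENNReal NNReal BigOperators

noncomputable section

/-- The number of vertices at height `k`, when `c k i` is the number of children of the `i`-th
vertex (from the left) at height `k`. -/
def levelWidth (c : ℕ → ℕ → ℕ) : ℕ → ℕ
  | 0 => 1
  | k + 1 => ∑ i ∈ Finset.range (levelWidth c k), c k i

/-- Locally finite rooted planar trees (finite or infinite) whose root has degree `1`.
The vertices at each height are numbered `0, 1, 2, …` from left to right, and `children k i` is
the number of children of the `i`-th vertex at height `k` (set to `0` if there is none).
Two such trees are equal exactly if they are isomorphic as rooted planar trees. -/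
@[ext] structure PlanarTree where
  children : ℕ → ℕ → ℕ
  children_root : children 0 0 = 1
  children_eq_zero : ∀ k i, levelWidth children k ≤ i → children k i = 0

namespace PlanarTree

/-- The number of vertices at height `k`. -/
def width (T : PlanarTree) (k : ℕ) : ℕ := levelWidth T.children k

/-- The total number of children of the first `i` vertices at height `k`: the children of the
`i`-th vertex at height `k` are the vertices `j` at height `k + 1` with
`offset k i ≤ j < offset k (i + 1)`. -/
def offset (T : PlanarTree) (k i : ℕ) : ℕ := ∑ m ∈ Finset.range i, T.children k m

/-- The vertices: for `i < width k`, the `i`-th vertex at height `k`. -/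
@[ext] structure Vertex (T : PlanarTree) : Type where
  height : ℕ
  idx : ℕ
  lt : idx < T.width height

/-- The root, the only vertex at height `0`. -/
def root (T : PlanarTree) : T.Vertex := ⟨0, 0, Nat.one_pos⟩

/-- `u` is the parent of `v`. -/
def IsParent (T : PlanarTree) (u v : T.Vertex) : Prop :=
  v.height = u.height + 1 ∧
    T.offset u.height u.idx ≤ v.idx ∧ v.idx < T.offset u.height (u.idx + 1)

/-- The tree as a graph. -/
def graph (T : PlanarTree) : SimpleGraph T.Vertex := SimpleGraph.fromRel T.IsParent

/-- The size `|T|`: the number of edges. -/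
def size (T : PlanarTree) : ℕ∞ := T.graph.edgeSet.encard

/-- `|B_R(T)|`: the number of edges of the subgraph spanned by the vertices at graph distance at
most `R` from the root. -/
def ballSize (T : PlanarTree) (R : ℕ) : ℕ :=
  {e ∈ T.graph.edgeSet | ∀ v ∈ e, T.graph.edist T.root v ≤ R}.ncard

/-- The trees coinciding with `T` up to height `R`. -/
def ball (R : ℕ) (T : PlanarTree) : Set PlanarTree :=
  {T' | ∀ k < R, ∀ i, T'.children k i = T.children k i}

/-- The Borel `σ`-algebra of the metric whose balls are the sets `ball R T`. -/
instance : MeasurableSpace PlanarTree :=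
  MeasurableSpace.generateFrom {A | ∃ R T, A = ball R T}

/-- The weight `∏ w_{σ_v}` of a finite tree, over the vertices `v` different from the root; the
degree `σ_v` of such a vertex is its number of children plus one. -/
def weight (w : ℕ → ℝ≥0) (T : PlanarTree) : ℝ≥0 :=
  ∏ᶠ v ∈ {v : T.Vertex | v ≠ T.root}, w (T.children v.height v.idx + 1)

end PlanarTree

/-- Infinite trees. -/
abbrev InfiniteTree : Type := {T : PlanarTree // Infinite T.Vertex}

/-- The finite volume partition function `Z_N`. -/
def partitionFunction (w : ℕ → ℝ≥0) (N : ℕ) : ℝ≥0∞ :=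
  ∑' T : {T : PlanarTree // T.size = N}, (T.1.weight w : ℝ≥0∞)

/-- The distribution `ν_N` on trees of size `N` (meaningful if `Z_N ≠ 0`). -/
def finiteVolumeMeasure (w : ℕ → ℝ≥0) (N : ℕ) : Measure PlanarTree :=
  (partitionFunction w N)⁻¹ •
    Measure.sum fun T : {T : PlanarTree // T.size = N} =>
      (T.1.weight w : ℝ≥0∞) • Measure.dirac T.1

/-- The generating function `φ(z) = ∑_{n ≥ 1} w_n z^{n-1}` of the branching weights. -/
def weightSeries (w : ℕ → ℝ≥0) (z : ℝ≥0∞) : ℝ≥0∞ := ∑' n : ℕ, (w (n + 1) : ℝ≥0∞) * z ^ n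

/-- The generating function `Z(ζ) = ∑_N Z_N ζ^N` (there is no tree of size `0`). -/
def partitionSeries (w : ℕ → ℝ≥0) (ζ : ℝ≥0∞) : ℝ≥0∞ := ∑' N : ℕ, partitionFunction w N * ζ ^ N

/-- The radius of convergence of a power series with nonnegative coefficients. -/
def convRadius (F : ℝ≥0∞ → ℝ≥0∞) : ℝ≥0∞ := ⨆ (r : ℝ≥0) (_ : F r ≠ ∞), (r : ℝ≥0∞)

/-- `z_c`. -/
def zCrit (w : ℕ → ℝ≥0) : ℝ≥0∞ := convRadius (weightSeries w)

/-- `ζ_0`. -/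
def zetaZero (w : ℕ → ℝ≥0) : ℝ≥0∞ := convRadius (partitionSeries w)

/-- `Z_0 = lim_{ζ ↑ ζ_0} Z(ζ)`; as `Z` is increasing, the limit is a supremum. -/
def ZZero (w : ℕ → ℝ≥0) : ℝ≥0∞ := ⨆ (ζ : ℝ≥0∞) (_ : ζ < zetaZero w), partitionSeries w ζ

/-- The standing assumptions on the branching weights, with the genericity `Z_0 < z_c`. -/
structure IsGeneric (w : ℕ → ℝ≥0) : Prop where
  one_pos : 0 < w 1
  exists_pos : ∃ n, 3 ≤ n ∧ 0 < w n
  zCrit_pos : 0 < zCrit w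
  generic : ZZero w < zCrit w

/-- The offspring probabilities `p_n = ζ_0 w_{n+1} Z_0^{n-1}`. -/
def offspringProb (w : ℕ → ℝ≥0) (n : ℕ) : ℝ :=
  (zetaZero w).toReal * (w (n + 1) : ℝ) * (ZZero w).toReal ^ ((n : ℤ) - 1)

/-- Their generating function `f`. -/
def offspringGF (w : ℕ → ℝ≥0) (s : ℝ) : ℝ := ∑' n : ℕ, offspringProb w n * s ^ n

/-- `ν` is a probability measure on the infinite trees and is the limit of the distributions
`ν_N` as `N → ∞` (through the `N` with `Z_N ≠ 0`, for which `ν_N` is defined), in the sense of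
convergence of the probabilities of all balls. -/
def IsInfiniteVolumeLimit (w : ℕ → ℝ≥0) (ν : Measure InfiniteTree) : Prop :=
  IsProbabilityMeasure ν ∧
    ∀ (R : ℕ) (T : PlanarTree),
      Tendsto (fun N => finiteVolumeMeasure w N (PlanarTree.ball R T))
        (atTop ⊓ 𝓟 {N | partitionFunction w N ≠ 0})
        (𝓝 (ν {T' : InfiniteTree | T'.1 ∈ PlanarTree.ball R T}))

/-! ### Causal triangulations -/

/-- A rooted, locally finite, connected triangulated surface without boundary, given by its
oriented edges (`Dart`): `opp` reverses an oriented edge, `next` is the following oriented edge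
along the boundary of the triangle on its left, so that `d ↦ opp (next (next d))` is the rotation
around the origin of `d`. Loops and multiple edges are allowed. The oriented edge `rootDart` is
the root edge, and its origin is the central vertex. -/
structure RootedTriangulation where
  Dart : Type
  Vertex : Type
  org : Dart → Vertex
  opp : Dart → Dart
  next : Dart → Dart
  rootDart : Dart
  opp_opp : ∀ d, opp (opp d) = d
  opp_ne : ∀ d, opp d ≠ d
  next_next_next : ∀ d, next (next (next d)) = d
  next_ne : ∀ d, next d ≠ d
  org_next : ∀ d, org (next d) = org (opp d)
  org_surjective : Function.Surjective org
  /-- the oriented edges starting at a vertex form one orbit of the rotation -/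
  rotation_transitive : ∀ d d', org d = org d' →
    Relation.EqvGen (fun a b => b = opp (next (next a))) d d'
  locallyFinite : ∀ v, {d | org d = v}.Finite
  connected : (SimpleGraph.fromRel fun u v => ∃ d, org d = u ∧ org (opp d) = v).Connected

namespace RootedTriangulation

/-- The central vertex `S_0`. -/
def center (G : RootedTriangulation) : G.Vertex := G.org G.rootDart

/-- Adjacency of distinct vertices; it determines the graph distance. -/
def graph (G : RootedTriangulation) : SimpleGraph G.Vertex :=
  SimpleGraph.fromRel fun u v => ∃ d, G.org d = u ∧ G.org (G.opp d) = v

/-- The vertices at graph distance `k` from the central vertex. -/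
def sphere (G : RootedTriangulation) (k : ℕ) : Set G.Vertex :=
  {v | G.graph.edist G.center v = k}

/-- `|B_R(G)|`: the number of edges (counted with multiplicity, each edge being a pair of opposite
oriented edges) of the subgraph spanned by the vertices at graph distance at most `R` from the
central vertex. -/
def ballSize (G : RootedTriangulation) (R : ℕ) : ℕ :=
  {e : Sym2 G.Dart | ∃ d, e = s(d, G.opp d) ∧ G.graph.edist G.center (G.org d) ≤ R ∧
    G.graph.edist G.center (G.org (G.opp d)) ≤ R}.ncard

/-- `G` is an infinite causal triangulation: for every `k ≥ 1` the vertices at distance `k` from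
the central vertex span a cycle (a nonempty connected graph in which all degrees are two, a loop
counting twice; cycles of one or two edges are allowed), and no edge joins the central vertex to
itself. Two consecutive cycles then bound an annulus, so that the surface is the plane. -/
structure IsCausal (G : RootedTriangulation) : Prop where
  no_loop : ∀ d, G.org d = G.center → G.org (G.opp d) ≠ G.center
  cycle_connected : ∀ k, 1 ≤ k → (G.graph.induce (G.sphere k)).Connected
  cycle_degree : ∀ k, 1 ≤ k → ∀ v ∈ G.sphere k,
    {d | G.org d = v ∧ G.org (G.opp d) ∈ G.sphere k}.ncard = 2

end RootedTriangulation

/-- Infinite causal triangulations of the plane. -/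
def CausalTriangulation : Type 1 := {G : RootedTriangulation // G.IsCausal}

namespace PlanarTree

variable (T : PlanarTree)

theorem offset_succ (k i : ℕ) : T.offset k (i + 1) = T.offset k i + T.children k i :=
  Finset.sum_range_succ _ _

theorem offset_mono (k : ℕ) {i j : ℕ} (h : i ≤ j) : T.offset k i ≤ T.offset k j :=
  Finset.sum_le_sum_of_subset (Finset.range_mono h)

theorem offset_zero (k : ℕ) : T.offset k 0 = 0 := rfl

theorem offset_width (k : ℕ) : T.offset k (T.width k) = T.width (k + 1) := rfl

theorem width_one : T.width 1 = 1 := by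
  change ∑ i ∈ Finset.range 1, T.children 0 i = 1
  simp [T.children_root]

theorem width_pos [h : Infinite T.Vertex] (k : ℕ) : 0 < T.width k := by
  by_contra hk
  have hk0 : T.width k = 0 := by omega
  have hz : ∀ m, T.width (k + m) = 0 := by
    intro m
    induction m with
    | zero => exact hk0
    | succ m ih =>
      rw [← add_assoc, ← offset_width, ih]; rfl
  have hlt : ∀ v : T.Vertex, v.height < k := by
    intro v
    by_contra hlt
    have h1 := hz (v.height - k)
    rw [Nat.add_sub_cancel' (by omega)] at h1
    have := v.lt
    omega
  refine h.not_finite (Finite.of_injective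
    (β := (Finset.range k).sigma fun m => Finset.range (T.width m))
    (fun v => ⟨⟨v.height, v.idx⟩, by simp [hlt v, v.lt]⟩) ?_)
  intro u v huv
  simp only [Subtype.mk.injEq, Sigma.mk.injEq, heq_eq_eq] at huv
  exact Vertex.ext huv.1 huv.2

/-- The index of the parent of the `j`-th vertex at height `k + 1`. -/
def parentIdx (k j : ℕ) : ℕ := sInf {i | j < T.offset k (i + 1)}

theorem parentIdx_spec {k j : ℕ} (h : j < T.width (k + 1)) :
    T.parentIdx k j < T.width k ∧ T.offset k (T.parentIdx k j) ≤ j ∧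
      j < T.offset k (T.parentIdx k j + 1) := by
  have hw : 0 < T.width k := by
    by_contra h0
    have h0 : T.width k = 0 := by omega
    rw [← offset_width, h0, offset_zero] at h
    omega
  have hmem : T.width k - 1 ∈ {i | j < T.offset k (i + 1)} := by
    change j < T.offset k (T.width k - 1 + 1)
    rwa [Nat.sub_add_cancel hw, offset_width]
  have h1 : T.parentIdx k j ≤ T.width k - 1 := Nat.sInf_le hmem
  refine ⟨by omega, ?_, Nat.sInf_mem ⟨_, hmem⟩⟩
  by_contra hlt
  rcases Nat.eq_zero_or_pos (T.parentIdx k j) with h0 | h0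
  · rw [h0, offset_zero] at hlt; omega
  · have : T.parentIdx k j - 1 ∈ {i | j < T.offset k (i + 1)} := by
      change j < T.offset k (T.parentIdx k j - 1 + 1)
      rw [Nat.sub_add_cancel h0]; omega
    have := Nat.sInf_le this
    change T.parentIdx k j ≤ _ at this
    omega

theorem parentIdx_eq {k j i : ℕ} (h1 : T.offset k i ≤ j) (h2 : j < T.offset k (i + 1)) :
    T.parentIdx k j = i := by
  have h0 : T.parentIdx k j ≤ i := Nat.sInf_le (s := {i | j < T.offset k (i + 1)}) h2
  refine le_antisymm h0 ?_
  by_contra hlt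
  have h3 : j < T.offset k (T.parentIdx k j + 1) :=
    Nat.sInf_mem (s := {i | j < T.offset k (i + 1)}) ⟨i, h2⟩
  have := T.offset_mono k (show T.parentIdx k j + 1 ≤ i by omega)
  omega

/-- The vertices of the causal triangulation of a tree: the vertices of the tree other than its
root. The height in the triangulation is one less than the height in the tree. -/
@[ext] structure CVertex : Type where
  height : ℕ
  idx : ℕ
  lt : idx < T.width (height + 1)

/-- The vertices of the triangulation other than the central one. Here `lev` is
the height in the triangulation minus one, that is, the height in the tree minus two. -/
@[ext] structure NVertex : Type where
  lev : ℕ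
  idx : ℕ
  lt : idx < T.width (lev + 2)

/-- The oriented edges of the causal triangulation of a tree. To each vertex `v` other than the
central one there belong three edges: the tree edge joining `v` to its parent (`treeDown` is
oriented from `v` to its parent), the edge of the cycle joining `v` to the cyclically next vertex to
the right at the same height (`cycRight` is oriented from `v`), and the added edge from `v` to
the next height, to the right of all tree edges from `v` to its children (`extUp` is oriented
from `v`). -/
inductive CDart : Type
  | treeUp (v : T.NVertex)
  | treeDown (v : T.NVertex)
  | cycRight (v : T.NVertex)
  | cycLeft (v : T.NVertex)
  | extUp (v : T.NVertex)
  | extDown (v : T.NVertex)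

variable {T}

/-- A noncentral vertex as a vertex. -/
def NVertex.toC (v : T.NVertex) : T.CVertex := ⟨v.lev + 1, v.idx, v.lt⟩

/-- The parent of a noncentral vertex. -/
def NVertex.parent (v : T.NVertex) : T.CVertex :=
  ⟨v.lev, T.parentIdx (v.lev + 1) v.idx, (T.parentIdx_spec v.lt).1⟩

theorem NVertex.pos (v : T.NVertex) : 0 < T.width (v.lev + 2) := lt_of_le_of_lt (Nat.zero_le _) v.lt

/-- The cyclically next vertex to the right at the same height. -/
def NVertex.right (v : T.NVertex) : T.NVertex :=
  ⟨v.lev, if v.idx + 1 < T.width (v.lev + 2) then v.idx + 1 else 0, by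
    have := v.pos
    split_ifs <;> assumption⟩

/-- The cyclically next vertex to the left at the same height. -/
def NVertex.left (v : T.NVertex) : T.NVertex :=
  ⟨v.lev, if v.idx = 0 then T.width (v.lev + 2) - 1 else v.idx - 1, by
    have := v.lt
    split_ifs <;> omega⟩

theorem NVertex.right_left (v : T.NVertex) : v.left.right = v := by
  obtain ⟨k, i, h⟩ := v
  simp only [NVertex.right, NVertex.left, NVertex.mk.injEq, true_and]
  split_ifs <;> omega

theorem NVertex.left_right (v : T.NVertex) : v.right.left = v := by
  obtain ⟨k, i, h⟩ := v
  by_cases h1 : i + 1 < T.width (k + 2)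
  · simp [NVertex.right, NVertex.left, h1]
  · simp only [NVertex.right, NVertex.left, NVertex.mk.injEq, true_and, h1, if_false, if_true]
    omega

theorem offset_succ_le_width (v : T.NVertex) :
    T.offset (v.lev + 2) (v.idx + 1) ≤ T.width (v.lev + 3) := by
  rw [← offset_width]
  exact T.offset_mono _ v.lt

/-- The endpoint of the added edge starting at `v`: the vertex at the next height that follows
cyclically to the right of the children of `v` (and of the children of the vertices to the left
of `v`). -/
def NVertex.apex [Infinite T.Vertex] (v : T.NVertex) : T.NVertex :=
  ⟨v.lev + 1, if T.offset (v.lev + 2) (v.idx + 1) < T.width (v.lev + 3)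
    then T.offset (v.lev + 2) (v.idx + 1) else 0, by
    have := T.width_pos (v.lev + 3)
    change _ < T.width (v.lev + 3)
    split_ifs <;> assumption⟩

namespace CDart

/-- The origin of an oriented edge. -/
def org [Infinite T.Vertex] : T.CDart → T.CVertex
  | treeUp v => v.parent
  | treeDown v => v.toC
  | cycRight v => v.toC
  | cycLeft v => v.right.toC
  | extUp v => v.toC
  | extDown v => v.apex.toC

/-- Reversal of orientation. -/
def opp : T.CDart → T.CDart
  | treeUp v => treeDown v
  | treeDown v => treeUp v
  | cycRight v => cycLeft v
  | cycLeft v => cycRight v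
  | extUp v => extDown v
  | extDown v => extUp v

/-- The leftmost edge from `u` to the next height. -/
def firstUp (u : T.NVertex) : T.CDart :=
  if h : T.children (u.lev + 2) u.idx = 0 then extUp u
  else treeUp ⟨u.lev + 1, T.offset (u.lev + 2) u.idx, by
    have h1 := T.offset_succ (u.lev + 2) u.idx
    have h2 := offset_succ_le_width u
    change _ < T.width (u.lev + 3)
    omega⟩

/-- The edge that follows the tree edge to `v` on the right among the edges from the parent of `v`
to the height of `v`. -/
def nextUp : T.NVertex → T.CDart
  | ⟨0, j, h⟩ => treeUp (NVertex.right ⟨0, j, h⟩)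
  | ⟨k + 1, j, h⟩ =>
    if h1 : j + 1 < T.offset (k + 2) (T.parentIdx (k + 2) j + 1) then
      treeUp ⟨k + 1, j + 1, by
        have := offset_succ_le_width (T := T)
          ⟨k, T.parentIdx (k + 2) j, (T.parentIdx_spec h).1⟩
        change T.offset (k + 2) (T.parentIdx (k + 2) j + 1) ≤ T.width (k + 3) at this
        change _ < T.width (k + 3)
        omega⟩
    else extUp ⟨k, T.parentIdx (k + 2) j, (T.parentIdx_spec h).1⟩

/-- The next oriented edge along the boundary of the triangle on the left. A triangle above a cycle
edge `v → v.right` consists of this edge, the leftmost edge from `v.right` to the next height and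
the added edge of `v`; a triangle below it consists of this edge, the tree edge from the parent
of `v` to `v`, and the edge that follows the latter on the right. -/
def next : T.CDart → T.CDart
  | cycRight v => firstUp v.right
  | extDown v => cycRight v
  | cycLeft v => treeDown v
  | treeDown v => nextUp v
  | treeUp ⟨0, j, h⟩ => cycLeft (NVertex.left ⟨0, j, h⟩)
  | treeUp ⟨k + 1, j, h⟩ =>
    if T.offset (k + 2) (T.parentIdx (k + 2) j) = j then
      extDown (NVertex.left ⟨k, T.parentIdx (k + 2) j, (T.parentIdx_spec h).1⟩)
    else cycLeft ⟨k + 1, j - 1, lt_of_le_of_lt (Nat.sub_le _ _) h⟩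
  | extUp v =>
    if h : T.children (v.lev + 2) v.idx = 0 then extDown v.left
    else cycLeft ⟨v.lev + 1, T.offset (v.lev + 2) (v.idx + 1) - 1, by
      have h1 := T.offset_succ (v.lev + 2) v.idx
      have h2 := offset_succ_le_width v
      change _ < T.width (v.lev + 3)
      omega⟩

theorem opp_opp (d : T.CDart) : d.opp.opp = d := by cases d <;> rfl

theorem opp_ne (d : T.CDart) : d.opp ≠ d := by cases d <;> simp [opp]

theorem next_firstUp (u : T.NVertex) : next (firstUp u) = extDown u.left := by
  obtain ⟨k, i, h⟩ := u
  unfold firstUp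
  dsimp only
  split_ifs with h0
  · simp [next, h0]
  · have h1 := T.offset_succ (k + 2) i
    have h2 : T.parentIdx (k + 2) (T.offset (k + 2) i) = i :=
      T.parentIdx_eq le_rfl (by omega)
    simp only [next, h2, if_true]

theorem next_nextUp (v : T.NVertex) : next (nextUp v) = cycLeft v := by
  obtain ⟨k, j, h⟩ := v
  cases k with
  | zero =>
    change cycLeft (NVertex.left (NVertex.right ⟨0, j, h⟩)) = _
    rw [NVertex.left_right]
  | succ k =>
    have h : j < T.width (k + 2 + 1) := h
    obtain ⟨h1, h2, h3⟩ := T.parentIdx_spec h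
    have h4 := T.offset_succ (k + 2) (T.parentIdx (k + 2) j)
    simp only [nextUp]
    split_ifs with h0
    · have h5 : T.parentIdx (k + 2) (j + 1) = T.parentIdx (k + 2) j :=
        T.parentIdx_eq (by omega) h0
      have h6 : ¬ T.offset (k + 2) (T.parentIdx (k + 2) j) = j + 1 := by omega
      simp only [next, h5, h6, if_false]
      rfl
    · have h6 : ¬ T.children (k + 2) (T.parentIdx (k + 2) j) = 0 := by omega
      have h7 : T.offset (k + 2) (T.parentIdx (k + 2) j + 1) - 1 = j := by omega
      simp only [next, h6, h7, dite_false]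

/-- An edge to the next height is the leftmost one of its origin or follows a tree edge. -/
theorem treeUp_cases (v : T.NVertex) :
    (∃ u, treeUp v = firstUp u) ∨ (∃ u, treeUp v = nextUp u) := by
  obtain ⟨k, j, h⟩ := v
  cases k with
  | zero =>
    right
    refine ⟨NVertex.left ⟨0, j, h⟩, ?_⟩
    change _ = treeUp (NVertex.right (NVertex.left ⟨0, j, h⟩))
    rw [NVertex.right_left]
  | succ k =>
    have h' : j < T.width (k + 2 + 1) := h
    obtain ⟨h1, h2, h3⟩ := T.parentIdx_spec h'
    have h4 := T.offset_succ (k + 2) (T.parentIdx (k + 2) j)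
    by_cases h0 : T.offset (k + 2) (T.parentIdx (k + 2) j) = j
    · left
      refine ⟨⟨k, T.parentIdx (k + 2) j, h1⟩, ?_⟩
      have h6 : ¬ T.children (k + 2) (T.parentIdx (k + 2) j) = 0 := by omega
      simp only [firstUp, h6, dite_false, h0]
    · right
      have h5 : T.parentIdx (k + 2) (j - 1) = T.parentIdx (k + 2) j :=
        T.parentIdx_eq (by omega) (by omega)
      have h6 : j - 1 + 1 = j := by omega
      refine ⟨⟨k + 1, j - 1, lt_of_le_of_lt (Nat.sub_le _ _) h⟩, ?_⟩
      simp only [nextUp, h5, h6, h3, dite_true]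

theorem extUp_cases (v : T.NVertex) :
    (∃ u, extUp v = firstUp u) ∨ (∃ u, extUp v = nextUp u) := by
  obtain ⟨k, i, h⟩ := v
  by_cases h0 : T.children (k + 2) i = 0
  · left
    exact ⟨⟨k, i, h⟩, by simp only [firstUp, h0, dite_true]⟩
  · right
    have h1 := T.offset_succ (k + 2) i
    have h2 := offset_succ_le_width ⟨k, i, h⟩
    change T.offset (k + 2) (i + 1) ≤ T.width (k + 3) at h2
    refine ⟨⟨k + 1, T.offset (k + 2) (i + 1) - 1, ?_⟩, ?_⟩
    · change _ < T.width (k + 3)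
      omega
    · have h5 : T.parentIdx (k + 2) (T.offset (k + 2) (i + 1) - 1) = i :=
        T.parentIdx_eq (by omega) (by omega)
      have h6 : ¬ T.offset (k + 2) (i + 1) - 1 + 1 < T.offset (k + 2) (i + 1) := by omega
      simp only [nextUp, h5, h6, dite_false]

theorem next_next_next (d : T.CDart) : next (next (next d)) = d := by
  have hF : ∀ u : T.NVertex, next (next (next (firstUp u))) = firstUp u := by
    intro u
    rw [next_firstUp]
    change firstUp (NVertex.right (NVertex.left u)) = _
    rw [NVertex.right_left]
  have hN : ∀ u : T.NVertex, next (next (next (nextUp u))) = nextUp u := by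
    intro u
    rw [next_nextUp]
    rfl
  cases d with
  | treeUp v =>
    rcases treeUp_cases v with ⟨u, hu⟩ | ⟨u, hu⟩
    · rw [hu, hF]
    · rw [hu, hN]
  | extUp v =>
    rcases extUp_cases v with ⟨u, hu⟩ | ⟨u, hu⟩
    · rw [hu, hF]
    · rw [hu, hN]
  | treeDown v =>
    change next (next (nextUp v)) = _
    rw [next_nextUp]
    rfl
  | cycLeft v =>
    change next (nextUp v) = _
    rw [next_nextUp]
  | cycRight v =>
    change next (next (firstUp v.right)) = _
    rw [next_firstUp, NVertex.left_right]
    rfl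
  | extDown v =>
    change next (firstUp v.right) = _
    rw [next_firstUp, NVertex.left_right]

theorem next_ne (d : T.CDart) : next d ≠ d := by
  have hF : ∀ u : T.NVertex, next (firstUp u) ≠ firstUp u := by
    intro u
    rw [next_firstUp]
    unfold firstUp
    split_ifs <;> simp
  have hN : ∀ u : T.NVertex, next (nextUp u) ≠ nextUp u := by
    rintro ⟨k, j, h⟩
    rw [next_nextUp]
    cases k with
    | zero => simp [nextUp]
    | succ k =>
      simp only [nextUp]
      split_ifs <;> simp
  cases d with
  | treeUp v =>
    rcases treeUp_cases v with ⟨u, hu⟩ | ⟨u, hu⟩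
    · rw [hu]; exact hF u
    · rw [hu]; exact hN u
  | extUp v =>
    rcases extUp_cases v with ⟨u, hu⟩ | ⟨u, hu⟩
    · rw [hu]; exact hF u
    · rw [hu]; exact hN u
  | treeDown v =>
    intro h
    have := next_nextUp v
    change nextUp v = _ at h
    rw [h] at this
    change nextUp v = _ at this
    rw [h] at this
    simp at this
  | cycLeft v => simp [next]
  | cycRight v =>
    change firstUp v.right ≠ _
    unfold firstUp
    split_ifs <;> simp
  | extDown v => simp [next]


theorem org_firstUp [Infinite T.Vertex] (u : T.NVertex) : org (firstUp u) = u.toC := by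
  obtain ⟨k, i, h⟩ := u
  unfold firstUp
  dsimp only
  split_ifs with h0
  · rfl
  · have h1 := T.offset_succ (k + 2) i
    have h2 : T.parentIdx (k + 2) (T.offset (k + 2) i) = i :=
      T.parentIdx_eq le_rfl (by omega)
    simp only [org, NVertex.parent, NVertex.toC, h2]

theorem org_nextUp [Infinite T.Vertex] (v : T.NVertex) : org (nextUp v) = v.parent := by
  obtain ⟨k, j, h⟩ := v
  cases k with
  | zero =>
    have h1 := (NVertex.parent (T := T) ⟨0, j, h⟩).lt
    have h2 := (NVertex.parent (T := T) (NVertex.right ⟨0, j, h⟩)).lt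
    have h3 := T.width_one
    change T.parentIdx 1 _ < T.width 1 at h1
    change T.parentIdx 1 _ < T.width 1 at h2
    simp only [nextUp, org]
    ext
    · rfl
    · change T.parentIdx 1 _ = T.parentIdx 1 _
      omega
  | succ k =>
    obtain ⟨h1, h2, h3⟩ := T.parentIdx_spec (k := k + 2) h
    simp only [nextUp]
    split_ifs with h0
    · have h5 : T.parentIdx (k + 2) (j + 1) = T.parentIdx (k + 2) j :=
        T.parentIdx_eq (by omega) h0
      simp only [org, NVertex.parent, h5]
    · rfl

theorem org_opp_nextUp [Infinite T.Vertex] (v : T.NVertex) :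
    org (opp (nextUp v)) = v.right.toC := by
  obtain ⟨k, j, h⟩ := v
  cases k with
  | zero => rfl
  | succ k =>
    obtain ⟨h1, h2, h3⟩ := T.parentIdx_spec (k := k + 2) h
    have h4 := offset_succ_le_width (T := T) ⟨k, T.parentIdx (k + 2) j, h1⟩
    change T.offset (k + 2) (T.parentIdx (k + 2) j + 1) ≤ T.width (k + 3) at h4
    simp only [nextUp]
    split_ifs with h0
    · have h5 : j + 1 < T.width (k + 1 + 2) := lt_of_lt_of_le h0 h4
      simp only [org, opp, NVertex.right, NVertex.toC, h5, if_true]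
    · have h6 : T.offset (k + 2) (T.parentIdx (k + 2) j + 1) = j + 1 := by omega
      simp only [org, opp, NVertex.right, NVertex.toC, NVertex.apex, h6]

theorem apex_left [Infinite T.Vertex] (u : T.NVertex) :
    u.left.apex.idx = if T.offset (u.lev + 2) u.idx < T.width (u.lev + 3)
      then T.offset (u.lev + 2) u.idx else 0 := by
  obtain ⟨k, i, h⟩ := u
  simp only [NVertex.left, NVertex.apex]
  by_cases hi : i = 0
  · have h1 : T.width (k + 2) - 1 + 1 = T.width (k + 2) := by omega
    simp [hi, h1, offset_width, offset_zero]
  · have h1 : i - 1 + 1 = i := by omega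
    simp [hi, h1]

theorem org_opp_firstUp [Infinite T.Vertex] (u : T.NVertex) :
    org (opp (firstUp u)) = u.left.apex.toC := by
  have hl := apex_left u
  obtain ⟨k, i, h⟩ := u
  have h1 := T.offset_succ (k + 2) i
  have h4 := offset_succ_le_width (T := T) ⟨k, i, h⟩
  change T.offset (k + 2) (i + 1) ≤ T.width (k + 3) at h4
  unfold firstUp
  dsimp only at hl ⊢
  split_ifs with h0
  · ext
    · rfl
    · rw [h0] at h1
      simp only [org, opp, NVertex.toC]
      rw [hl, NVertex.apex]
      simp only [h1, Nat.add_zero]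
  · ext
    · rfl
    · simp only [org, opp, NVertex.toC]
      rw [hl, if_pos (by omega)]

theorem org_next [Infinite T.Vertex] (d : T.CDart) : org (next d) = org (opp d) := by
  have hF : ∀ u : T.NVertex, org (next (firstUp u)) = org (opp (firstUp u)) := by
    intro u
    rw [next_firstUp, org_opp_firstUp]
    rfl
  have hN : ∀ u : T.NVertex, org (next (nextUp u)) = org (opp (nextUp u)) := by
    intro u
    rw [next_nextUp, org_opp_nextUp]
    rfl
  cases d with
  | treeUp v =>
    rcases treeUp_cases v with ⟨u, hu⟩ | ⟨u, hu⟩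
    · rw [hu, hF]
    · rw [hu, hN]
  | extUp v =>
    rcases extUp_cases v with ⟨u, hu⟩ | ⟨u, hu⟩
    · rw [hu, hF]
    · rw [hu, hN]
  | treeDown v => exact org_nextUp v
  | cycLeft v => rfl
  | cycRight v => exact org_firstUp v.right
  | extDown v => rfl

/-- Being related by iterates of the rotation around the origin. -/
abbrev RotEq : T.CDart → T.CDart → Prop :=
  Relation.EqvGen fun a b => b = opp (next (next a))

theorem RotEq.of_eq {a b : T.CDart} (h : b = opp (next (next a))) : RotEq a b :=
  Relation.EqvGen.rel _ _ h

theorem rot_cycRight (v : T.NVertex) : RotEq (cycRight v) (extUp v) := by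
  refine .of_eq ?_
  change _ = opp (next (firstUp v.right))
  rw [next_firstUp, NVertex.left_right]
  rfl

theorem rot_extDown (v : T.NVertex) : RotEq (extDown v) (opp (firstUp v.right)) :=
  .of_eq rfl

theorem rot_treeDown (v : T.NVertex) : RotEq (treeDown v) (cycRight v) := by
  refine .of_eq ?_
  change _ = opp (next (nextUp v))
  rw [next_nextUp]
  rfl

theorem rot_cycLeft (v : T.NVertex) : RotEq (cycLeft v) (opp (nextUp v)) :=
  .of_eq rfl

theorem rot_firstUp (u : T.NVertex) : RotEq (firstUp u) (cycLeft u.left) := by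
  refine .of_eq ?_
  rw [next_firstUp]
  rfl

theorem rot_nextUp (v : T.NVertex) : RotEq (nextUp v) (treeUp v) := by
  refine .of_eq ?_
  rw [next_nextUp]
  rfl

theorem rot_treeUp_zero (j : ℕ) (h : j < T.width (0 + 2)) :
    RotEq (treeUp (T := T) ⟨0, j, h⟩) (treeUp ⟨0, 0, lt_of_le_of_lt (Nat.zero_le _) h⟩) := by
  induction j with
  | zero => exact .refl _
  | succ j ih =>
    have h' : j < T.width (0 + 2) := by omega
    refine .trans _ _ _ ?_ (ih h')
    have := rot_nextUp (T := T) ⟨0, j, h'⟩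
    simpa only [nextUp, NVertex.right, h, if_true] using this

theorem rot_treeUp_succ (n : ℕ) : ∀ (k j : ℕ) (h : j < T.width (k + 1 + 2)),
    T.offset (k + 2) (T.parentIdx (k + 2) j + 1) = j + 1 + n →
    RotEq (treeUp (T := T) ⟨k + 1, j, h⟩)
      (cycRight ⟨k, T.parentIdx (k + 2) j, (T.parentIdx_spec h).1⟩) := by
  induction n with
  | zero =>
    intro k j h hn
    have h1 := rot_nextUp (T := T) ⟨k + 1, j, h⟩
    have h0 : ¬ j + 1 < T.offset (k + 2) (T.parentIdx (k + 2) j + 1) := by omega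
    simp only [nextUp, h0, dite_false] at h1
    exact .trans _ _ _ (.symm _ _ h1) (.symm _ _ (rot_cycRight _))
  | succ n ih =>
    intro k j h hn
    have h1 := rot_nextUp (T := T) ⟨k + 1, j, h⟩
    have h0 : j + 1 < T.offset (k + 2) (T.parentIdx (k + 2) j + 1) := by omega
    obtain ⟨h3, h4, -⟩ := T.parentIdx_spec (k := k + 2) h
    have h5 : T.parentIdx (k + 2) (j + 1) = T.parentIdx (k + 2) j :=
        T.parentIdx_eq (by omega) h0
    have h6 := offset_succ_le_width (T := T) ⟨k, T.parentIdx (k + 2) j, h3⟩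
    change T.offset (k + 2) (T.parentIdx (k + 2) j + 1) ≤ T.width (k + 3) at h6
    simp only [nextUp, h0, dite_true] at h1
    have h7 := ih k (j + 1) (lt_of_lt_of_le h0 h6) (by rw [h5]; omega)
    simp only [h5] at h7
    exact .trans _ _ _ (.symm _ _ h1) h7

theorem rot_treeUp (k j : ℕ) (h : j < T.width (k + 1 + 2)) :
    RotEq (treeUp (T := T) ⟨k + 1, j, h⟩)
      (cycRight ⟨k, T.parentIdx (k + 2) j, (T.parentIdx_spec h).1⟩) := by
  have := (T.parentIdx_spec (k := k + 2) h).2.2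
  exact rot_treeUp_succ (T.offset (k + 2) (T.parentIdx (k + 2) j + 1) - (j + 1)) k j h (by omega)

theorem rot_firstUp' (u : T.NVertex) : RotEq (firstUp u) (cycRight u) := by
  obtain ⟨k, i, h⟩ := u
  unfold firstUp
  dsimp only
  split_ifs with h0
  · exact .symm _ _ (rot_cycRight _)
  · have h1 := T.offset_succ (k + 2) i
    have h2 : T.parentIdx (k + 2) (T.offset (k + 2) i) = i :=
      T.parentIdx_eq le_rfl (by omega)
    have h4 := offset_succ_le_width (T := T) ⟨k, i, h⟩
    change T.offset (k + 2) (i + 1) ≤ T.width (k + 3) at h4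
    have h3 := rot_treeUp (T := T) k (T.offset (k + 2) i)
      (show _ < T.width (k + 3) by omega)
    simpa only [h2] using h3

theorem rot_cycLeft' (v : T.NVertex) : RotEq (cycLeft v) (cycRight v.right) := by
  have h1 := rot_firstUp v.right
  rw [NVertex.left_right] at h1
  exact .trans _ _ _ (.symm _ _ h1) (rot_firstUp' _)

theorem rot_extDown_of_ne [Infinite T.Vertex] (v : T.NVertex)
    (h0 : T.children (v.lev + 2) v.idx ≠ 0) : RotEq (extDown v) (cycRight v.apex) := by
  obtain ⟨k, i, h⟩ := v
  dsimp only at h0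
  have h1 := T.offset_succ (k + 2) i
  have h4 := offset_succ_le_width (T := T) ⟨k, i, h⟩
  change T.offset (k + 2) (i + 1) ≤ T.width (k + 3) at h4
  have h5 : T.parentIdx (k + 2) (T.offset (k + 2) (i + 1) - 1) = i :=
    T.parentIdx_eq (by omega) (by omega)
  have h6 : ¬ T.offset (k + 2) (i + 1) - 1 + 1 < T.offset (k + 2) (i + 1) := by omega
  have h7 : T.offset (k + 2) (i + 1) - 1 + 1 = T.offset (k + 2) (i + 1) := by omega
  have h8 : T.offset (k + 2) (i + 1) - 1 < T.width (k + 1 + 2) :=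
    show _ < T.width (k + 3) by omega
  have h9 := rot_cycLeft (T := T) ⟨k + 1, T.offset (k + 2) (i + 1) - 1, h8⟩
  simp only [nextUp, h5, h6, dite_false] at h9
  have h10 := rot_cycLeft' (T := T) ⟨k + 1, T.offset (k + 2) (i + 1) - 1, h8⟩
  simp only [NVertex.right, h7] at h10
  exact .trans _ _ _ (.symm _ _ h9) h10

theorem rot_extDown_of_left [Infinite T.Vertex] (v : T.NVertex)
    (h0 : T.children (v.lev + 2) v.idx = 0) (h : RotEq (extDown v.left) (cycRight v.left.apex)) :
    RotEq (extDown v) (cycRight v.apex) := by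
  have h1 := rot_extDown v.left
  rw [NVertex.right_left] at h1
  have h2 : firstUp v = extUp v := by simp only [firstUp, h0, dite_true]
  rw [h2] at h1
  have h3 : v.left.apex = v.apex := by
    have h4 := T.offset_succ (v.lev + 2) v.idx
    rw [h0] at h4
    ext
    · rfl
    · rw [apex_left, NVertex.apex]
      simp only [h4, Nat.add_zero]
  rw [h3] at h
  exact .trans _ _ _ (.symm _ _ h1) h

theorem rot_extDown' [Infinite T.Vertex] (v : T.NVertex) :
    RotEq (extDown v) (cycRight v.apex) := by
  obtain ⟨k, i, h⟩ := v
  have step : ∀ (i : ℕ) (h : i + 1 < T.width (k + 2)),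
      RotEq (extDown (T := T) ⟨k, i, by omega⟩) (cycRight (NVertex.apex ⟨k, i, by omega⟩)) →
      RotEq (extDown (T := T) ⟨k, i + 1, h⟩) (cycRight (NVertex.apex ⟨k, i + 1, h⟩)) := by
    intro i h hi
    by_cases h0 : T.children (k + 2) (i + 1) = 0
    · refine rot_extDown_of_left _ h0 ?_
      simpa [NVertex.left] using hi
    · exact rot_extDown_of_ne _ h0
  have up : ∀ (m : ℕ) (hm : m < T.width (k + 2)),
      RotEq (extDown (T := T) ⟨k, m, hm⟩) (cycRight (NVertex.apex ⟨k, m, hm⟩)) →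
      ∀ (n : ℕ) (hn : m + n < T.width (k + 2)),
      RotEq (extDown (T := T) ⟨k, m + n, hn⟩) (cycRight (NVertex.apex ⟨k, m + n, hn⟩)) := by
    intro m hm h0 n
    induction n with
    | zero => intro _; exact h0
    | succ n ih =>
      intro hn
      exact step (m + n) hn (ih (by omega))
  obtain ⟨m, hm, hm0⟩ : ∃ m, m < T.width (k + 2) ∧ T.children (k + 2) m ≠ 0 := by
    by_contra hcon
    push Not at hcon
    have h1 : T.width (k + 3) = 0 := by
      rw [← offset_width]
      exact Finset.sum_eq_zero fun m hm => hcon m (Finset.mem_range.1 hm)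
    have := T.width_pos (k + 3)
    omega
  have hlast := up m hm (rot_extDown_of_ne _ hm0) (T.width (k + 2) - 1 - m) (by omega)
  have hzero : RotEq (extDown (T := T) ⟨k, 0, by omega⟩)
      (cycRight (NVertex.apex ⟨k, 0, by omega⟩)) := by
    by_cases h0 : T.children (k + 2) 0 = 0
    · refine rot_extDown_of_left _ h0 ?_
      have h2 : m + (T.width (k + 2) - 1 - m) = T.width (k + 2) - 1 := by omega
      simpa [NVertex.left, h2] using hlast
    · exact rot_extDown_of_ne _ h0
  have := up 0 (by omega) hzero i (by omega)
  simpa using this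

/-- A chosen oriented edge with a given origin. -/
def canon [Infinite T.Vertex] : T.CVertex → T.CDart
  | ⟨0, _, _⟩ => treeUp ⟨0, 0, T.width_pos 2⟩
  | ⟨k + 1, i, h⟩ => cycRight ⟨k, i, h⟩

theorem rot_canon [Infinite T.Vertex] (d : T.CDart) : RotEq d (canon (org d)) := by
  cases d with
  | treeUp v =>
    obtain ⟨k, j, h⟩ := v
    cases k with
    | zero => exact rot_treeUp_zero j h
    | succ k => exact rot_treeUp k j h
  | treeDown v => exact rot_treeDown v
  | cycRight v => exact .refl _
  | cycLeft v => exact rot_cycLeft' v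
  | extUp v => exact .symm _ _ (rot_cycRight v)
  | extDown v => exact rot_extDown' v

theorem org_canon [Infinite T.Vertex] (v : T.CVertex) : org (canon v) = v := by
  obtain ⟨k, i, h⟩ := v
  cases k with
  | zero =>
    have h1 := T.width_one
    have h2 := (NVertex.parent (T := T) ⟨0, 0, T.width_pos 2⟩).lt
    change _ < T.width 1 at h2
    change i < T.width 1 at h
    ext
    · rfl
    · change (NVertex.parent (T := T) ⟨0, 0, T.width_pos 2⟩).idx = i
      omega
  | succ k => rfl

theorem finite_org [Infinite T.Vertex] (v : T.CVertex) : {d : T.CDart | org d = v}.Finite := by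
  have hN : {u : T.NVertex | u.lev ≤ v.height}.Finite := by
    refine Set.Finite.of_finite_image (f := fun u : T.NVertex => (⟨u.lev, u.idx⟩ : Σ _ : ℕ, ℕ))
      (((Finset.range (v.height + 1)).sigma fun k =>
        Finset.range (T.width (k + 2))).finite_toSet.subset ?_) ?_
    · rintro _ ⟨u, hu, rfl⟩
      have hu : u.lev ≤ v.height := hu
      simp [u.lt, hu]
    · intro u _ u' _ huu
      simp only [Sigma.mk.injEq, heq_eq_eq] at huu
      exact NVertex.ext huu.1 huu.2
  refine ((((((hN.image treeUp).union (hN.image treeDown)).union (hN.image cycRight)).union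
    (hN.image cycLeft)).union (hN.image extUp)).union (hN.image extDown)).subset ?_
  rintro d rfl
  cases d <;> simp [org, NVertex.parent, NVertex.toC, NVertex.right, NVertex.apex]
  omega

end CDart

/-- Adjacency of distinct vertices in the triangulation. -/
def cgraph (T : PlanarTree) [Infinite T.Vertex] : SimpleGraph T.CVertex :=
  SimpleGraph.fromRel fun u v => ∃ d : T.CDart, d.org = u ∧ d.opp.org = v

theorem cgraph_adj [Infinite T.Vertex] (d : T.CDart) (h : d.org ≠ d.opp.org) :
    T.cgraph.Adj d.org d.opp.org :=
  ⟨h, Or.inl ⟨d, rfl, rfl⟩⟩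

theorem height_le_of_dart [Infinite T.Vertex] (d : T.CDart) :
    d.opp.org.height ≤ d.org.height + 1 := by
  cases d <;> simp [CDart.org, CDart.opp, NVertex.parent, NVertex.toC, NVertex.right, NVertex.apex]
  omega

theorem height_le_of_adj [Infinite T.Vertex] {u v : T.CVertex} (h : T.cgraph.Adj u v) :
    v.height ≤ u.height + 1 := by
  rcases h.2 with ⟨d, rfl, rfl⟩ | ⟨d, rfl, rfl⟩
  · exact height_le_of_dart d
  · have := height_le_of_dart d.opp
    rwa [CDart.opp_opp] at this

theorem height_le_of_walk [Infinite T.Vertex] {u v : T.CVertex} (p : T.cgraph.Walk u v) :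
    v.height ≤ u.height + p.length := by
  induction p with
  | nil => simp
  | cons h p ih =>
    have := height_le_of_adj h
    rw [SimpleGraph.Walk.length_cons]
    omega

theorem CVertex.eq_of_height_zero {u v : T.CVertex} (hu : u.height = 0) (hv : v.height = 0) :
    u = v := by
  obtain ⟨k, i, h⟩ := u
  obtain ⟨l, j, h'⟩ := v
  dsimp only at hu hv
  subst hu hv
  have h : i < T.width 1 := h
  have h' : j < T.width 1 := h'
  have := T.width_one
  ext
  · rfl
  · dsimp only
    omega

theorem exists_walk [Infinite T.Vertex] {r : T.CVertex} (hr : r.height = 0) :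
    ∀ (k : ℕ) (v : T.CVertex), v.height = k → ∃ p : T.cgraph.Walk r v, p.length = k := by
  intro k
  induction k with
  | zero =>
    intro v hv
    obtain rfl := CVertex.eq_of_height_zero hr hv
    exact ⟨.nil, rfl⟩
  | succ k ih =>
    rintro ⟨l, i, h⟩ hv
    dsimp only at hv
    subst hv
    obtain ⟨p, hp⟩ := ih (NVertex.parent ⟨k, i, h⟩) rfl
    have hadj : T.cgraph.Adj (NVertex.parent ⟨k, i, h⟩) ⟨k + 1, i, h⟩ := by
      refine cgraph_adj (CDart.treeUp ⟨k, i, h⟩) ?_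
      intro heq
      have := congrArg CVertex.height heq
      simp [CDart.org, CDart.opp, NVertex.parent, NVertex.toC] at this
    exact ⟨p.concat hadj, by rw [SimpleGraph.Walk.length_concat, hp]⟩

theorem edist_eq_height [Infinite T.Vertex] {r : T.CVertex} (hr : r.height = 0) (v : T.CVertex) :
    T.cgraph.edist r v = v.height := by
  obtain ⟨p, hp⟩ := exists_walk hr _ v rfl
  apply le_antisymm
  · rw [← hp]
    exact SimpleGraph.edist_le p
  · refine le_iInf fun q => ?_
    have := height_le_of_walk q
    rw [hr, Nat.zero_add] at this
    exact_mod_cast this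

theorem cgraph_connected (T : PlanarTree) [Infinite T.Vertex] : T.cgraph.Connected := by
  have hr : ∀ v : T.CVertex,
      T.cgraph.Reachable ⟨0, 0, T.width_pos 1⟩ v := fun v =>
    let ⟨p, _⟩ := exists_walk (r := (⟨0, 0, T.width_pos 1⟩ : T.CVertex)) rfl _ v rfl
    ⟨p⟩
  have : Nonempty T.CVertex := ⟨⟨0, 0, T.width_pos 1⟩⟩
  exact ⟨fun u v => (hr u).symm.trans (hr v)⟩

/-- The triangulated surface of an infinite tree `T`: the root of `T` and its edge are deleted, so
that the vertex at height `1` becomes the central vertex; the vertices at each height `k ≥ 1` are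
joined into a cycle in their cyclic order; and each noncentral vertex gets one more edge to the
next height, to the right of all others. The root edge is the rightmost edge from the central
vertex. -/
def toTriangulation (T : PlanarTree) [Infinite T.Vertex] : RootedTriangulation where
  Dart := T.CDart
  Vertex := T.CVertex
  org := CDart.org
  opp := CDart.opp
  next := CDart.next
  rootDart := CDart.treeUp ⟨0, T.width 2 - 1, Nat.sub_lt (T.width_pos 2) Nat.one_pos⟩
  opp_opp := CDart.opp_opp
  opp_ne := CDart.opp_ne
  next_next_next := CDart.next_next_next
  next_ne := CDart.next_ne
  org_next := CDart.org_next
  org_surjective v := ⟨CDart.canon v, CDart.org_canon v⟩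
  rotation_transitive d d' h :=
    .trans _ _ _ (CDart.rot_canon d) (h ▸ .symm _ _ (CDart.rot_canon d'))
  locallyFinite := CDart.finite_org
  connected := T.cgraph_connected

theorem mem_sphere [Infinite T.Vertex] (k : ℕ) (v : T.CVertex) :
    v ∈ T.toTriangulation.sphere k ↔ v.height = k := by
  change T.cgraph.edist _ v = k ↔ _
  have h : T.cgraph.edist _ v = v.height :=
    edist_eq_height (r := (T.toTriangulation.center : T.CVertex)) rfl v
  exact (Eq.congr_left h).trans Nat.cast_inj

theorem isCausal_toTriangulation (T : PlanarTree) [Infinite T.Vertex] :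
    T.toTriangulation.IsCausal where
  no_loop d h1 h2 := by
    have h1 : (CDart.org d).height = 0 := by
      rw [show CDart.org d = _ from h1]; rfl
    have h2 : (CDart.org (CDart.opp d)).height = 0 := by
      rw [show CDart.org (CDart.opp d) = _ from h2]; rfl
    revert h1 h2
    cases d <;> simp [CDart.org, CDart.opp, NVertex.toC, NVertex.right]
  cycle_connected k hk := by
    obtain ⟨k, rfl⟩ : ∃ m, k = m + 1 := ⟨k - 1, by omega⟩
    have hmem : ∀ (i : ℕ) (h : i < T.width (k + 2)),
        (⟨k + 1, i, h⟩ : T.CVertex) ∈ T.toTriangulation.sphere (k + 1) :=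
      fun i h => (mem_sphere _ _).2 rfl
    have hr : ∀ (i : ℕ) (h : i < T.width (k + 2)),
        (T.toTriangulation.graph.induce (T.toTriangulation.sphere (k + 1))).Reachable
          ⟨⟨k + 1, 0, T.width_pos (k + 2)⟩, hmem _ _⟩ ⟨⟨k + 1, i, h⟩, hmem _ _⟩ := by
      intro i
      induction i with
      | zero => intro _; exact .refl _
      | succ i ih =>
        intro h
        refine (ih (by omega)).trans (SimpleGraph.Adj.reachable ?_)
        have h1 := cgraph_adj (T := T) (CDart.cycRight ⟨k, i, by omega⟩)
        simp only [CDart.org, CDart.opp, NVertex.toC, NVertex.right, h, if_true] at h1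
        exact h1 (by simp)
    have : Nonempty (T.toTriangulation.sphere (k + 1)) := ⟨⟨_, hmem 0 (T.width_pos (k + 2))⟩⟩
    have hr' : ∀ v : T.toTriangulation.sphere (k + 1),
        (T.toTriangulation.graph.induce (T.toTriangulation.sphere (k + 1))).Reachable
          ⟨⟨k + 1, 0, T.width_pos (k + 2)⟩, hmem _ _⟩ v := by
      rintro ⟨⟨l, i, h⟩, hv⟩
      obtain rfl : l = k + 1 := (mem_sphere _ _).1 hv
      exact hr i h
    exact ⟨fun u v => (hr' u).symm.trans (hr' v)⟩
  cycle_degree k hk v hv := by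
    obtain ⟨k, rfl⟩ : ∃ m, k = m + 1 := ⟨k - 1, by omega⟩
    obtain ⟨l, i, h⟩ := v
    obtain rfl : l = k + 1 := (mem_sphere _ _).1 hv
    have : {d : T.CDart | d.org = ⟨k + 1, i, h⟩ ∧
        d.opp.org ∈ T.toTriangulation.sphere (k + 1)} =
        {CDart.cycRight ⟨k, i, h⟩, CDart.cycLeft (NVertex.left ⟨k, i, h⟩)} := by
      ext d
      simp only [Set.mem_ofPred_eq, Set.mem_insert_iff, Set.mem_singleton_iff]
      constructor
      · rintro ⟨h1, h2⟩
        have h2 := (mem_sphere _ _).1 h2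
        have h3 := congrArg CVertex.height h1
        cases d with
        | cycRight u =>
          left
          obtain ⟨l, j, h'⟩ := u
          simp only [CDart.org, NVertex.toC, CVertex.mk.injEq] at h1
          obtain ⟨h1, rfl⟩ := h1
          obtain rfl : l = k := by omega
          rfl
        | cycLeft u =>
          right
          have h4 : u.right = ⟨k, i, h⟩ := by
            simp only [CDart.org, NVertex.toC, CVertex.mk.injEq] at h1
            exact NVertex.ext (by simpa using h1.1) h1.2
          rw [← h4, NVertex.left_right]
        | _ =>
          simp [CDart.org, CDart.opp, NVertex.toC, NVertex.parent, NVertex.apex] at h2 h3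
          omega
      · rintro (rfl | rfl)
        · exact ⟨rfl, (mem_sphere _ _).2 rfl⟩
        · refine ⟨?_, (mem_sphere _ _).2 rfl⟩
          change (NVertex.right (NVertex.left ⟨k, i, h⟩)).toC = _
          rw [NVertex.right_left]
          rfl
    change {d : T.CDart | d.org = ⟨k + 1, i, h⟩ ∧
        d.opp.org ∈ T.toTriangulation.sphere (k + 1)}.ncard = 2
    rw [this]
    exact Set.ncard_pair (by simp)

end PlanarTree

/-- The map `β⁻¹` from infinite trees to infinite causal triangulations. -/
def InfiniteTree.toCausal (T : InfiniteTree) : CausalTriangulation :=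
  haveI := T.2
  ⟨T.1.toTriangulation, T.1.isCausal_toTriangulation⟩

/-- The events of causal triangulations: the sets `A` for which `β(A)` is an event of trees. (As
`β` is an isometry, these are the Borel sets of the metric on causal triangulations.) -/
instance : MeasurableSpace CausalTriangulation :=
  MeasurableSpace.map InfiniteTree.toCausal inferInstance

/-- The measure `ρ(A) = ν(β(A))` on causal triangulations, for a measure `ν` on trees. -/
def causalMeasure (ν : Measure InfiniteTree) : Measure CausalTriangulation :=
  ν.map InfiniteTree.toCausal

/-- The Hausdorff dimension of a graph whose balls of radius `R` have size `b R` exists and is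
equal to `d`. -/
def HasHausdorffDim (b : ℕ → ℝ) (d : ℝ) : Prop :=
  Tendsto (fun R : ℕ => Real.log (b R) / Real.log R) atTop (𝓝 d)

end

/-!
# Growth of generic random trees and of uniform causal triangulations

The generating function of planted trees satisfies `Z = ζ φ(Z)`, and the cycle lemma gives the
number of forests in closed form, as a convolution power of the weights (`forestSum`). Cutting a
tree at a given height, the probability of a ball at finite volume becomes a ratio of numbers of
forests (`finiteVolumeMeasure_ball`).

Genericity makes the tilted weights `p n` a critical offspring law with a finite exponential moment
(`IsGeneric.exists_isCriticalLaw`): `ζ₀ ≥ r / φ(r)` for all `r < z_c`, with equality at the interior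
point `Z₀`, so that `f(s) - s` has a local minimum at `s = 1`. The local limit theorem for `p`
(`IsCriticalLaw.tendsto_sqrt_mul_convPow`, by Fourier inversion on the lattice spanned by the
possible numbers of children) then shows that the ball probabilities converge to those of the
branching process with offspring law `p`, biased by the width at the boundary of the ball
(`IsGeneric.exists_tendsto_ball`). This size-biased law exists, since it is built level by level
from independent choices, and it is unique, since the balls form a `π`-system.

Under the size-biased law, the mean of `h(D) / D`, with `D` the width at a given height, is the mean
of `h` for the branching process (`IsSizeBiased.lintegral_width_div`). With `h(D) = D ^ 2` this
gives the linear growth of the mean width, and hence the mean of the size `B R` of balls. With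
`h(D) = 1` for `D > 0` it gives the mean of `1 / D`, the survival probability of the critical
process, which decays like the inverse of the height (`IsCriticalLaw.exists_survival_le`).

The almost sure bounds only use means along `R = 2 ^ j`. The variables `B(2 ^ j) / 4 ^ j` have
bounded means, and so have the sums of `1 / D` over the heights between `2 ^ j` and `2 ^ (j + 1)`;
by the Cauchy-Schwarz inequality the latter control `4 ^ j / B(2 ^ (j + 1))`. A sequence of
variables with bounded means is almost surely `O(j ^ 2)` (`ae_eventually_le_sq`), and `j` is of
order `log R`.

A ball of a causal triangulation contains at least as many edges as the ball of the same radius of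
its tree, and at most three times as many as the ball of the next radius
(`PlanarTree.ballSize_toTriangulation`), so that the bounds carry over. The weights `w_n = 1` are
generic because `Z (1 - Z) = ζ` does not allow `Z` to exceed `1 / 2`.
-/

/-! ### Convolution powers of a weight sequence -/

/-- The `m`-fold convolution power of the weight sequence `v`: `convPow v m s` is the coefficient of
`x ^ s` in `(∑ n, v n * x ^ n) ^ m`. If `v` is an offspring distribution, this is the probability
that `m` individuals have `s` children altogether. -/
noncomputable def convPow (v : ℕ → ℝ≥0) (m s : ℕ) : ℝ≥0 :=
  PowerSeries.coeff s (PowerSeries.mk v ^ m)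

theorem convPow_zero (v : ℕ → ℝ≥0) (s : ℕ) : convPow v 0 s = if s = 0 then 1 else 0 := by
  simp [convPow, PowerSeries.coeff_one]

theorem convPow_one (v : ℕ → ℝ≥0) (s : ℕ) : convPow v 1 s = v s := by
  simp [convPow]

theorem convPow_add (v : ℕ → ℝ≥0) (m n s : ℕ) :
    convPow v (m + n) s =
      ∑ q ∈ Finset.HasAntidiagonal.antidiagonal s, convPow v m q.1 * convPow v n q.2 := by
  rw [convPow, pow_add, PowerSeries.coeff_mul]
  rfl

theorem convPow_succ (v : ℕ → ℝ≥0) (m s : ℕ) :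
    convPow v (m + 1) s = ∑ q ∈ Finset.HasAntidiagonal.antidiagonal s, convPow v m q.1 * v q.2 := by
  simp [convPow_add, convPow_one]

theorem ENNReal.tsum_tsum_antidiagonal (f : ℕ → ℕ → ℝ≥0∞) :
    ∑' s, ∑ q ∈ Finset.HasAntidiagonal.antidiagonal s, f q.1 q.2 = ∑' i, ∑' j, f i j := by
  rw [← ENNReal.tsum_prod, ← Finset.HasAntidiagonal.sigmaAntidiagonalEquivProd.tsum_eq,
    ENNReal.tsum_sigma']
  refine tsum_congr fun s => ?_
  rw [tsum_fintype]
  exact (Finset.sum_coe_sort (Finset.HasAntidiagonal.antidiagonal s) fun q => f q.1 q.2).symm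

theorem tsum_convPow_add (v : ℕ → ℝ≥0) (m n : ℕ) (H : ℕ → ℝ≥0∞) :
    ∑' s, (convPow v (m + n) s : ℝ≥0∞) * H s =
      ∑' i, ∑' j, (convPow v m i : ℝ≥0∞) * convPow v n j * H (i + j) := by
  rw [← ENNReal.tsum_tsum_antidiagonal fun i j =>
    (convPow v m i : ℝ≥0∞) * convPow v n j * H (i + j)]
  refine tsum_congr fun s => ?_
  rw [convPow_add, ENNReal.ofNNReal_finsetSum, Finset.sum_mul]
  refine Finset.sum_congr rfl fun q hq => ?_
  rw [Finset.HasAntidiagonal.mem_antidiagonal.1 hq, ENNReal.coe_mul]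

theorem tsum_convPow_succ (v : ℕ → ℝ≥0) (m : ℕ) (H : ℕ → ℝ≥0∞) :
    ∑' s, (convPow v (m + 1) s : ℝ≥0∞) * H s =
      ∑' i, ∑' j, (convPow v m i : ℝ≥0∞) * v j * H (i + j) := by
  simp only [tsum_convPow_add, convPow_one]

/-- Summing over the numbers of children of `m` individuals: a function of the total number of
children is summed against the convolution power. -/
theorem tsum_pi_prod_mul (v : ℕ → ℝ≥0) (m : ℕ) (H : ℕ → ℝ≥0∞) :
    ∑' c : Fin m → ℕ, (∏ i, (v (c i) : ℝ≥0∞)) * H (∑ i, c i) =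
      ∑' s, (convPow v m s : ℝ≥0∞) * H s := by
  induction m generalizing H with
  | zero =>
    rw [tsum_eq_single (0 : ℕ) (by intro s hs; simp [convPow_zero, hs])]
    simp [convPow_zero]
  | succ m ih =>
    rw [← (Fin.snocEquiv fun _ : Fin (m + 1) => ℕ).tsum_eq, tsum_convPow_succ, ENNReal.tsum_comm,
      ENNReal.tsum_prod']
    refine tsum_congr fun j => ?_
    have h := ih fun s => v j * H (s + j)
    simp only [mul_assoc]
    rw [← h]
    refine tsum_congr fun c => ?_
    simp [Fin.snocEquiv, Fin.prod_univ_castSucc, Fin.sum_univ_castSucc, mul_assoc]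

theorem tsum_convPow_mul_pow (v : ℕ → ℝ≥0) (m : ℕ) (x : ℝ≥0∞) :
    ∑' s, (convPow v m s : ℝ≥0∞) * x ^ s = (∑' n, (v n : ℝ≥0∞) * x ^ n) ^ m := by
  induction m with
  | zero =>
    rw [tsum_eq_single 0 (by intro s hs; simp [convPow_zero, hs])]
    simp [convPow_zero]
  | succ m ih =>
    rw [tsum_convPow_succ, pow_succ, ← ih, ← ENNReal.tsum_mul_right]
    refine tsum_congr fun i => ?_
    rw [← ENNReal.tsum_mul_left]
    refine tsum_congr fun j => ?_
    rw [pow_add]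
    ring

/-- The symmetry argument behind the cycle lemma: the share of the first `m` of `m + n` summands in
their total `K` is `m / (m + n)`. -/
theorem sum_antidiagonal_mul_convPow (v : ℕ → ℝ≥0) (m n K : ℕ) :
    (m + n : ℝ≥0) * ∑ q ∈ Finset.HasAntidiagonal.antidiagonal K,
        (q.1 : ℝ≥0) * (convPow v m q.1 * convPow v n q.2) =
      m * K * convPow v (m + n) K := by
  cases m with
  | zero =>
    simp only [Nat.cast_zero, zero_mul, zero_add]
    rw [mul_eq_zero]
    right
    refine Finset.sum_eq_zero fun q _ => ?_
    rcases eq_or_ne q.1 0 with h | h <;> simp [convPow_zero, h]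
  | succ m =>
    have hder : ∀ (A : PowerSeries ℝ≥0) (s : ℕ),
        PowerSeries.coeff s (PowerSeries.X * PowerSeries.derivative ℝ≥0 A) =
          s * PowerSeries.coeff s A := by
      intro A s
      cases s with
      | zero => simp
      | succ s =>
        rw [PowerSeries.coeff_succ_X_mul, PowerSeries.coeff_derivative]
        push_cast
        ring
    set A : PowerSeries ℝ≥0 := PowerSeries.mk v
    -- compare `A ^ n * d(A ^ (m + 1))` with `d(A ^ (m + 1 + n))`
    have key : ((m + 1 + n : ℕ) : PowerSeries ℝ≥0) *
        ((PowerSeries.X * PowerSeries.derivative ℝ≥0 (A ^ (m + 1))) * A ^ n) =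
        ((m + 1 : ℕ) : PowerSeries ℝ≥0) *
          (PowerSeries.X * PowerSeries.derivative ℝ≥0 (A ^ (m + 1 + n))) := by
      rw [Derivation.leibniz_pow, Derivation.leibniz_pow]
      simp only [nsmul_eq_mul, smul_eq_mul]
      have : m + 1 + n - 1 = m + n := by omega
      rw [this, Nat.add_sub_cancel, pow_add]
      ring
    have h := congrArg (PowerSeries.coeff K) key
    have hC : ∀ (k : ℕ) (B : PowerSeries ℝ≥0),
        PowerSeries.coeff K ((k : PowerSeries ℝ≥0) * B) = k * PowerSeries.coeff K B := by
      intro k B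
      rw [← nsmul_eq_mul, map_nsmul, nsmul_eq_mul]
    rw [hC, hC, hder, PowerSeries.coeff_mul] at h
    simp only [hder] at h
    simp only [convPow]
    push_cast at h ⊢
    rw [mul_assoc, ← h]
    simp only [mul_assoc]
    rfl

/-! ### Forests -/

/-- The total weight of the ordered forests of `m` planted trees with `M` edges altogether, in the
closed form provided by the cycle lemma; `v n` is the weight of a vertex with `n` children. -/
noncomputable def forestSum (v : ℕ → ℝ≥0) (m M : ℕ) : ℝ≥0 :=
  if M = 0 then (if m = 0 then 1 else 0)
  else if m ≤ M then (m : ℝ≥0) / M * convPow v M (M - m) else 0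

theorem forestSum_zero_right (v : ℕ → ℝ≥0) (m : ℕ) :
    forestSum v m 0 = if m = 0 then 1 else 0 := by simp [forestSum]

theorem forestSum_zero_left (v : ℕ → ℝ≥0) (M : ℕ) :
    forestSum v 0 M = if M = 0 then 1 else 0 := by simp [forestSum]

theorem forestSum_of_lt (v : ℕ → ℝ≥0) {m M : ℕ} (h : M < m) : forestSum v m M = 0 := by
  unfold forestSum
  split_ifs <;> first | rfl | omega

theorem forestSum_of_le (v : ℕ → ℝ≥0) {m M : ℕ} (h0 : 0 < M) (h : m ≤ M) :
    forestSum v m M = (m : ℝ≥0) / M * convPow v M (M - m) := by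
  rw [forestSum, if_neg h0.ne', if_pos h]

/-- Removing the `m` root edges of a forest leaves one tree for each child of their endpoints. -/
theorem forestSum_add (v : ℕ → ℝ≥0) {m : ℕ} (hm : 0 < m) (K : ℕ) :
    forestSum v m (m + K) = ∑ s ∈ Finset.range (K + 1), convPow v m s * forestSum v s K := by
  rw [forestSum_of_le v (by omega) (by omega), Nat.add_sub_cancel_left]
  rcases Nat.eq_zero_or_pos K with rfl | hK
  · simp only [add_zero, zero_add, Finset.range_one, Finset.sum_singleton, forestSum_zero_right,
      if_true, mul_one]
    rw [div_self (by positivity), one_mul]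
  · have h := sum_antidiagonal_mul_convPow v m K K
    rw [Finset.Nat.sum_antidiagonal_eq_sum_range_succ
      (fun i j => (i : ℝ≥0) * (convPow v m i * convPow v K j))] at h
    have hsum : ∑ s ∈ Finset.range (K + 1), convPow v m s * forestSum v s K =
        (K : ℝ≥0)⁻¹ * ∑ s ∈ Finset.range (K + 1),
          (s : ℝ≥0) * (convPow v m s * convPow v K (K - s)) := by
      rw [Finset.mul_sum]
      refine Finset.sum_congr rfl fun s hs => ?_
      rw [forestSum_of_le v hK (Nat.lt_succ_iff.1 (Finset.mem_range.1 hs))]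
      ring
    rw [hsum]
    have hK0 : (K : ℝ≥0) ≠ 0 := by positivity
    have hmK : (m + K : ℝ≥0) ≠ 0 := by positivity
    push_cast
    rw [← mul_right_inj' hmK, mul_left_comm _ (K : ℝ≥0)⁻¹, h]
    field_simp

theorem tsum_convPow_mul_forestSum (v : ℕ → ℝ≥0) {m : ℕ} (hm : 0 < m) (K : ℕ) :
    ∑' s, (convPow v m s : ℝ≥0∞) * forestSum v s K = forestSum v m (m + K) := by
  rw [forestSum_add v hm, tsum_eq_sum (s := Finset.range (K + 1)), ENNReal.ofNNReal_finsetSum]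
  · simp
  · intro s hs
    rw [forestSum_of_lt v (by simpa using hs)]
    simp

/-- A forest of `m + n` trees is the juxtaposition of a forest of `m` trees and one of `n` trees. -/
theorem forestSum_add_left (v : ℕ → ℝ≥0) {m n : ℕ} (hm : 0 < m) (hn : 0 < n) (M : ℕ) :
    (forestSum v (m + n) M : ℝ≥0∞) = ∑ q ∈ Finset.HasAntidiagonal.antidiagonal M,
      (forestSum v m q.1 * forestSum v n q.2 : ℝ≥0∞) := by
  induction M using Nat.strong_induction_on generalizing m n with
  | _ M ih =>
    rcases lt_or_ge M (m + n) with hlt | hge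
    · rw [forestSum_of_lt v hlt, ENNReal.coe_zero, eq_comm]
      refine Finset.sum_eq_zero fun q hq => ?_
      have hq := Finset.HasAntidiagonal.mem_antidiagonal.1 hq
      rcases lt_or_ge q.1 m with h1 | h1
      · simp [forestSum_of_lt v h1]
      · simp [forestSum_of_lt v (show q.2 < n by omega)]
    · obtain ⟨K, rfl⟩ := Nat.exists_eq_add_of_le hge
      have hF : ∀ i j, (forestSum v (i + j) K : ℝ≥0∞) =
          ∑ q ∈ Finset.HasAntidiagonal.antidiagonal K,
            (forestSum v i q.1 * forestSum v j q.2 : ℝ≥0∞) := by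
        intro i j
        rcases Nat.eq_zero_or_pos i with rfl | hi
        · rw [Finset.sum_eq_single (0, K)]
          · simp [forestSum_zero_left]
          · rintro ⟨a, b⟩ hab hne
            have hab : a + b = K := Finset.HasAntidiagonal.mem_antidiagonal.1 hab
            have : a ≠ 0 := by rintro rfl; exact hne (by rw [← hab, zero_add])
            simp [forestSum_zero_left, this]
          · intro h; simp at h
        rcases Nat.eq_zero_or_pos j with rfl | hj
        · rw [Finset.sum_eq_single (K, 0)]
          · simp [forestSum_zero_left]
          · rintro ⟨a, b⟩ hab hne
            have hab : a + b = K := Finset.HasAntidiagonal.mem_antidiagonal.1 hab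
            have : b ≠ 0 := by rintro rfl; exact hne (by rw [← hab, add_zero])
            simp [forestSum_zero_left, this]
          · intro h; simp at h
        exact ih K (by omega) hi hj
      -- the pairs `q` for which both factors are nonzero are the translates by `(m, n)`
      have hshift : ∑ q ∈ Finset.HasAntidiagonal.antidiagonal (m + n + K),
            (forestSum v m q.1 * forestSum v n q.2 : ℝ≥0∞) =
          ∑ q ∈ Finset.HasAntidiagonal.antidiagonal K,
            (forestSum v m (m + q.1) * forestSum v n (n + q.2) : ℝ≥0∞) := by
        symm
        refine Finset.sum_of_injOn (fun q => (m + q.1, n + q.2)) ?_ ?_ ?_ (fun _ _ => rfl)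
        · rintro ⟨a, b⟩ _ ⟨c, d⟩ _ h
          simp only [Prod.mk.injEq] at h ⊢
          omega
        · rintro ⟨a, b⟩ h
          have h := Finset.HasAntidiagonal.mem_antidiagonal.1 (Finset.mem_coe.1 h)
          refine Finset.mem_coe.2 (Finset.HasAntidiagonal.mem_antidiagonal.2 ?_)
          dsimp only at h ⊢
          omega
        · rintro ⟨a, b⟩ h hnot
          have h := Finset.HasAntidiagonal.mem_antidiagonal.1 h
          dsimp only at h ⊢
          by_cases ha : a < m
          · simp [forestSum_of_lt v ha]
          by_cases hb : b < n
          · simp [forestSum_of_lt v hb]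
          refine absurd ⟨(a - m, b - n), Finset.mem_coe.2
            (Finset.HasAntidiagonal.mem_antidiagonal.2 ?_), ?_⟩ hnot
          · dsimp only; omega
          · simp only [Prod.mk.injEq]; omega
      rw [hshift, ← tsum_convPow_mul_forestSum v (by omega), tsum_convPow_add]
      simp only [hF, Finset.mul_sum]
      simp only [← tsum_convPow_mul_forestSum v hm, ← tsum_convPow_mul_forestSum v hn]
      rw [show ∀ f : ℕ → ℕ → ℕ × ℕ → ℝ≥0∞, ∑' i, ∑' j,
          ∑ q ∈ Finset.HasAntidiagonal.antidiagonal K, f i j q =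
          ∑ q ∈ Finset.HasAntidiagonal.antidiagonal K, ∑' i, ∑' j, f i j q from fun f => by
        simp only [Summable.tsum_finsetSum fun _ _ => ENNReal.summable]]
      refine Finset.sum_congr rfl fun q _ => ?_
      rw [← ENNReal.tsum_mul_right]
      refine tsum_congr fun i => ?_
      rw [← ENNReal.tsum_mul_left]
      refine tsum_congr fun j => ?_
      ring

/-- The generating function of forests of `m` trees is the `m`-th power of that of trees. -/
theorem tsum_forestSum_mul_pow (v : ℕ → ℝ≥0) (x : ℝ≥0∞) (m : ℕ) :
    ∑' M, (forestSum v m M : ℝ≥0∞) * x ^ M = (∑' M, (forestSum v 1 M : ℝ≥0∞) * x ^ M) ^ m := by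
  induction m with
  | zero =>
    rw [tsum_eq_single 0 (by intro s hs; simp [forestSum_zero_left, hs])]
    simp [forestSum_zero_left]
  | succ m ih =>
    rcases Nat.eq_zero_or_pos m with rfl | hm
    · simp
    rw [pow_succ, ← ih, ← ENNReal.tsum_mul_right]
    have h := ENNReal.tsum_tsum_antidiagonal
      fun i j => (forestSum v m i : ℝ≥0∞) * x ^ i * (forestSum v 1 j * x ^ j)
    simp only [ENNReal.tsum_mul_left] at h
    rw [← h]
    refine tsum_congr fun M => ?_
    rw [forestSum_add_left v hm one_pos, Finset.sum_mul]
    refine Finset.sum_congr rfl fun q hq => ?_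
    rw [← Finset.HasAntidiagonal.mem_antidiagonal.1 hq, pow_add]
    ring

/-- The functional equation `Z = x φ(Z)` of the generating function of planted trees. -/
theorem tsum_forestSum_one_eq (v : ℕ → ℝ≥0) (x : ℝ≥0∞) :
    ∑' M, (forestSum v 1 M : ℝ≥0∞) * x ^ M =
      x * ∑' n, (v n : ℝ≥0∞) * (∑' M, (forestSum v 1 M : ℝ≥0∞) * x ^ M) ^ n := by
  have h0 : ∑' M, (forestSum v 1 M : ℝ≥0∞) * x ^ M =
      ∑' K, (forestSum v 1 (1 + K) : ℝ≥0∞) * x ^ (K + 1) := by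
    rw [tsum_eq_zero_add' ENNReal.summable]
    simp [forestSum_zero_right, add_comm]
  conv_lhs => rw [h0]
  simp only [← tsum_forestSum_mul_pow, ← tsum_convPow_mul_forestSum v one_pos, convPow_one]
  simp only [← ENNReal.tsum_mul_left, ← ENNReal.tsum_mul_right]
  rw [ENNReal.tsum_comm]
  refine tsum_congr fun n => tsum_congr fun K => ?_
  rw [pow_succ]
  ring

/-! ### Trees cut at a given height -/

namespace PlanarTree

variable {T T' : PlanarTree}

theorem levelWidth_congr {c c' : ℕ → ℕ → ℕ} {k : ℕ} (h : ∀ l < k, ∀ i, c l i = c' l i) :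
    levelWidth c k = levelWidth c' k := by
  induction k with
  | zero => rfl
  | succ k ih =>
    simp only [levelWidth]
    rw [ih fun l hl => h l (by omega)]
    exact Finset.sum_congr rfl fun i _ => h k (by omega) i

theorem width_succ (T : PlanarTree) (k : ℕ) :
    T.width (k + 1) = ∑ i ∈ Finset.range (T.width k), T.children k i := rfl

theorem mem_ball_self (R : ℕ) (T : PlanarTree) : T ∈ ball R T := fun _ _ _ => rfl

theorem ball_eq_of_mem {R : ℕ} (h : T' ∈ ball R T) : ball R T' = ball R T := by
  ext S
  exact ⟨fun hS k hk i => (hS k hk i).trans (h k hk i),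
    fun hS k hk i => (hS k hk i).trans (h k hk i).symm⟩

theorem ball_subset_ball {R R' : ℕ} (h : R ≤ R') (T : PlanarTree) : ball R' T ⊆ ball R T :=
  fun _ hS k hk i => hS k (by omega) i

theorem width_eq_of_mem_ball {R k : ℕ} (h : T' ∈ ball R T) (hk : k ≤ R) :
    T'.width k = T.width k :=
  levelWidth_congr fun l hl i => h l (by omega) i

theorem children_zero (T : PlanarTree) (i : ℕ) : T.children 0 i = if i = 0 then 1 else 0 := by
  split_ifs with h
  · rw [h, T.children_root]
  · exact T.children_eq_zero 0 i (by simp only [levelWidth]; omega)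

theorem ball_zero (T : PlanarTree) : ball 0 T = Set.univ :=
  Set.eq_univ_of_forall fun _ _ hk => absurd hk (Nat.not_lt_zero _)

theorem ball_one (T : PlanarTree) : ball 1 T = Set.univ := by
  refine Set.eq_univ_of_forall fun S k hk i => ?_
  obtain rfl : k = 0 := by omega
  rw [children_zero, children_zero]

/-- The tree that coincides with `T` up to height `R + 1`, in which the `i`-th vertex at height
`R + 1` has `c i` children, which are leaves. -/
def extend (T : PlanarTree) (R : ℕ) (c : Fin (T.width (R + 1)) → ℕ) : PlanarTree where
  children k i := if k ≤ R then T.children k i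
    else if h : k = R + 1 ∧ i < T.width (R + 1) then c ⟨i, h.2⟩ else 0
  children_root := by simp [T.children_root]
  children_eq_zero k i hi := by
    split_ifs with h1 h2
    · refine T.children_eq_zero k i (le_of_eq_of_le ?_ hi)
      exact levelWidth_congr fun l hl j => by rw [if_pos (by omega)]
    · obtain ⟨rfl, h2⟩ := h2
      refine absurd hi (not_le.2 (lt_of_lt_of_eq h2 ?_))
      exact levelWidth_congr fun l hl j => by rw [if_pos (by omega)]
    · rfl

variable (T) in
theorem extend_mem_ball (R : ℕ) (c : Fin (T.width (R + 1)) → ℕ) :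
    T.extend R c ∈ ball (R + 1) T := fun k hk i => if_pos (by omega)

variable (T) in
theorem children_extend (R : ℕ) (c : Fin (T.width (R + 1)) → ℕ) (i : Fin (T.width (R + 1))) :
    (T.extend R c).children (R + 1) i = c i := by
  simp [extend]

variable (T) in
theorem width_extend_of_le {R k : ℕ} (c : Fin (T.width (R + 1)) → ℕ) (hk : k ≤ R + 1) :
    (T.extend R c).width k = T.width k :=
  width_eq_of_mem_ball (T.extend_mem_ball R c) hk

variable (T) in
theorem width_extend (R : ℕ) (c : Fin (T.width (R + 1)) → ℕ) :
    (T.extend R c).width (R + 2) = ∑ i, c i := by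
  rw [width_succ, T.width_extend_of_le c le_rfl, Finset.sum_range]
  exact Finset.sum_congr rfl fun i _ => T.children_extend R c i

theorem mem_ball_extend {R : ℕ} {c : Fin (T.width (R + 1)) → ℕ} :
    T' ∈ ball (R + 2) (T.extend R c) ↔
      T' ∈ ball (R + 1) T ∧ ∀ i : Fin (T.width (R + 1)), T'.children (R + 1) i = c i := by
  constructor
  · intro h
    refine ⟨fun k hk i => (h k (by omega) i).trans (T.extend_mem_ball R c k hk i), fun i => ?_⟩
    rw [h (R + 1) (by omega), children_extend]
  · rintro ⟨h1, h2⟩ k hk i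
    rcases Nat.lt_or_ge k (R + 1) with hk' | hk'
    · rw [h1 k hk', T.extend_mem_ball R c k hk']
    · obtain rfl : k = R + 1 := by omega
      by_cases hi : i < T.width (R + 1)
      · rw [h2 ⟨i, hi⟩]
        exact (T.children_extend R c ⟨i, hi⟩).symm
      · rw [T'.children_eq_zero _ _ (by
            change T'.width _ ≤ _; rw [width_eq_of_mem_ball h1 le_rfl]; omega),
          (T.extend R c).children_eq_zero _ _ (by
            change (T.extend R c).width _ ≤ _; rw [T.width_extend_of_le c le_rfl]; omega)]

/-- A ball is the disjoint union of the balls of the next radius contained in it, which correspond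
to the numbers of children of the vertices at the last height. -/
theorem ball_eq_iUnion (R : ℕ) (T : PlanarTree) :
    ball (R + 1) T = ⋃ c : Fin (T.width (R + 1)) → ℕ, ball (R + 2) (T.extend R c) := by
  ext S
  simp only [Set.mem_iUnion, mem_ball_extend]
  exact ⟨fun h => ⟨fun i => S.children (R + 1) i, h, fun _ => rfl⟩, fun ⟨_, h, _⟩ => h⟩

theorem pairwise_disjoint_ball_extend (R : ℕ) (T : PlanarTree) :
    Pairwise fun c c' : Fin (T.width (R + 1)) → ℕ =>
      Disjoint (ball (R + 2) (T.extend R c)) (ball (R + 2) (T.extend R c')) := by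
  intro c c' hne
  rw [Set.disjoint_left]
  intro S h h'
  rw [mem_ball_extend] at h h'
  exact hne (funext fun i => (h.2 i).symm.trans (h'.2 i))

theorem measurableSet_ball (R : ℕ) (T : PlanarTree) : MeasurableSet (ball R T) :=
  MeasurableSpace.measurableSet_generateFrom ⟨R, T, rfl⟩

theorem lintegral_ball (μ : Measure PlanarTree) (R : ℕ) (T : PlanarTree)
    (g : PlanarTree → ℝ≥0∞) :
    ∫⁻ S in ball (R + 1) T, g S ∂μ = ∑' c, ∫⁻ S in ball (R + 2) (T.extend R c), g S ∂μ := by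
  rw [ball_eq_iUnion]
  exact lintegral_iUnion (fun c => measurableSet_ball _ _) (pairwise_disjoint_ball_extend R T) g

theorem measure_ball (μ : Measure PlanarTree) (R : ℕ) (T : PlanarTree) :
    μ (ball (R + 1) T) = ∑' c, μ (ball (R + 2) (T.extend R c)) := by
  rw [ball_eq_iUnion]
  exact measure_iUnion (pairwise_disjoint_ball_extend R T) fun c => measurableSet_ball _ _

/-- The numbers of children of the vertices at heights less than `R`. -/
def trunc (R : ℕ) (T : PlanarTree) (k : Fin R) : List ℕ :=
  (List.range (T.width k)).map (T.children k)

theorem mem_ball_of_trunc_eq {R : ℕ} (h : trunc R T' = trunc R T) : T' ∈ ball R T := by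
  intro k hk i
  have h1 := congrFun h ⟨k, hk⟩
  simp only [trunc] at h1
  have hw : T'.width k = T.width k := by simpa using congrArg List.length h1
  by_cases hi : i < T.width k
  · have := congrArg (fun l => l[i]?) h1
    simpa [hi, hw] using this
  · rw [T'.children_eq_zero k i (by change T'.width k ≤ i; omega),
      T.children_eq_zero k i (by change T.width k ≤ i; omega)]

theorem trunc_eq_of_mem_ball {R : ℕ} (h : T' ∈ ball R T) : trunc R T' = trunc R T := by
  funext k
  simp only [trunc, width_eq_of_mem_ball h k.2.le]
  exact List.map_congr_left fun i _ => h k k.2 i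

/-- A property that depends only on the tree up to some height is an event, as there are only
countably many trees up to a given height. -/
theorem measurableSet_of_ball {A : Set PlanarTree} (R : ℕ)
    (hA : ∀ T ∈ A, ∀ T' ∈ ball R T, T' ∈ A) : MeasurableSet A := by
  have h : A = ⋃ x ∈ trunc R '' A, {S | trunc R S = x} := by
    ext S
    simp only [Set.mem_iUnion, Set.mem_image, Set.mem_ofPred_eq, exists_prop]
    constructor
    · exact fun hS => ⟨_, ⟨S, hS, rfl⟩, rfl⟩
    · rintro ⟨_, ⟨T, hT, rfl⟩, hS⟩
      exact hA T hT S (mem_ball_of_trunc_eq hS)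
  rw [h]
  refine MeasurableSet.biUnion (Set.to_countable _) ?_
  rintro _ ⟨T, -, rfl⟩
  have : {S | trunc R S = trunc R T} = ball R T :=
    Set.ext fun S => ⟨mem_ball_of_trunc_eq, trunc_eq_of_mem_ball⟩
  rw [this]
  exact measurableSet_ball R T

theorem measurable_width (k : ℕ) : Measurable fun T : PlanarTree => T.width k :=
  measurable_to_countable' fun n => measurableSet_of_ball k fun T hT T' hT' => by
    simp only [Set.mem_preimage, Set.mem_singleton_iff] at hT ⊢
    rw [width_eq_of_mem_ball hT' le_rfl, hT]

/-! ### Vertices and edges of a tree -/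

theorem infinite_vertex_iff : Infinite T.Vertex ↔ ∀ k, 0 < T.width k := by
  refine ⟨fun h k => T.width_pos k, fun h => ?_⟩
  exact Infinite.of_injective (fun k : ℕ => (⟨k, 0, h k⟩ : T.Vertex))
    fun k l hkl => congrArg Vertex.height hkl

theorem width_eq_zero_of_le {k l : ℕ} (h : T.width k = 0) (hkl : k ≤ l) : T.width l = 0 := by
  induction l, hkl using Nat.le_induction with
  | base => exact h
  | succ l _ ih => rw [width_succ, ih]; rfl

theorem measurableSet_infinite : MeasurableSet {T : PlanarTree | Infinite T.Vertex} := by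
  simp only [infinite_vertex_iff, Set.ofPred_forall]
  exact MeasurableSet.iInter fun k => measurable_width k (measurableSet_Ioi (a := 0))

theorem ne_root_iff (v : T.Vertex) : v ≠ T.root ↔ 0 < v.height := by
  obtain ⟨k, i, h⟩ := v
  refine ⟨fun hv => Nat.pos_of_ne_zero ?_, fun hv he => ?_⟩
  · rintro rfl
    have h : i < 1 := h
    obtain rfl : i = 0 := by omega
    exact hv rfl
  · have := congrArg Vertex.height he
    simp only [root] at this hv
    omega

/-- The parent of a vertex; the root is assigned to itself. -/
noncomputable def parent : T.Vertex → T.Vertex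
  | ⟨0, i, h⟩ => ⟨0, i, h⟩
  | ⟨k + 1, i, h⟩ => ⟨k, T.parentIdx k i, (T.parentIdx_spec h).1⟩

theorem isParent_iff {u v : T.Vertex} : T.IsParent u v ↔ 0 < v.height ∧ u = parent v := by
  obtain ⟨l, i, h⟩ := v
  obtain ⟨k, j, h'⟩ := u
  constructor
  · rintro ⟨h1, h2, h3⟩
    dsimp only at h1 h2 h3
    subst h1
    refine ⟨Nat.succ_pos k, ?_⟩
    simp only [parent, Vertex.mk.injEq, true_and]
    exact (T.parentIdx_eq h2 h3).symm
  · rintro ⟨h1, h2⟩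
    obtain ⟨l, rfl⟩ : ∃ m, l = m + 1 := ⟨l - 1, by simp only at h1; omega⟩
    simp only [parent, Vertex.mk.injEq] at h2
    obtain ⟨rfl, rfl⟩ := h2
    exact ⟨rfl, (T.parentIdx_spec h).2⟩

theorem height_parent {v : T.Vertex} (h : 0 < v.height) : (parent v).height + 1 = v.height := by
  obtain ⟨l, i, hi⟩ := v
  obtain ⟨l, rfl⟩ : ∃ m, l = m + 1 := ⟨l - 1, by simp only at h; omega⟩
  rfl

theorem graph_adj_parent {v : T.Vertex} (h : 0 < v.height) : T.graph.Adj (parent v) v := by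
  refine ⟨fun he => ?_, Or.inl (isParent_iff.2 ⟨h, rfl⟩)⟩
  have := height_parent h
  rw [he] at this
  omega

theorem height_le_of_walk_graph {u v : T.Vertex} (p : T.graph.Walk u v) :
    v.height ≤ u.height + p.length := by
  induction p with
  | nil => simp
  | cons h p ih =>
    rw [SimpleGraph.Walk.length_cons]
    obtain ⟨-, h | h⟩ := h <;> have := h.1 <;> omega

/-- The graph distance from the root is the height. -/
theorem edist_root (v : T.Vertex) : T.graph.edist T.root v = v.height := by
  have hw : ∀ (k : ℕ) (v : T.Vertex), v.height = k →
      ∃ p : T.graph.Walk T.root v, p.length = k := by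
    intro k
    induction k with
    | zero =>
      intro v hv
      obtain rfl : v = T.root := by
        by_contra hne
        exact absurd ((ne_root_iff v).1 hne) (by omega)
      exact ⟨.nil, rfl⟩
    | succ k ih =>
      intro v hv
      obtain ⟨p, hp⟩ := ih (parent v) (by have := height_parent (v := v) (by omega); omega)
      exact ⟨p.concat (graph_adj_parent (by omega)), by rw [SimpleGraph.Walk.length_concat, hp]⟩
  obtain ⟨p, hp⟩ := hw _ v rfl
  apply le_antisymm
  · rw [← hp]
    exact SimpleGraph.edist_le p
  · refine le_iInf fun q => ?_
    have := height_le_of_walk_graph q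
    rw [show T.root.height = 0 from rfl, Nat.zero_add] at this
    exact_mod_cast this

theorem edgeSet_graph : T.graph.edgeSet = (fun v => s(parent v, v)) '' {v | v ≠ T.root} := by
  ext e
  induction e with
  | _ u v =>
    simp only [SimpleGraph.mem_edgeSet, Set.mem_image, Set.mem_ofPred_eq, ne_root_iff]
    constructor
    · rintro ⟨-, h | h⟩
      · obtain ⟨h1, rfl⟩ := isParent_iff.1 h
        exact ⟨v, h1, rfl⟩
      · obtain ⟨h1, rfl⟩ := isParent_iff.1 h
        exact ⟨u, h1, Sym2.eq_swap⟩
    · rintro ⟨x, hx, he⟩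
      rw [← SimpleGraph.mem_edgeSet, ← he]
      exact graph_adj_parent hx

theorem injOn_edge : Set.InjOn (fun v => s(parent v, v)) {v | v ≠ T.root} := by
  intro u hu v hv h
  have hu := height_parent ((ne_root_iff u).1 hu)
  have hv := height_parent ((ne_root_iff v).1 hv)
  simp only [Sym2.eq_iff] at h
  rcases h with ⟨-, h⟩ | ⟨h1, h2⟩
  · exact h
  · rw [h1] at hu
    rw [← h2] at hv
    omega

/-- The vertices other than the root up to height `R`, numbered by height and index. -/
theorem bijOn_vertex (R : ℕ) :
    Set.BijOn (fun v : T.Vertex => (⟨v.height - 1, v.idx⟩ : Σ _ : ℕ, ℕ))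
      {v | v ≠ T.root ∧ v.height ≤ R}
      ((Finset.range R).sigma fun k => Finset.range (T.width (k + 1))) := by
  refine ⟨?_, ?_, ?_⟩
  · rintro v ⟨h1, h2⟩
    rw [ne_root_iff] at h1
    have := v.lt
    simp only [Finset.coe_sigma, Set.mem_sigma_iff, Finset.coe_range, Set.mem_Iio]
    rw [Nat.sub_add_cancel h1]
    exact ⟨by omega, this⟩
  · rintro u ⟨hu, -⟩ v ⟨hv, -⟩ h
    rw [ne_root_iff] at hu hv
    simp only [Sigma.mk.injEq, heq_eq_eq] at h
    exact Vertex.ext (by omega) h.2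
  · rintro ⟨k, i⟩ h
    simp only [Finset.coe_sigma, Set.mem_sigma_iff, Finset.coe_range, Set.mem_Iio] at h
    refine ⟨⟨k + 1, i, h.2⟩, ⟨(ne_root_iff _).2 (Nat.succ_pos k), ?_⟩, rfl⟩
    change k + 1 ≤ R
    omega

theorem ncard_vertex (T : PlanarTree) (R : ℕ) :
    {v : T.Vertex | v ≠ T.root ∧ v.height ≤ R}.ncard = ∑ k ∈ Finset.range R, T.width (k + 1) := by
  rw [← (bijOn_vertex R).injOn.ncard_image, (bijOn_vertex R).image_eq, Set.ncard_coe_finset,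
    Finset.card_sigma]
  simp

theorem finite_vertex (T : PlanarTree) (R : ℕ) :
    {v : T.Vertex | v ≠ T.root ∧ v.height ≤ R}.Finite :=
  (bijOn_vertex R).finite_iff_finite.2 (Finset.finite_toSet _)

/-- Every vertex other than the root contributes the edge to its parent. -/
theorem ballSize_eq (T : PlanarTree) (R : ℕ) :
    T.ballSize R = ∑ k ∈ Finset.range R, T.width (k + 1) := by
  have : {e ∈ T.graph.edgeSet | ∀ v ∈ e, T.graph.edist T.root v ≤ R} =
      (fun v => s(parent v, v)) '' {v : T.Vertex | v ≠ T.root ∧ v.height ≤ R} := by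
    rw [edgeSet_graph]
    ext e
    simp only [Set.mem_ofPred_eq, Set.mem_image]
    constructor
    · rintro ⟨⟨v, hv, rfl⟩, h⟩
      refine ⟨v, ⟨hv, ?_⟩, rfl⟩
      have := h v (Sym2.mem_mk_right _ _)
      rw [edist_root] at this
      exact_mod_cast this
    · rintro ⟨v, ⟨hv, h⟩, rfl⟩
      refine ⟨⟨v, hv, rfl⟩, fun u hu => ?_⟩
      have := height_parent ((ne_root_iff v).1 hv)
      rw [edist_root, Nat.cast_le]
      rcases Sym2.mem_iff.1 hu with rfl | rfl <;> omega
  rw [ballSize, this, (injOn_edge.mono fun v hv => hv.1).ncard_image, ncard_vertex]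

theorem size_eq (T : PlanarTree) : T.size = {v : T.Vertex | v ≠ T.root}.encard := by
  rw [size, edgeSet_graph, injOn_edge.encard_image]

theorem sum_width_le_size (T : PlanarTree) (R : ℕ) :
    ((∑ k ∈ Finset.range R, T.width (k + 1) : ℕ) : ℕ∞) ≤ T.size := by
  rw [size_eq, ← ncard_vertex, (finite_vertex T R).cast_ncard_eq]
  exact Set.encard_le_encard fun v hv => hv.1

theorem setOf_ne_root_of_width_eq_zero {R : ℕ} (h : T.width (R + 1) = 0) :
    {v : T.Vertex | v ≠ T.root} = {v : T.Vertex | v ≠ T.root ∧ v.height ≤ R} := by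
  ext v
  refine ⟨fun hv => ⟨hv, ?_⟩, fun hv => hv.1⟩
  by_contra hlt
  have := v.lt
  rw [width_eq_zero_of_le h (by omega)] at this
  omega

theorem size_of_width_eq_zero {R : ℕ} (h : T.width (R + 1) = 0) :
    T.size = ∑ k ∈ Finset.range R, T.width (k + 1) := by
  rw [size_eq, setOf_ne_root_of_width_eq_zero h, ← ncard_vertex, (finite_vertex T R).cast_ncard_eq]

/-- The product of the weights of the vertices at the heights `1, …, R`, where `v n` is the weight
of a vertex with `n` children. -/
def levelWeight {M : Type*} [CommMonoid M] (v : ℕ → M) (R : ℕ) (T : PlanarTree) : M :=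
  ∏ k ∈ Finset.range R, ∏ i ∈ Finset.range (T.width (k + 1)), v (T.children (k + 1) i)

theorem levelWeight_eq_of_mem_ball {M : Type*} [CommMonoid M] (v : ℕ → M) {R : ℕ}
    (h : T' ∈ ball (R + 1) T) : levelWeight v R T' = levelWeight v R T := by
  refine Finset.prod_congr rfl fun k hk => ?_
  have hk := Finset.mem_range.1 hk
  rw [width_eq_of_mem_ball h (by omega)]
  exact Finset.prod_congr rfl fun i _ => by rw [h (k + 1) (by omega)]

theorem levelWeight_extend {M : Type*} [CommMonoid M] (v : ℕ → M) (R : ℕ) (T : PlanarTree)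
    (c : Fin (T.width (R + 1)) → ℕ) :
    levelWeight v (R + 1) (T.extend R c) = levelWeight v R T * ∏ i, v (c i) := by
  rw [levelWeight, Finset.prod_range_succ, ← levelWeight,
    levelWeight_eq_of_mem_ball v (T.extend_mem_ball R c), T.width_extend_of_le c le_rfl,
    Finset.prod_range]
  congr 1
  exact Finset.prod_congr rfl fun i _ => by rw [T.children_extend R c i]

theorem weight_of_width_eq_zero (w : ℕ → ℝ≥0) {R : ℕ} (h : T.width (R + 1) = 0) :
    T.weight w = levelWeight (fun n => w (n + 1)) R T := by
  rw [weight, setOf_ne_root_of_width_eq_zero h,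
    finprod_mem_eq_of_bijOn (g := fun x : Σ _ : ℕ, ℕ => w (T.children (x.1 + 1) x.2 + 1)) _
      (bijOn_vertex R), finprod_mem_coe_finset, Finset.prod_sigma, levelWeight]
  rintro v ⟨hv, -⟩
  rw [ne_root_iff] at hv
  simp only
  rw [Nat.sub_add_cancel hv]

end PlanarTree

/-! ### Finite volume weights of balls -/

/-- The unnormalised distribution of trees with `N` edges. -/
noncomputable def finiteVolumeWeight (w : ℕ → ℝ≥0) (N : ℕ) : Measure PlanarTree :=
  Measure.sum fun T : {T : PlanarTree // T.size = N} =>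
    (T.1.weight w : ℝ≥0∞) • Measure.dirac T.1

namespace PlanarTree

variable {T T' : PlanarTree}

theorem eq_of_mem_ball_of_width_eq_zero {R : ℕ} (hT : T.width (R + 1) = 0)
    (h : T' ∈ ball (R + 1) T) : T' = T := by
  ext k i
  rcases Nat.lt_or_ge k (R + 1) with hk | hk
  · exact h k hk i
  · have h1 := width_eq_zero_of_le hT hk
    have h2 := width_eq_zero_of_le ((width_eq_of_mem_ball h le_rfl).trans hT) hk
    rw [T.children_eq_zero k i (by change T.width k ≤ i; omega),
      T'.children_eq_zero k i (by change T'.width k ≤ i; omega)]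

end PlanarTree

open PlanarTree

theorem finiteVolumeWeight_apply (w : ℕ → ℝ≥0) (N : ℕ) {A : Set PlanarTree}
    (hA : MeasurableSet A) :
    finiteVolumeWeight w N A = ∑' T : {T : PlanarTree // T.size = N},
      (T.1.weight w : ℝ≥0∞) * A.indicator 1 T.1 := by
  rw [finiteVolumeWeight, Measure.sum_apply _ hA]
  exact tsum_congr fun T => by rw [Measure.smul_apply, Measure.dirac_apply' _ hA, smul_eq_mul]

/-- The weight of the trees of a given size that coincide with `T` up to height `R + 1`: the
vertices at height `R + 1` are the endpoints of the root edges of a forest of planted trees. -/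
theorem finiteVolumeWeight_ball (w : ℕ → ℝ≥0) (M : ℕ) : ∀ (R : ℕ) (T : PlanarTree),
    finiteVolumeWeight w ((∑ k ∈ Finset.range R, T.width (k + 1)) + M) (ball (R + 1) T) =
      levelWeight (fun n => w (n + 1)) R T *
        forestSum (fun n => w (n + 1)) (T.width (R + 1)) M := by
  induction M using Nat.strong_induction_on with
  | _ M ih =>
    intro R T
    set v : ℕ → ℝ≥0 := fun n => w (n + 1)
    rcases lt_or_ge M (T.width (R + 1)) with hlt | hge
    · rw [forestSum_of_lt v hlt, finiteVolumeWeight_apply w _ (measurableSet_ball _ _)]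
      simp only [ENNReal.coe_zero, mul_zero, ENNReal.tsum_eq_zero]
      rintro ⟨S, hS⟩
      rw [mul_eq_zero]
      right
      refine Set.indicator_of_notMem (fun hb => ?_) _
      have h1 := sum_width_le_size S (R + 1)
      rw [hS, Nat.cast_le, Finset.sum_range_succ, width_eq_of_mem_ball hb le_rfl] at h1
      rw [Finset.sum_congr rfl fun k hk => width_eq_of_mem_ball hb
        (show k + 1 ≤ R + 1 by have := Finset.mem_range.1 hk; omega)] at h1
      omega
    rcases Nat.eq_zero_or_pos (T.width (R + 1)) with h0 | hpos
    · rw [h0, forestSum_zero_left, finiteVolumeWeight_apply w _ (measurableSet_ball _ _)]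
      have hT := size_of_width_eq_zero h0
      split_ifs with hM
      · subst hM
        rw [tsum_eq_single ⟨T, by rw [hT, add_zero]⟩, Set.indicator_of_mem (mem_ball_self _ _),
          weight_of_width_eq_zero w h0]
        · simp [v]
        · rintro ⟨S, hS⟩ hne
          rw [Set.indicator_of_notMem, mul_zero]
          exact fun hb => hne (Subtype.ext (eq_of_mem_ball_of_width_eq_zero h0 hb))
      · simp only [ENNReal.coe_zero, mul_zero, ENNReal.tsum_eq_zero]
        rintro ⟨S, hS⟩
        rw [mul_eq_zero]
        right
        refine Set.indicator_of_notMem (fun hb => hM ?_) _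
        rw [show S = T from eq_of_mem_ball_of_width_eq_zero h0 hb, hT, Nat.cast_inj] at hS
        omega
    · -- decompose the ball according to the numbers of children at the last height
      obtain ⟨K, rfl⟩ := Nat.exists_eq_add_of_le hge
      rw [measure_ball, ← tsum_convPow_mul_forestSum v hpos, ← tsum_pi_prod_mul,
        ← ENNReal.tsum_mul_left]
      refine tsum_congr fun c => ?_
      have h := ih K (by omega) (R + 1) (T.extend R c)
      rw [width_extend, levelWeight_extend, Finset.sum_range_succ,
        T.width_extend_of_le c le_rfl, Finset.sum_congr rfl fun k hk => T.width_extend_of_le c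
          (show k + 1 ≤ R + 1 by have := Finset.mem_range.1 hk; omega)] at h
      rw [← add_assoc, h]
      push_cast
      ring

theorem finiteVolumeWeight_univ (w : ℕ → ℝ≥0) (N : ℕ) :
    finiteVolumeWeight w N Set.univ = partitionFunction w N := by
  rw [finiteVolumeWeight_apply w N MeasurableSet.univ, partitionFunction]
  simp

/-- The ball of radius `1` contains all trees. -/
theorem partitionFunction_eq (w : ℕ → ℝ≥0) (N : ℕ) :
    partitionFunction w N = forestSum (fun n => w (n + 1)) 1 N := by
  obtain ⟨T⟩ : Nonempty PlanarTree := ⟨⟨fun k i => if k = 0 ∧ i = 0 then 1 else 0, by simp, by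
    intro k i h
    rw [if_neg]
    rintro ⟨rfl, rfl⟩
    simp [levelWidth] at h⟩⟩
  have h := finiteVolumeWeight_ball w N 0 T
  rw [T.width_one, ball_one, Finset.sum_range_zero, zero_add, finiteVolumeWeight_univ] at h
  simpa [levelWeight] using h

/-- The probability of a ball at finite volume is a ratio of numbers of forests, so that its limit
is governed by the asymptotics of convolution powers. -/
theorem finiteVolumeMeasure_ball (w : ℕ → ℝ≥0) (R M : ℕ) (T : PlanarTree) :
    finiteVolumeMeasure w ((∑ k ∈ Finset.range R, T.width (k + 1)) + M) (ball (R + 1) T) =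
      (forestSum (fun n => w (n + 1)) 1 ((∑ k ∈ Finset.range R, T.width (k + 1)) + M) : ℝ≥0∞)⁻¹ *
        (levelWeight (fun n => w (n + 1)) R T *
          forestSum (fun n => w (n + 1)) (T.width (R + 1)) M) := by
  rw [← finiteVolumeWeight_ball, ← partitionFunction_eq]
  rfl

/-! ### Differentiation of power series -/

theorem summable_mul_pow_of_lt {c : ℕ → ℝ} {ρ r : ℝ} (h : Summable fun n => |c n| * ρ ^ n)
    (hr : 0 ≤ r) (hρ : r < ρ) : Summable fun n => |c (n + 1) * (n + 1)| * r ^ n := by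
  have hρ0 : 0 < ρ := hr.trans_lt hρ
  have hq : ‖r / ρ‖ < 1 := by
    rw [Real.norm_of_nonneg (by positivity), div_lt_one hρ0]
    exact hρ
  have h1 := summable_pow_mul_geometric_of_norm_lt_one 1 hq
  have h2 : Summable fun n : ℕ => ((n : ℝ) + 1) * (r / ρ) ^ n := by
    have := h1.add (summable_geometric_of_norm_lt_one hq)
    refine this.congr fun n => ?_
    ring
  obtain ⟨B, hB⟩ := h.tendsto_atTop_zero.bddAbove_range
  have hB : ∀ n, |c n| * ρ ^ n ≤ B := fun n => hB ⟨n, rfl⟩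
  -- `|c (n + 1)|` is at most `B / ρ ^ (n + 1)`, so a geometric series times `n + 1` dominates
  refine Summable.of_nonneg_of_le (fun n => by positivity) (fun n => ?_) (h2.mul_left (B / ρ))
  rw [abs_mul, abs_of_nonneg (by positivity : (0 : ℝ) ≤ n + 1), div_pow]
  have h3 := hB (n + 1)
  rw [pow_succ] at h3
  have h4 : |c (n + 1)| ≤ B / ρ / ρ ^ n := by
    rw [div_div, le_div_iff₀ (by positivity)]
    linarith
  calc |c (n + 1)| * (n + 1) * r ^ n ≤ B / ρ / ρ ^ n * (n + 1) * r ^ n := by gcongr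
    _ = B / ρ * ((n + 1) * (r ^ n / ρ ^ n)) := by ring

theorem hasDerivAt_tsum_pow {c : ℕ → ℝ} {ρ x : ℝ} (h : Summable fun n => |c n| * ρ ^ n)
    (hx : |x| < ρ) :
    HasDerivAt (fun s => ∑' n, c n * s ^ n) (∑' n : ℕ, c (n + 1) * (n + 1) * x ^ n) x := by
  obtain ⟨r, hxr, hrρ⟩ := exists_between hx
  have hr : 0 ≤ r := (abs_nonneg x).trans hxr.le
  have hu := summable_mul_pow_of_lt h hr hrρ
  have h0 : Summable fun n => |c n| * r ^ n :=
    Summable.of_nonneg_of_le (fun n => by positivity) (fun n => by gcongr) h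
  have hs : ∀ y, |y| ≤ r → Summable fun n => c n * y ^ n := by
    intro y hy
    refine Summable.of_norm_bounded h0 fun n => ?_
    rw [norm_mul, norm_pow, Real.norm_eq_abs, Real.norm_eq_abs]
    gcongr
  have key := hasDerivAt_tsum_of_isPreconnected (𝕜 := ℝ) (F := ℝ) (α := ℕ) hu
    (t := Set.Ioo (-r) r)
    (g := fun n s => c (n + 1) * s ^ (n + 1)) (g' := fun n s => c (n + 1) * (n + 1) * s ^ n)
    isOpen_Ioo isPreconnected_Ioo ?_ ?_ (abs_lt.1 hxr) ?_ (abs_lt.1 hxr)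
  · have h1 := key.const_add (c 0)
    refine h1.congr_of_eventuallyEq ?_
    filter_upwards [isOpen_Ioo.mem_nhds (abs_lt.1 hxr : x ∈ Set.Ioo (-r) r)] with y hy
    rw [(hs y (abs_lt.2 hy).le).tsum_eq_zero_add]
    simp
  · intro n y _
    have := (hasDerivAt_pow (n + 1) y).const_mul (c (n + 1))
    refine this.congr_deriv ?_
    rw [Nat.add_sub_cancel]
    push_cast
    ring
  · intro n y hy
    rw [norm_mul, norm_pow, Real.norm_eq_abs, Real.norm_eq_abs]
    have := (abs_lt.2 hy).le
    gcongr
  · exact (summable_nat_add_iff 1).2 (hs x hxr.le)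

/-! ### Criticality of generic weights -/

/-- A critical offspring law of finite exponential moment under which both no child and at least two
children have positive probability. -/
structure IsCriticalLaw (p : ℕ → ℝ≥0) : Prop where
  tsum_eq_one : ∑' n, (p n : ℝ≥0∞) = 1
  tsum_mul_eq_one : ∑' n : ℕ, (p n : ℝ≥0∞) * n = 1
  exists_moment : ∃ ρ : ℝ, 1 < ρ ∧ Summable fun n => (p n : ℝ) * ρ ^ n
  zero_pos : 0 < p 0
  exists_pos : ∃ n, 2 ≤ n ∧ 0 < p n

section Generic

variable {w : ℕ → ℝ≥0}

theorem partitionSeries_eq (w : ℕ → ℝ≥0) (x : ℝ≥0∞) :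
    partitionSeries w x = ∑' M, (forestSum (fun n => w (n + 1)) 1 M : ℝ≥0∞) * x ^ M := by
  simp only [partitionSeries, partitionFunction_eq]

theorem partitionSeries_eq_mul_weightSeries (w : ℕ → ℝ≥0) (x : ℝ≥0∞) :
    partitionSeries w x = x * weightSeries w (partitionSeries w x) := by
  rw [partitionSeries_eq]
  exact tsum_forestSum_one_eq _ x

theorem partitionSeries_mono (w : ℕ → ℝ≥0) : Monotone (partitionSeries w) :=
  fun _ _ h => ENNReal.tsum_le_tsum fun _ => by gcongr

theorem weightSeries_mono (w : ℕ → ℝ≥0) : Monotone (weightSeries w) :=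
  fun _ _ h => ENNReal.tsum_le_tsum fun _ => by gcongr

theorem le_weightSeries (w : ℕ → ℝ≥0) (x : ℝ≥0∞) : (w 1 : ℝ≥0∞) ≤ weightSeries w x := by
  refine le_of_eq_of_le ?_ (ENNReal.le_tsum 0)
  simp

theorem mul_le_partitionSeries (w : ℕ → ℝ≥0) (x : ℝ≥0∞) : x * w 1 ≤ partitionSeries w x := by
  rw [partitionSeries_eq_mul_weightSeries]
  exact mul_le_mul_right (le_weightSeries w _) _

/-- The radius of convergence of `Z` is at least `r / φ(r)`: by the cycle lemma, `Z_N` is at most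
the coefficient of `x ^ (N - 1)` in `φ(x) ^ N`. -/
theorem le_zetaZero_mul_weightSeries (h1 : 0 < w 1) {r : ℝ≥0} (hr : weightSeries w r ≠ ∞) :
    (r : ℝ≥0∞) ≤ zetaZero w * weightSeries w r := by
  rcases eq_or_ne r 0 with rfl | hr0
  · simp
  have hφ0 : weightSeries w r ≠ 0 :=
    ((ENNReal.coe_pos.2 h1).trans_le (le_weightSeries w r)).ne'
  rw [← ENNReal.div_le_iff hφ0 hr]
  refine le_of_forall_lt fun ζ hζ => ?_
  obtain ⟨ζ', hζ1, hζ2⟩ := ENNReal.lt_iff_exists_nnreal_btwn.1 hζ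
  refine hζ1.trans_le ?_
  refine le_iSup₂_of_le ζ' ?_ le_rfl
  have hr0' : (r : ℝ≥0∞) ≠ 0 := by simpa using hr0
  set q : ℝ≥0∞ := weightSeries w r * ζ' / r
  have hq : q < 1 := by
    refine ENNReal.div_lt_of_lt_mul' ?_
    rw [mul_one]
    have := (ENNReal.lt_div_iff_mul_lt (Or.inl hφ0) (Or.inl hr)).1 hζ2
    rwa [mul_comm] at this
  have hle : partitionSeries w ζ' ≤ ∑' N : ℕ, r * q ^ N := by
    rw [partitionSeries_eq]
    refine ENNReal.tsum_le_tsum fun N => ?_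
    rcases Nat.eq_zero_or_pos N with rfl | hN
    · simp [forestSum_zero_right]
    set v : ℕ → ℝ≥0 := fun n => w (n + 1)
    have hF : forestSum v 1 N ≤ convPow v N (N - 1) := by
      rw [forestSum_of_le v hN hN]
      refine mul_le_of_le_one_left zero_le ?_
      rw [Nat.cast_one]
      exact div_le_one_of_le₀ (by exact_mod_cast hN) zero_le
    have hc : (convPow v N (N - 1) : ℝ≥0∞) * r ^ (N - 1) ≤ weightSeries w r ^ N := by
      refine le_of_le_of_eq ?_ (tsum_convPow_mul_pow v N r)
      exact ENNReal.le_tsum (f := fun s => (convPow v N s : ℝ≥0∞) * (r : ℝ≥0∞) ^ s) (N - 1)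
    have hrN : (r : ℝ≥0∞) ^ N = r ^ (N - 1) * r := by
      rw [← pow_succ, Nat.sub_add_cancel hN]
    have hq' : (r : ℝ≥0∞) * q ^ N = r * (weightSeries w r ^ N * ζ' ^ N) / r ^ N := by
      simp only [q, div_eq_mul_inv, mul_pow, ENNReal.inv_pow, mul_assoc]
    rw [hq', ENNReal.le_div_iff_mul_le (Or.inl (pow_ne_zero _ hr0'))
      (Or.inl (ENNReal.pow_ne_top ENNReal.coe_ne_top)), hrN]
    calc (forestSum v 1 N : ℝ≥0∞) * ζ' ^ N * (r ^ (N - 1) * r)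
        ≤ convPow v N (N - 1) * ζ' ^ N * (r ^ (N - 1) * r) := by gcongr
      _ = r * (convPow v N (N - 1) * r ^ (N - 1) * ζ' ^ N) := by ring
      _ ≤ _ := by gcongr
  refine ne_top_of_le_ne_top ?_ hle
  rw [ENNReal.tsum_mul_left, ENNReal.tsum_geometric]
  exact ENNReal.mul_ne_top ENNReal.coe_ne_top
    (ENNReal.inv_ne_top.2 (tsub_pos_of_lt hq).ne')

theorem exists_weightSeries_ne_top {x : ℝ≥0∞} (hx : x < zCrit w) :
    ∃ r : ℝ≥0, x < r ∧ weightSeries w r ≠ ∞ := by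
  obtain ⟨r, hr⟩ := lt_iSup_iff.1 hx
  obtain ⟨hr1, hr2⟩ := lt_iSup_iff.1 hr
  exact ⟨r, hr2, hr1⟩

theorem IsGeneric.zetaZero_pos (hw : IsGeneric w) : 0 < zetaZero w := by
  obtain ⟨r, hr, hr'⟩ := exists_weightSeries_ne_top hw.zCrit_pos
  refine pos_iff_ne_zero.2 fun h => ?_
  have := le_zetaZero_mul_weightSeries hw.one_pos hr'
  rw [h, zero_mul] at this
  exact absurd hr (not_lt.2 this)

theorem IsGeneric.ZZero_ne_top (hw : IsGeneric w) : ZZero w ≠ ∞ := hw.generic.ne_top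

theorem partitionSeries_le_ZZero {ζ : ℝ≥0∞} (h : ζ < zetaZero w) :
    partitionSeries w ζ ≤ ZZero w := le_iSup₂_of_le ζ h le_rfl

theorem IsGeneric.zetaZero_ne_top (hw : IsGeneric w) : zetaZero w ≠ ∞ := by
  intro h
  have h1 : (w 1 : ℝ≥0∞) ≠ 0 := by simpa using hw.one_pos.ne'
  have hlt : ZZero w / w 1 < ∞ := ENNReal.div_lt_top hw.ZZero_ne_top h1
  obtain ⟨x, hx1, hx2⟩ := exists_between hlt
  have := (mul_le_partitionSeries w x).trans (partitionSeries_le_ZZero (h ▸ hx2))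
  rw [← ENNReal.le_div_iff_mul_le (Or.inl h1) (Or.inl ENNReal.coe_ne_top)] at this
  exact absurd hx1 (not_lt.2 this)

theorem IsGeneric.ZZero_pos (hw : IsGeneric w) : 0 < ZZero w := by
  obtain ⟨x, hx1, hx2⟩ := exists_between hw.zetaZero_pos
  exact (ENNReal.mul_pos hx1.ne' (by simpa using hw.one_pos.ne')).trans_le
    ((mul_le_partitionSeries w x).trans (partitionSeries_le_ZZero hx2))

/-- By monotone convergence, `Z_0` is the value of the series at its radius of convergence. -/
theorem ZZero_eq_partitionSeries (h : 0 < zetaZero w) :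
    ZZero w = partitionSeries w (zetaZero w) := by
  refine le_antisymm (iSup₂_le fun ζ hζ => partitionSeries_mono w hζ.le) ?_
  rw [partitionSeries_eq, ENNReal.tsum_eq_iSup_sum]
  refine iSup_le fun s => ?_
  set v : ℕ → ℝ≥0 := fun n => w (n + 1)
  have hcont : Continuous fun x : ℝ≥0∞ => ∑ M ∈ s, (forestSum v 1 M : ℝ≥0∞) * x ^ M :=
    continuous_finsetSum _ fun M _ =>
      (ENNReal.continuous_const_mul ENNReal.coe_ne_top).comp (ENNReal.continuous_pow M)
  have : (𝓝[<] (zetaZero w)).NeBot := nhdsLT_neBot_of_exists_lt ⟨0, h⟩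
  refine le_of_tendsto (hcont.tendsto (zetaZero w) |>.mono_left
    (nhdsWithin_le_nhds (s := Set.Iio (zetaZero w)))) ?_
  filter_upwards [self_mem_nhdsWithin] with ζ hζ
  refine le_trans ?_ (partitionSeries_le_ZZero hζ)
  rw [partitionSeries_eq]
  exact ENNReal.sum_le_tsum s

theorem IsGeneric.ZZero_eq (hw : IsGeneric w) :
    ZZero w = zetaZero w * weightSeries w (ZZero w) := by
  have := partitionSeries_eq_mul_weightSeries w (zetaZero w)
  rwa [← ZZero_eq_partitionSeries hw.zetaZero_pos] at this

/-- The offspring law of generic weights is critical: by `le_zetaZero_mul_weightSeries` its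
generating function satisfies `s ≤ f(s)` near `s = 1`, with equality at `s = 1`, so that the two
sides have the same derivative there. -/
theorem IsGeneric.exists_isCriticalLaw (hw : IsGeneric w) :
    ∃ (p : ℕ → ℝ≥0) (a z : ℝ≥0), 0 < a ∧ 0 < z ∧ (∀ n, p n = a / z * (w (n + 1) * z ^ n)) ∧
      (∀ n, offspringProb w n = p n) ∧ IsCriticalLaw p := by
  obtain ⟨z, hz⟩ : ∃ z : ℝ≥0, (z : ℝ≥0∞) = ZZero w := ⟨_, ENNReal.coe_toNNReal hw.ZZero_ne_top⟩
  obtain ⟨a, ha⟩ : ∃ a : ℝ≥0, (a : ℝ≥0∞) = zetaZero w :=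
    ⟨_, ENNReal.coe_toNNReal hw.zetaZero_ne_top⟩
  have hz0 : 0 < z := by simpa [← hz] using hw.ZZero_pos
  have ha0 : 0 < a := by simpa [← ha] using hw.zetaZero_pos
  have hz0' : (z : ℝ≥0∞) ≠ 0 := by simpa using hz0.ne'
  set p : ℕ → ℝ≥0 := fun n => a / z * (w (n + 1) * z ^ n) with hp
  have hsum : ∀ s : ℝ≥0, ∑' n, (p n : ℝ≥0∞) * (s : ℝ≥0∞) ^ n =
      a / z * weightSeries w (s * z : ℝ≥0) := by
    intro s
    rw [weightSeries, ← ENNReal.tsum_mul_left]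
    refine tsum_congr fun n => ?_
    simp only [hp]
    push_cast
    rw [ENNReal.coe_div hz0.ne', mul_pow]
    ring
  have hone : ∑' n, (p n : ℝ≥0∞) = 1 := by
    have h := hsum 1
    simp only [ENNReal.coe_one, one_pow, mul_one, one_mul] at h
    have h2 := hw.ZZero_eq
    rw [← ha, ← hz] at h2
    rw [h, ← ENNReal.mul_div_right_comm, ← h2]
    exact ENNReal.div_self hz0' ENNReal.coe_ne_top
  -- genericity gives room beyond `Z_0`, hence a finite exponential moment
  obtain ⟨r, hr, hr'⟩ := exists_weightSeries_ne_top hw.generic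
  rw [← hz, ENNReal.coe_lt_coe] at hr
  set ρ : ℝ≥0 := r / z
  have hρ : 1 < ρ := (one_lt_div hz0).2 hr
  have hρz : ρ * z = r := div_mul_cancel₀ _ hz0.ne'
  have hle : ∀ s : ℝ≥0, s ≤ ρ → ∑' n, (p n : ℝ≥0∞) * (s : ℝ≥0∞) ^ n ≠ ∞ ∧
      (s : ℝ≥0∞) ≤ ∑' n, (p n : ℝ≥0∞) * (s : ℝ≥0∞) ^ n := by
    intro s hs
    have hfin : weightSeries w (s * z : ℝ≥0) ≠ ∞ := by
      refine ne_top_of_le_ne_top hr' (weightSeries_mono w (ENNReal.coe_le_coe.2 ?_))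
      rw [← hρz]
      gcongr
    have h := le_zetaZero_mul_weightSeries hw.one_pos hfin
    rw [hsum]
    refine ⟨ENNReal.mul_ne_top (ENNReal.div_ne_top ENNReal.coe_ne_top hz0') hfin, ?_⟩
    rw [← ha, ENNReal.coe_mul] at h
    rw [← ENNReal.mul_div_right_comm, ENNReal.le_div_iff_mul_le (Or.inl hz0')
      (Or.inl ENNReal.coe_ne_top)]
    exact_mod_cast h
  have hreal : ∀ s : ℝ≥0, s ≤ ρ → Summable (fun n => (p n : ℝ) * (s : ℝ) ^ n) ∧
      (s : ℝ) ≤ ∑' n, (p n : ℝ) * (s : ℝ) ^ n := by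
    intro s hs
    obtain ⟨h1, h2⟩ := hle s hs
    have h1' : Summable fun n => p n * s ^ n := by
      rw [← ENNReal.tsum_coe_ne_top_iff_summable]
      exact_mod_cast h1
    refine ⟨by exact_mod_cast NNReal.summable_coe.2 h1', ?_⟩
    have h3 : (s : ℝ≥0∞) ≤ ((∑' n, p n * s ^ n : ℝ≥0) : ℝ≥0∞) := by
      rw [ENNReal.coe_tsum h1']
      exact_mod_cast h2
    have h4 := NNReal.coe_le_coe.2 (ENNReal.coe_le_coe.1 h3)
    rw [NNReal.coe_tsum] at h4
    exact_mod_cast h4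
  have hρsum := (hreal ρ le_rfl).1
  have hder := hasDerivAt_tsum_pow (c := fun n => (p n : ℝ)) (ρ := (ρ : ℝ)) (x := 1)
    (by simpa using hρsum) (by simpa using hρ)
  have hf1 : ∑' n, (p n : ℝ) * (1 : ℝ) ^ n = 1 := by
    simp only [one_pow, mul_one]
    have h1' : Summable p := by
      rw [← ENNReal.tsum_coe_ne_top_iff_summable, hone]
      exact ENNReal.one_ne_top
    rw [← ENNReal.coe_tsum h1', ENNReal.coe_eq_one] at hone
    rw [← NNReal.coe_tsum, hone, NNReal.coe_one]
  have hmin : IsLocalMin (fun s : ℝ => (∑' n, (p n : ℝ) * s ^ n) - s) 1 := by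
    have hmem : Set.Ioo (0 : ℝ) ρ ∈ 𝓝 (1 : ℝ) :=
      isOpen_Ioo.mem_nhds ⟨zero_lt_one, by exact_mod_cast hρ⟩
    filter_upwards [hmem] with s hs
    obtain ⟨hs0, hs1⟩ := hs
    rw [hf1, sub_self, sub_nonneg]
    lift s to ℝ≥0 using hs0.le
    exact (hreal s (by exact_mod_cast hs1.le)).2
  have hmean := hmin.hasDerivAt_eq_zero (hder.sub (hasDerivAt_id 1))
  rw [sub_eq_zero] at hmean
  have hsm : Summable fun n : ℕ => (p (n + 1) : ℝ) * (n + 1) := by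
    have := summable_mul_pow_of_lt (c := fun n => (p n : ℝ)) (ρ := (ρ : ℝ)) (r := 1)
      (by simpa using hρsum) zero_le_one (by exact_mod_cast hρ)
    refine this.congr fun n => ?_
    rw [one_pow, mul_one, abs_of_nonneg (by positivity)]
  have hsm' : Summable fun n : ℕ => p (n + 1) * (n + 1) := by
    rw [← NNReal.summable_coe]
    exact_mod_cast hsm
  refine ⟨p, a, z, ha0, hz0, fun n => rfl, fun n => ?_, hone, ?_,
    ⟨ρ, by exact_mod_cast hρ, hρsum⟩, ?_, ?_⟩
  · rw [offspringProb, ← ha, ← hz, ENNReal.coe_toReal, ENNReal.coe_toReal,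
      zpow_sub_one₀ (by positivity), zpow_natCast]
    simp only [hp]
    push_cast
    ring
  · rw [tsum_eq_zero_add' ENNReal.summable]
    simp only [Nat.cast_zero, mul_zero, zero_add]
    have : (∑' n : ℕ, p (n + 1) * (n + 1) : ℝ≥0) = 1 := by
      rw [← NNReal.coe_inj, NNReal.coe_tsum]
      simpa using hmean
    rw [← ENNReal.coe_one, ← this, ENNReal.coe_tsum hsm']
    push_cast
    rfl
  · simp only [hp]
    have := hw.one_pos
    positivity
  · obtain ⟨n, hn, hn'⟩ := hw.exists_pos
    refine ⟨n - 1, by omega, ?_⟩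
    simp only [hp]
    rw [Nat.sub_add_cancel (by omega)]
    positivity

end Generic

/-! ### Moments of a critical law -/

/-- The variance of an offspring law of mean `1`. -/
noncomputable def offspringVariance (p : ℕ → ℝ≥0) : ℝ := ∑' n : ℕ, (p n : ℝ) * ((n : ℝ) - 1) ^ 2

namespace IsCriticalLaw

variable {p : ℕ → ℝ≥0}

theorem hasSum_one (hp : IsCriticalLaw p) : HasSum (fun n => (p n : ℝ)) 1 := by
  have h1 : Summable p := by
    rw [← ENNReal.tsum_coe_ne_top_iff_summable, hp.tsum_eq_one]
    exact ENNReal.one_ne_top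
  have h := hp.tsum_eq_one
  rw [← ENNReal.coe_tsum h1, ENNReal.coe_eq_one] at h
  have h2 := h1.hasSum
  rw [h] at h2
  simpa using NNReal.hasSum_coe.2 h2

theorem hasSum_mul (hp : IsCriticalLaw p) : HasSum (fun n : ℕ => (p n : ℝ) * n) 1 := by
  have h := hp.tsum_mul_eq_one
  have h0 : ∀ n : ℕ, (p n : ℝ≥0∞) * n = ((p n * n : ℝ≥0) : ℝ≥0∞) := fun n => by push_cast; rfl
  simp only [h0] at h
  have h1 : Summable fun n : ℕ => p n * n := by
    rw [← ENNReal.tsum_coe_ne_top_iff_summable, h]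
    exact ENNReal.one_ne_top
  rw [← ENNReal.coe_tsum h1, ENNReal.coe_eq_one] at h
  have h2 := h1.hasSum
  rw [h] at h2
  simpa using NNReal.hasSum_coe.2 h2

theorem summable_mul_sq (hp : IsCriticalLaw p) : Summable fun n : ℕ => (p n : ℝ) * (n : ℝ) ^ 2 := by
  obtain ⟨ρ, hρ, hs⟩ := hp.exists_moment
  have h1 : Tendsto (fun n : ℕ => (n : ℝ) ^ 2 * ρ⁻¹ ^ n) atTop (𝓝 0) := by
    refine tendsto_pow_const_mul_const_pow_of_abs_lt_one 2 ?_
    rw [abs_of_pos (by positivity)]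
    exact inv_lt_one_of_one_lt₀ hρ
  obtain ⟨B, hB⟩ := h1.bddAbove_range
  refine Summable.of_nonneg_of_le (fun n => by positivity) (fun n => ?_) (hs.mul_left B)
  have h2 : (n : ℝ) ^ 2 * ρ⁻¹ ^ n ≤ B := hB ⟨n, rfl⟩
  rw [inv_pow, ← div_eq_mul_inv, div_le_iff₀ (by positivity)] at h2
  calc (p n : ℝ) * (n : ℝ) ^ 2 ≤ p n * (B * ρ ^ n) := by gcongr
    _ = _ := by ring

theorem hasSum_variance (hp : IsCriticalLaw p) :
    HasSum (fun n : ℕ => (p n : ℝ) * ((n : ℝ) - 1) ^ 2) (offspringVariance p) := by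
  refine Summable.hasSum ?_
  refine ((hp.summable_mul_sq.sub (hp.hasSum_mul.summable.mul_left 2)).add
    hp.hasSum_one.summable).congr fun n => ?_
  ring

theorem hasSum_mul_sq (hp : IsCriticalLaw p) :
    HasSum (fun n : ℕ => (p n : ℝ) * (n : ℝ) ^ 2) (1 + offspringVariance p) := by
  have h := (hp.hasSum_variance.add (hp.hasSum_mul.mul_left 2)).sub hp.hasSum_one
  rw [show 1 + offspringVariance p = offspringVariance p + 2 * 1 - 1 by ring]
  refine (congrArg (fun f : ℕ → ℝ => HasSum f _) (funext fun n => ?_)).mp h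
  ring

theorem variance_pos (hp : IsCriticalLaw p) : 0 < offspringVariance p := by
  have h := hp.hasSum_variance
  have h1 := h.summable.le_tsum 0 fun n _ => by positivity
  rw [h.tsum_eq] at h1
  refine lt_of_lt_of_le ?_ h1
  have := hp.zero_pos
  simpa using this

theorem tsum_mul_sq (hp : IsCriticalLaw p) :
    ∑' n : ℕ, (p n : ℝ≥0∞) * (n : ℝ≥0∞) ^ 2 = ENNReal.ofReal (1 + offspringVariance p) := by
  rw [← hp.hasSum_mul_sq.tsum_eq, ENNReal.ofReal_tsum_of_nonneg (fun n => by positivity)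
    hp.summable_mul_sq]
  refine tsum_congr fun n => ?_
  rw [ENNReal.ofReal_mul (by positivity), ENNReal.ofReal_coe_nnreal,
    ENNReal.ofReal_pow (by positivity), ENNReal.ofReal_natCast]

/-- The second derivative of the generating function at `1` is the variance. -/
theorem deriv_deriv (hp : IsCriticalLaw p) :
    deriv (deriv fun s : ℝ => ∑' n, (p n : ℝ) * s ^ n) 1 = offspringVariance p := by
  obtain ⟨ρ, hρ, hs⟩ := hp.exists_moment
  obtain ⟨r, hr, hrρ⟩ := exists_between hρ
  have hs' : Summable fun n => |(p n : ℝ)| * ρ ^ n := by simpa using hs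
  have h1 : deriv (fun s : ℝ => ∑' n, (p n : ℝ) * s ^ n) =ᶠ[𝓝 1]
      fun s => ∑' n : ℕ, (p (n + 1) : ℝ) * (n + 1) * s ^ n := by
    filter_upwards [isOpen_Ioo.mem_nhds (show (1 : ℝ) ∈ Set.Ioo (-ρ) ρ from ⟨by linarith, hρ⟩)]
      with s hs1
    exact (hasDerivAt_tsum_pow hs' (abs_lt.2 hs1)).deriv
  rw [h1.deriv_eq]
  have h2 := summable_mul_pow_of_lt hs' (by linarith) hrρ
  rw [(hasDerivAt_tsum_pow h2 (x := 1) (by simpa using hr)).deriv]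
  have h3 : HasSum (fun n : ℕ => (p n : ℝ) * (n * (n - 1))) (offspringVariance p) := by
    have h := hp.hasSum_mul_sq.sub hp.hasSum_mul
    rw [add_sub_cancel_left] at h
    refine (congrArg (fun f : ℕ → ℝ => HasSum f _) (funext fun n => ?_)).mp h
    ring
  rw [← h3.tsum_eq, h3.summable.tsum_eq_zero_add,
    ((summable_nat_add_iff 1).2 h3.summable).tsum_eq_zero_add]
  simp only [Nat.cast_zero, zero_mul, mul_zero, zero_add, Nat.cast_one, sub_self, one_pow, mul_one]
  refine tsum_congr fun n => ?_
  push_cast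
  ring

/-! ### The local limit theorem -/

/-- The characteristic function of the number of children minus one. -/
noncomputable def _root_.stepCharFun (p : ℕ → ℝ≥0) (t : ℝ) : ℂ :=
  ∑' n : ℕ, (p n : ℂ) * Complex.exp ((t * ((n : ℝ) - 1) : ℝ) * Complex.I)

theorem norm_step (t : ℝ) (n : ℕ) :
    ‖(p n : ℂ) * Complex.exp ((t * ((n : ℝ) - 1) : ℝ) * Complex.I)‖ = p n := by
  rw [norm_mul, Complex.norm_exp_ofReal_mul_I, mul_one]
  simp

theorem summable_step (hp : IsCriticalLaw p) (t : ℝ) :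
    Summable fun n : ℕ => ‖(p n : ℂ) * Complex.exp ((t * ((n : ℝ) - 1) : ℝ) * Complex.I)‖ := by
  simp only [norm_step]
  exact hp.hasSum_one.summable

theorem continuous_stepCharFun (hp : IsCriticalLaw p) : Continuous (stepCharFun p) := by
  refine continuous_tsum (fun n => by fun_prop) hp.hasSum_one.summable fun n t => ?_
  rw [norm_step]

/-- The two steps `-1` and `a - 1`, taken with the probabilities `p 0` and `p a`, already keep the
characteristic function away from modulus one, except where `cos (a t) = 1`. -/
theorem norm_stepCharFun_le (hp : IsCriticalLaw p) {a : ℕ} (ha : 0 < a) (hpa : 0 < p a) :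
    ∃ b : ℝ, 0 < b ∧ ∀ t : ℝ, ‖stepCharFun p t‖ ≤ 1 - b * (1 - Real.cos (a * t)) := by
  have h0 : (0 : ℝ) < p 0 := by exact_mod_cast hp.zero_pos
  have h1 : (0 : ℝ) < p a := by exact_mod_cast hpa
  set A : ℝ := p 0 + p a
  have hA : 0 < A := by positivity
  refine ⟨p 0 * p a / A, by positivity, fun t => ?_⟩
  set f : ℕ → ℂ := fun n => (p n : ℂ) * Complex.exp ((t * ((n : ℝ) - 1) : ℝ) * Complex.I)
  have hf : Summable f := (hp.summable_step t).of_norm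
  have hne : (0 : ℕ) ≠ a := ha.ne
  have hsplit := hf.sum_add_tsum_compl (s := {0, a})
  have hsplit' := hp.hasSum_one.summable.sum_add_tsum_compl (s := {0, a})
  rw [Finset.sum_pair hne] at hsplit hsplit'
  rw [hp.hasSum_one.tsum_eq] at hsplit'
  have hrest : ‖∑' n : ↑((({0, a} : Finset ℕ) : Set ℕ)ᶜ), f n‖ ≤ 1 - A := by
    have : ∑' n : ↑((({0, a} : Finset ℕ) : Set ℕ)ᶜ), (p n : ℝ) = 1 - A := by
      simp only [A]; linarith
    rw [← this]
    refine (norm_tsum_le_tsum_norm ?_).trans (le_of_eq (tsum_congr fun n => norm_step t n))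
    exact (hp.summable_step t).subtype _
  have hmain : ‖f 0 + f a‖ ≤ A - p 0 * p a / A * (1 - Real.cos (a * t)) := by
    have hfac : f 0 + f a = Complex.exp ((-t : ℝ) * Complex.I) *
        ((p 0 : ℝ) + (p a : ℝ) * Complex.exp ((a * t : ℝ) * Complex.I)) := by
      simp only [f]
      rw [mul_add, mul_comm (Complex.exp _) ((p 0 : ℝ) : ℂ), mul_left_comm, ← Complex.exp_add]
      congr 3
      · push_cast; ring
      · push_cast; ring
    rw [hfac, norm_mul, Complex.norm_exp_ofReal_mul_I, one_mul]
    have hc := Real.neg_one_le_cos (a * t)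
    have hc' := Real.cos_le_one (a * t)
    have hb : p 0 * p a / A * A = p 0 * p a := div_mul_cancel₀ _ hA.ne'
    have hbA : p 0 * p a / A * 2 ≤ A := by
      rw [div_mul_eq_mul_div, div_le_iff₀ hA]
      simp only [A]
      nlinarith [sq_nonneg ((p 0 : ℝ) - p a)]
    have hb0 : (0 : ℝ) ≤ p 0 * p a / A := by positivity
    refine abs_le_of_sq_le_sq' ?_ ?_ |>.2
    · rw [← Complex.normSq_eq_norm_sq, Complex.exp_mul_I, Complex.normSq_apply]
      simp only [← Complex.ofReal_cos, ← Complex.ofReal_sin, Complex.add_re, Complex.ofReal_re,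
        Complex.mul_re, Complex.add_im, Complex.ofReal_im, Complex.mul_im, Complex.I_re,
        Complex.I_im]
      have hsc := Real.sin_sq_add_cos_sq (a * t)
      have : (A - p 0 * p a / A * (1 - Real.cos (a * t))) ^ 2 =
          A ^ 2 - 2 * (p 0 * p a) * (1 - Real.cos (a * t)) +
            (p 0 * p a / A * (1 - Real.cos (a * t))) ^ 2 := by
        linear_combination (-2 * (1 - Real.cos (a * t))) * hb
      rw [this]
      have h2 : (0 : ℝ) ≤ (p 0 * p a / A * (1 - Real.cos (a * t))) ^ 2 := sq_nonneg _
      refine le_trans (le_of_eq ?_) (le_add_of_nonneg_right h2)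
      simp only [A]
      linear_combination (p a : ℝ) ^ 2 * hsc
    · nlinarith
  calc ‖stepCharFun p t‖ = ‖f 0 + f a + ∑' n : ↑((({0, a} : Finset ℕ) : Set ℕ)ᶜ), f n‖ := by
        rw [hsplit]; rfl
    _ ≤ ‖f 0 + f a‖ + ‖∑' n : ↑((({0, a} : Finset ℕ) : Set ℕ)ᶜ), f n‖ := norm_add_le _ _
    _ ≤ _ := by linarith

/-- The period `d` of the offspring law is the greatest common divisor of its support, and on
`|t| ≤ π / d` the characteristic function has modulus one only at `t = 0`. -/
theorem exists_period (hp : IsCriticalLaw p) :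
    ∃ d : ℕ, 0 < d ∧ (∀ n, p n ≠ 0 → d ∣ n) ∧
      ∀ t : ℝ, |t| ≤ Real.pi / d → ‖stepCharFun p t‖ = 1 → t = 0 := by
  obtain ⟨g, hg⟩ := Int.subgroup_cyclic
    (AddSubgroup.closure ((fun n : ℕ => (n : ℤ)) '' {n | p n ≠ 0}))
  have hdvd : ∀ n, p n ≠ 0 → g.natAbs ∣ n := by
    intro n hn
    have : (n : ℤ) ∈ AddSubgroup.closure ((fun n : ℕ => (n : ℤ)) '' {n | p n ≠ 0}) :=
      AddSubgroup.subset_closure ⟨n, hn, rfl⟩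
    rw [hg, AddSubgroup.mem_closure_singleton] at this
    obtain ⟨k, hk⟩ := this
    rw [← Int.natCast_dvd_natCast, Int.natAbs_dvd]
    exact ⟨k, by rw [← hk, smul_eq_mul, mul_comm]⟩
  have hpos : 0 < g.natAbs := by
    obtain ⟨a, ha, hpa⟩ := hp.exists_pos
    refine Nat.pos_of_ne_zero fun h => ?_
    have := hdvd a hpa.ne'
    rw [h, zero_dvd_iff] at this
    omega
  refine ⟨g.natAbs, hpos, hdvd, fun t ht hnorm => ?_⟩
  -- the integers `k` for which `exp (i k t) = 1`
  let H : AddSubgroup ℤ :=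
    { carrier := {k | ∃ n : ℤ, (k : ℝ) * t = n * (2 * Real.pi)}
      add_mem' := by
        rintro a b ⟨m, hm⟩ ⟨n, hn⟩
        exact ⟨m + n, by push_cast; linarith⟩
      zero_mem' := ⟨0, by simp⟩
      neg_mem' := by
        rintro a ⟨m, hm⟩
        exact ⟨-m, by push_cast; linarith⟩ }
  have hH : AddSubgroup.closure ((fun n : ℕ => (n : ℤ)) '' {n | p n ≠ 0}) ≤ H := by
    rw [AddSubgroup.closure_le]
    rintro _ ⟨a, ha, rfl⟩
    rcases Nat.eq_zero_or_pos a with rfl | ha0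
    · exact H.zero_mem
    obtain ⟨b, hb, hle⟩ := hp.norm_stepCharFun_le ha0 (pos_iff_ne_zero.2 ha)
    have h1 := hle t
    rw [hnorm] at h1
    have h2 : Real.cos (a * t) = 1 := by
      refine le_antisymm (Real.cos_le_one _) ?_
      by_contra hlt
      have := mul_pos hb (show 0 < 1 - Real.cos (a * t) by linarith)
      linarith
    obtain ⟨n, hn⟩ := (Real.cos_eq_one_iff _).1 h2
    exact ⟨n, by rw [hn]; simp⟩
  obtain ⟨n, hn⟩ := hH (show g ∈ _ by rw [hg]; exact AddSubgroup.subset_closure rfl)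
  have hgR : |(g : ℝ)| = (g.natAbs : ℝ) := by rw [Nat.cast_natAbs, Int.cast_abs]
  have hposR : (0 : ℝ) < g.natAbs := by exact_mod_cast hpos
  have hpi := Real.pi_pos
  have hn0 : n = 0 := by
    have h1 : |(n : ℝ) * (2 * Real.pi)| ≤ Real.pi := by
      rw [← hn, abs_mul, hgR]
      rw [le_div_iff₀ hposR] at ht
      linarith
    rw [abs_mul, abs_of_pos (by positivity : 0 < 2 * Real.pi)] at h1
    have h2 : |(n : ℝ)| < 1 := by nlinarith
    exact Int.abs_lt_one_iff.1 (by exact_mod_cast h2)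
  rw [hn0, Int.cast_zero, zero_mul, mul_eq_zero] at hn
  refine hn.resolve_left fun h => ?_
  rw [h, abs_zero] at hgR
  linarith

/-- A Gaussian bound on a period, which dominates the integrals in the local limit theorem. Near `0`
it follows from `norm_stepCharFun_le`, and on the rest of the period from compactness. -/
theorem exists_norm_stepCharFun_le_exp (hp : IsCriticalLaw p) {B : ℝ} (hB : 0 < B)
    (hper : ∀ t : ℝ, |t| ≤ B → ‖stepCharFun p t‖ = 1 → t = 0) :
    ∃ c : ℝ, 0 < c ∧ ∀ t : ℝ, |t| ≤ B → ‖stepCharFun p t‖ ≤ Real.exp (-c * t ^ 2) := by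
  obtain ⟨a, ha, hpa⟩ := hp.exists_pos
  have haR : (0 : ℝ) < a := by exact_mod_cast (show 0 < a by omega)
  obtain ⟨b, hb, hle⟩ := hp.norm_stepCharFun_le (a := a) (by omega) hpa
  have hpi := Real.pi_pos
  have hle1 : ∀ t, ‖stepCharFun p t‖ ≤ 1 := fun t => (hle t).trans <| by
    have := mul_nonneg hb.le (sub_nonneg.2 (Real.cos_le_one (a * t)))
    linarith
  set c₁ : ℝ := b * (2 / Real.pi ^ 2 * a ^ 2)
  have hc₁ : 0 < c₁ := by positivity
  have hnear : ∀ t : ℝ, |t| ≤ Real.pi / a → ‖stepCharFun p t‖ ≤ Real.exp (-c₁ * t ^ 2) := by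
    intro t ht
    have hat : |a * t| ≤ Real.pi := by
      rw [abs_mul, abs_of_pos haR]
      rw [le_div_iff₀ haR] at ht
      linarith
    have h1 := Real.cos_le_one_sub_mul_cos_sq hat
    have h2 := Real.add_one_le_exp (-c₁ * t ^ 2)
    have h3 := mul_le_mul_of_nonneg_left h1 hb.le
    refine (hle t).trans (le_trans ?_ h2)
    simp only [c₁]
    nlinarith
  set K : Set ℝ := {t | |t| ≤ B ∧ Real.pi / a ≤ |t|}
  have hK : IsCompact K := by
    refine (isCompact_Icc (a := -B) (b := B)).of_isClosed_subset ?_ fun t ht => abs_le.1 ht.1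
    exact (isClosed_le continuous_abs continuous_const).inter
      (isClosed_le continuous_const continuous_abs)
  obtain ⟨q, hq, hqK⟩ : ∃ q : ℝ, q < 1 ∧ ∀ t ∈ K, ‖stepCharFun p t‖ ≤ q := by
    rcases K.eq_empty_or_nonempty with h | h
    · exact ⟨0, zero_lt_one, by simp [h]⟩
    · obtain ⟨t₀, ht₀, hmax⟩ := hK.exists_isMaxOn h hp.continuous_stepCharFun.norm.continuousOn
      refine ⟨_, lt_of_le_of_ne (hle1 t₀) fun h1 => ?_, fun t ht => hmax ht⟩
      have h2 := ht₀.2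
      rw [hper t₀ ht₀.1 h1, abs_zero] at h2
      exact absurd h2 (not_le.2 (by positivity))
  set c₂ : ℝ := (1 - q) / B ^ 2
  have hc₂ : 0 < c₂ := div_pos (by linarith) (by positivity)
  refine ⟨min c₁ c₂, lt_min hc₁ hc₂, fun t ht => ?_⟩
  have ht2 := sq_nonneg t
  rcases le_total |t| (Real.pi / a) with h | h
  · refine (hnear t h).trans (Real.exp_le_exp.2 ?_)
    have := mul_le_mul_of_nonneg_right (min_le_left c₁ c₂) ht2
    linarith
  · refine (hqK t ⟨ht, h⟩).trans ?_
    have h1 : min c₁ c₂ * t ^ 2 ≤ c₂ * B ^ 2 := by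
      have h2 : t ^ 2 ≤ B ^ 2 := sq_le_sq' (abs_le.1 ht).1 (abs_le.1 ht).2
      have h3 := min_le_right c₁ c₂
      have h4 : 0 ≤ min c₁ c₂ := (lt_min hc₁ hc₂).le
      gcongr
    have h2 : c₂ * B ^ 2 = 1 - q := div_mul_cancel₀ _ (by positivity)
    have h3 := Real.add_one_le_exp (-min c₁ c₂ * t ^ 2)
    linarith

theorem dvd_of_convPow_ne_zero {d : ℕ} (hd : ∀ n, p n ≠ 0 → d ∣ n) (M : ℕ) {k : ℕ}
    (h : convPow p M k ≠ 0) : d ∣ k := by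
  induction M generalizing k with
  | zero =>
    rw [convPow_zero] at h
    obtain rfl : k = 0 := by by_contra hk; simp [hk] at h
    exact dvd_zero d
  | succ M ih =>
    rw [convPow_succ] at h
    obtain ⟨q, hq, hne⟩ := Finset.exists_ne_zero_of_sum_ne_zero h
    rw [← Finset.HasAntidiagonal.mem_antidiagonal.1 hq]
    exact dvd_add (ih (left_ne_zero_of_mul hne)) (hd _ (right_ne_zero_of_mul hne))

/-- The characteristic function of a sum of `M` independent steps. -/
theorem hasSum_convPow_step (hp : IsCriticalLaw p) (M : ℕ) (t : ℝ) :
    HasSum (fun k : ℕ => (convPow p M k : ℂ) *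
      Complex.exp ((t * ((k : ℝ) - M) : ℝ) * Complex.I)) (stepCharFun p t ^ M) ∧
    Summable fun k : ℕ => ‖(convPow p M k : ℂ) *
      Complex.exp ((t * ((k : ℝ) - M) : ℝ) * Complex.I)‖ := by
  induction M with
  | zero =>
    have h : ∀ k : ℕ, k ≠ 0 → (convPow p 0 k : ℂ) *
        Complex.exp ((t * ((k : ℝ) - (0 : ℕ)) : ℝ) * Complex.I) = 0 := by
      intro k hk
      simp [convPow_zero, hk]
    refine ⟨?_, summable_of_ne_finset_zero (s := {0}) fun k hk => ?_⟩
    · have := hasSum_single 0 h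
      simpa [convPow_zero] using this
    · rw [h k (by simpa using hk), norm_zero]
  | succ M ih =>
    set f : ℕ → ℂ := fun k => (convPow p M k : ℂ) *
      Complex.exp ((t * ((k : ℝ) - M) : ℝ) * Complex.I)
    set g : ℕ → ℂ := fun n => (p n : ℂ) * Complex.exp ((t * ((n : ℝ) - 1) : ℝ) * Complex.I)
    have hg : Summable fun n => ‖g n‖ := hp.summable_step t
    have hfg : ∀ k : ℕ, (convPow p (M + 1) k : ℂ) *
        Complex.exp ((t * ((k : ℝ) - (M + 1 : ℕ)) : ℝ) * Complex.I) =
        ∑ q ∈ Finset.HasAntidiagonal.antidiagonal k, f q.1 * g q.2 := by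
      intro k
      rw [convPow_succ]
      push_cast
      rw [Finset.sum_mul]
      refine Finset.sum_congr rfl fun q hq => ?_
      rw [← Finset.HasAntidiagonal.mem_antidiagonal.1 hq]
      simp only [f, g]
      rw [mul_mul_mul_comm, ← Complex.exp_add]
      congr 2
      push_cast
      ring
    simp only [hfg]
    have hs := summable_norm_sum_mul_antidiagonal_of_summable_norm ih.2 hg
    refine ⟨?_, hs⟩
    have h := tsum_mul_tsum_eq_tsum_sum_antidiagonal_of_summable_norm ih.2 hg
    rw [ih.1.tsum_eq] at h
    rw [pow_succ]
    have h2 := hs.of_norm.hasSum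
    rw [← h] at h2
    exact h2

theorem integral_exp_mul_int {d : ℝ} (hd : 0 < d) (l : ℤ) :
    ∫ t in (-(Real.pi / d))..(Real.pi / d), Complex.exp ((t * (d * l) : ℝ) * Complex.I) =
      if l = 0 then ((2 * Real.pi / d : ℝ) : ℂ) else 0 := by
  split_ifs with h
  · simp [h]
    ring
  · have hc : ((d * l : ℝ) : ℂ) * Complex.I ≠ 0 := by
      refine mul_ne_zero ?_ Complex.I_ne_zero
      have : (l : ℝ) ≠ 0 := by exact_mod_cast h
      exact_mod_cast mul_ne_zero hd.ne' this
    have h1 := integral_exp_mul_complex (a := -(Real.pi / d)) (b := Real.pi / d) hc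
    have h2 : ∀ t : ℝ, Complex.exp ((t * (d * l) : ℝ) * Complex.I) =
        Complex.exp (((d * l : ℝ) : ℂ) * Complex.I * t) := by
      intro t
      congr 1
      push_cast
      ring
    simp only [h2]
    rw [h1, div_eq_zero_iff, sub_eq_zero]
    left
    have hd' : (d : ℂ) ≠ 0 := by exact_mod_cast hd.ne'
    rw [Complex.exp_eq_exp_iff_exists_int]
    refine ⟨l, ?_⟩
    push_cast
    field_simp
    ring

/-- Fourier inversion on the lattice of multiples of the period. -/
theorem convPow_eq_integral (hp : IsCriticalLaw p) {d : ℕ} (hd0 : 0 < d)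
    (hd : ∀ n, p n ≠ 0 → d ∣ n) (K m : ℕ) :
    ((2 * Real.pi / d : ℝ) : ℂ) * convPow p (d * K + m) (d * K) =
      ∫ t in (-(Real.pi / d))..(Real.pi / d),
        stepCharFun p t ^ (d * K + m) * Complex.exp ((t * m : ℝ) * Complex.I) := by
  have hdR : (0 : ℝ) < d := by exact_mod_cast hd0
  set M := d * K + m
  have hsum := intervalIntegral.hasSum_integral_of_dominated_convergence (μ := volume)
    (a := -(Real.pi / d)) (b := Real.pi / d)
    (F := fun (k : ℕ) (t : ℝ) => (convPow p M k : ℂ) *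
      Complex.exp ((t * ((k : ℝ) - M) : ℝ) * Complex.I) * Complex.exp ((t * m : ℝ) * Complex.I))
    (f := fun t => stepCharFun p t ^ M * Complex.exp ((t * m : ℝ) * Complex.I))
    (fun k _ => convPow p M k)
    (fun k => Continuous.aestronglyMeasurable (by fun_prop))
    (fun k => Eventually.of_forall fun t _ => by
      rw [norm_mul, norm_mul, Complex.norm_exp_ofReal_mul_I, Complex.norm_exp_ofReal_mul_I]
      simp)
    (Eventually.of_forall fun t _ => by
      have := (hp.hasSum_convPow_step M t).2
      simp only [norm_mul, Complex.norm_exp_ofReal_mul_I, mul_one] at this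
      simpa using this)
    intervalIntegrable_const
    (Eventually.of_forall fun t _ => (hp.hasSum_convPow_step M t).1.mul_right _)
  have hterm : ∀ k : ℕ, ∫ t in (-(Real.pi / d))..(Real.pi / d), (convPow p M k : ℂ) *
      Complex.exp ((t * ((k : ℝ) - M) : ℝ) * Complex.I) * Complex.exp ((t * m : ℝ) * Complex.I) =
      if k = d * K then ((2 * Real.pi / d : ℝ) : ℂ) * convPow p M (d * K) else 0 := by
    intro k
    by_cases hk : d ∣ k
    · obtain ⟨l, rfl⟩ := hk
      have h1 : ∀ t : ℝ, (convPow p M (d * l) : ℂ) *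
          Complex.exp ((t * (((d * l : ℕ) : ℝ) - M) : ℝ) * Complex.I) *
            Complex.exp ((t * m : ℝ) * Complex.I) =
          (convPow p M (d * l) : ℂ) *
            Complex.exp ((t * ((d : ℝ) * ((l : ℤ) - (K : ℤ) : ℤ)) : ℝ) * Complex.I) := by
        intro t
        rw [mul_assoc, ← Complex.exp_add]
        congr 2
        simp only [M]
        push_cast
        ring
      simp only [h1]
      rw [intervalIntegral.integral_const_mul, integral_exp_mul_int hdR]
      by_cases hlK : l = K
      · subst hlK
        simp only [sub_self, if_true]
        ring
      · rw [if_neg (by omega), if_neg (fun h => hlK (Nat.eq_of_mul_eq_mul_left hd0 h)), mul_zero]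
    · have h0 : convPow p M k = 0 := by
        by_contra hne
        exact hk (dvd_of_convPow_ne_zero hd M hne)
      rw [if_neg (fun h => hk ⟨K, h⟩), h0]
      simp
  simp only [hterm] at hsum
  exact (hasSum_ite_eq (d * K) _).unique hsum

/-- The central limit theorem for the characteristic functions: the one in Mathlib is applied to
the normalised steps `(n - 1) / √κ`. -/
theorem tendsto_stepCharFun_pow (hp : IsCriticalLaw p) (s : ℝ) :
    Tendsto (fun M : ℕ => stepCharFun p (s / √M) ^ M) atTop
      (𝓝 (Complex.exp ((-(offspringVariance p / 2) * s ^ 2 : ℝ)))) := by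
  set κ := offspringVariance p
  have hκ : 0 < κ := hp.variance_pos
  have hsq : 0 < √κ := Real.sqrt_pos.2 hκ
  let P : PMF ℕ := ⟨fun n => p n, by
    have := ENNReal.summable.hasSum (f := fun n => (p n : ℝ≥0∞))
    rwa [hp.tsum_eq_one] at this⟩
  have hPn : ∀ n, (P n).toReal = p n := fun n => rfl
  set X : ℕ → ℝ := fun n => ((n : ℝ) - 1) / √κ
  have hX : Measurable X := measurable_from_top
  have hint : ∀ {E : Type} [NormedAddCommGroup E] [NormedSpace ℝ E] [MeasurableSpace E]
      [BorelSpace E] [SecondCountableTopology E] [CompleteSpace E] (f : ℕ → E),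
      Summable (fun n => (p n : ℝ) * ‖f n‖) → ∫ n, f n ∂P.toMeasure = ∑' n, (p n : ℝ) • f n := by
    intro E _ _ _ _ _ _ f hf
    have hi : Integrable f P.toMeasure := by
      refine ⟨(measurable_from_top (f := f)).aestronglyMeasurable, ?_⟩
      rw [hasFiniteIntegral_iff_enorm, lintegral_countable']
      have h1 : ∀ n, ‖f n‖ₑ * P.toMeasure {n} = ((p n * ‖f n‖₊ : ℝ≥0) : ℝ≥0∞) := by
        intro n
        rw [PMF.toMeasure_apply_singleton _ _ (measurableSet_singleton n), mul_comm]
        rfl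
      simp only [h1]
      rw [lt_top_iff_ne_top, ENNReal.tsum_coe_ne_top_iff_summable, ← NNReal.summable_coe]
      refine hf.congr fun n => ?_
      rw [NNReal.coe_mul, coe_nnnorm]
    rw [PMF.integral_eq_tsum _ _ hi]
    rfl
  have hmean : ∫ n, X n ∂P.toMeasure = 0 := by
    have h1 : HasSum (fun n : ℕ => (p n : ℝ) • X n) 0 := by
      have := (hp.hasSum_mul.sub hp.hasSum_one).div_const (√κ)
      rw [sub_self, zero_div] at this
      refine (congrArg (fun f : ℕ → ℝ => HasSum f _) (funext fun n => ?_)).mp this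
      simp only [X, smul_eq_mul]
      ring
    rw [hint X, h1.tsum_eq]
    refine Summable.of_nonneg_of_le (fun n => by positivity) (fun n => ?_)
      ((hp.hasSum_mul.summable.add hp.hasSum_one.summable).div_const (√κ))
    rw [Real.norm_eq_abs, abs_div, abs_of_pos hsq, ← mul_div_assoc]
    have : |(n : ℝ) - 1| ≤ n + 1 := by
      rw [abs_le]; constructor <;> linarith [(Nat.cast_nonneg n : (0 : ℝ) ≤ n)]
    have h2 : (p n : ℝ) * |(n : ℝ) - 1| ≤ p n * n + p n := by
      rw [← mul_add_one]
      gcongr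
    gcongr
  have hvar : ∫ n, (X ^ 2) n ∂P.toMeasure = 1 := by
    have h1 : HasSum (fun n : ℕ => (p n : ℝ) • (X ^ 2) n) 1 := by
      have := hp.hasSum_variance.div_const κ
      rw [div_self hκ.ne'] at this
      refine (congrArg (fun f : ℕ → ℝ => HasSum f _) (funext fun n => ?_)).mp this
      simp only [X, smul_eq_mul, Pi.pow_apply, div_pow, Real.sq_sqrt hκ.le]
      ring
    rw [hint (X ^ 2), h1.tsum_eq]
    refine h1.summable.congr fun n => ?_
    rw [smul_eq_mul, Real.norm_of_nonneg]
    simp only [Pi.pow_apply]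
    positivity
  have hchar : ∀ u : ℝ, charFun (P.toMeasure.map X) u = stepCharFun p (u / √κ) := by
    intro u
    rw [charFun_apply_real, integral_map hX.aemeasurable (by fun_prop), hint]
    · refine tsum_congr fun n => ?_
      rw [Complex.real_smul]
      congr 2
      simp only [X]
      push_cast
      ring
    · refine hp.hasSum_one.summable.congr fun n => ?_
      have : (u : ℂ) * (X n : ℂ) * Complex.I = ((u * X n : ℝ) : ℂ) * Complex.I := by push_cast; rfl
      rw [this, Complex.norm_exp_ofReal_mul_I, mul_one]
  have key := ProbabilityTheory.tendsto_charFun_inv_sqrt_mul_pow hX.aemeasurable hmean hvar (√κ * s)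
  have h1 : ∀ M : ℕ, (√(M : ℝ))⁻¹ * (√κ * s) / √κ = s / √M := by
    intro M
    field_simp
  simp only [hchar, h1] at key
  convert key using 2
  push_cast
  rw [mul_pow, ← Complex.ofReal_pow (√κ), Real.sq_sqrt hκ.le]
  congr 1
  ring

/-- The local limit theorem along the lattice of possible values: the probability that `d * K + m`
individuals have `d * K` children decays like the inverse square root of their number, with a
constant that does not depend on `m`. -/
theorem tendsto_sqrt_mul_convPow (hp : IsCriticalLaw p) :
    ∃ d : ℕ, 0 < d ∧ (∀ n, p n ≠ 0 → d ∣ n) ∧ ∃ L : ℝ, 0 < L ∧ ∀ m : ℕ,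
      Tendsto (fun K : ℕ => √((d * K + m : ℕ) : ℝ) * (convPow p (d * K + m) (d * K) : ℝ)) atTop
        (𝓝 L) := by
  obtain ⟨d, hd0, hd, hper⟩ := hp.exists_period
  have hdR : (0 : ℝ) < d := by exact_mod_cast hd0
  have hpi := Real.pi_pos
  have hκ := hp.variance_pos
  set B : ℝ := Real.pi / d with hBdef
  have hB : 0 < B := by positivity
  obtain ⟨c, hc, hle⟩ := hp.exists_norm_stepCharFun_le_exp hB hper
  set I : ℝ := ∫ s : ℝ, Real.exp (-(offspringVariance p / 2) * s ^ 2)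
  have hI : 0 < I := by
    simp only [I]
    rw [integral_gaussian]
    positivity
  refine ⟨d, hd0, hd, I / (2 * Real.pi / d), by positivity, fun m => ?_⟩
  -- the integrand of Fourier inversion after the substitution `t = s / √M`
  set F : ℕ → ℝ → ℂ := fun M => (Set.Ioc (-B * √M) (B * √M)).indicator
    fun s => stepCharFun p (s / √M) ^ M * Complex.exp ((s / √M * m : ℝ) * Complex.I)
  have hcont := hp.continuous_stepCharFun
  have hlim : Tendsto (fun M : ℕ => ∫ s, F M s) atTop
      (𝓝 (∫ s : ℝ, Complex.exp ((-(offspringVariance p / 2) * s ^ 2 : ℝ)))) := by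
    refine tendsto_integral_filter_of_dominated_convergence
      (fun s => Real.exp (-c * s ^ 2)) ?_ ?_ (integrable_exp_neg_mul_sq hc) ?_
    · refine Eventually.of_forall fun M => ?_
      refine AEStronglyMeasurable.indicator ?_ measurableSet_Ioc
      exact Continuous.aestronglyMeasurable (by fun_prop)
    · filter_upwards [eventually_gt_atTop 0] with M hM
      refine Eventually.of_forall fun s => ?_
      have hMR : (0 : ℝ) < M := by exact_mod_cast hM
      have hsM : 0 < √(M : ℝ) := Real.sqrt_pos.2 hMR
      by_cases hs : s ∈ Set.Ioc (-B * √M) (B * √M)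
      · simp only [F]
        rw [Set.indicator_of_mem hs, norm_mul, Complex.norm_exp_ofReal_mul_I, mul_one, norm_pow]
        have h1 : |s / √M| ≤ B := by
          rw [abs_div, abs_of_pos hsM, div_le_iff₀ hsM, abs_le]
          exact ⟨by linarith [hs.1], hs.2⟩
        refine (pow_le_pow_left₀ (norm_nonneg _) (hle _ h1) M).trans (le_of_eq ?_)
        rw [← Real.exp_nat_mul, div_pow, Real.sq_sqrt hMR.le]
        congr 1
        field_simp
      · simp only [F]
        rw [Set.indicator_of_notMem hs, norm_zero]
        positivity
    · refine Eventually.of_forall fun s => ?_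
      have hsq : Tendsto (fun M : ℕ => √(M : ℝ)) atTop atTop :=
        Real.tendsto_sqrt_atTop.comp tendsto_natCast_atTop_atTop
      have h0 : Tendsto (fun M : ℕ => s / √(M : ℝ)) atTop (𝓝 0) := hsq.const_div_atTop s
      have h1 : Tendsto (fun M : ℕ => Complex.exp ((s / √M * m : ℝ) * Complex.I)) atTop (𝓝 1) := by
        have hc : Continuous fun x : ℝ => Complex.exp ((x * m : ℝ) * Complex.I) := by fun_prop
        have := (hc.tendsto 0).comp h0
        simp only [Complex.ofReal_zero, zero_mul, Complex.exp_zero] at this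
        exact this
      have h2 := (hp.tendsto_stepCharFun_pow s).mul h1
      rw [mul_one] at h2
      refine h2.congr' ?_
      filter_upwards [hsq.eventually_gt_atTop (|s| / B)] with M hM
      simp only [F]
      rw [Set.indicator_of_mem]
      rw [div_lt_iff₀ hB, abs_lt] at hM
      exact ⟨by linarith [hM.1], by linarith [hM.2]⟩
  have hconv : ∀ K : ℕ, 0 < d * K + m → ∫ s, F (d * K + m) s =
      ((2 * Real.pi / d * (√((d * K + m : ℕ) : ℝ) * convPow p (d * K + m) (d * K)) : ℝ) : ℂ) := by
    intro K hK
    set M := d * K + m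
    have hsM : 0 < √(M : ℝ) := Real.sqrt_pos.2 (by exact_mod_cast hK)
    simp only [F]
    rw [integral_indicator measurableSet_Ioc, ← intervalIntegral.integral_of_le (by nlinarith)]
    have h1 := intervalIntegral.integral_comp_div (a := -B * √M) (b := B * √M)
      (fun t => stepCharFun p t ^ M * Complex.exp ((t * m : ℝ) * Complex.I)) hsM.ne'
    rw [h1, mul_div_cancel_right₀ _ hsM.ne', mul_div_cancel_right₀ _ hsM.ne',
      ← hp.convPow_eq_integral hd0 hd K m, Complex.real_smul]
    push_cast
    ring
  have hreal : ∫ s : ℝ, Complex.exp ((-(offspringVariance p / 2) * s ^ 2 : ℝ)) = (I : ℂ) := by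
    simp only [← Complex.ofReal_exp]
    exact integral_ofReal
  rw [hreal] at hlim
  have hdK : Tendsto (fun K : ℕ => d * K + m) atTop atTop :=
    tendsto_atTop_mono (fun K => (Nat.le_mul_of_pos_left K hd0).trans (Nat.le_add_right _ m))
      tendsto_id
  have h3 := (Complex.continuous_re.tendsto _).comp (hlim.comp hdK)
  rw [Complex.ofReal_re] at h3
  have h4 := h3.div_const (2 * Real.pi / d)
  refine h4.congr' ?_
  filter_upwards [eventually_gt_atTop 0] with K hK
  simp only [Function.comp_apply]
  rw [hconv K (by positivity), Complex.ofReal_re, mul_div_cancel_left₀]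
  positivity

end IsCriticalLaw

/-! ### The infinite volume limit of the ball probabilities -/

section Tilting

variable {p v : ℕ → ℝ≥0} {b z : ℝ≥0}

/-- Tilting the weights by `n ↦ b * z ^ n` only multiplies the convolution powers by a factor. -/
theorem convPow_of_tilt (hp : ∀ n, p n = b * (v n * z ^ n)) (M k : ℕ) :
    convPow p M k = b ^ M * (convPow v M k * z ^ k) := by
  induction M generalizing k with
  | zero =>
    rw [convPow_zero, convPow_zero]
    split_ifs with h <;> simp [h]
  | succ M ih =>
    rw [convPow_succ, convPow_succ, Finset.sum_mul, Finset.mul_sum]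
    refine Finset.sum_congr rfl fun q hq => ?_
    rw [ih, hp, ← Finset.HasAntidiagonal.mem_antidiagonal.1 hq]
    ring

theorem levelWeight_of_tilt (hp : ∀ n, p n = b * (v n * z ^ n)) (R : ℕ) (T : PlanarTree) :
    levelWeight p R T = b ^ (∑ k ∈ Finset.range R, T.width (k + 1)) *
      (levelWeight v R T * z ^ (∑ k ∈ Finset.range R, T.width (k + 2))) := by
  simp only [levelWeight, hp, Finset.prod_mul_distrib, Finset.prod_const, Finset.card_range,
    Finset.prod_pow_eq_pow_sum, width_succ]

end Tilting

/-- Every vertex at the heights `1, …, R + 1`, except the one at height `1`, is a child of a vertex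
at the heights `1, …, R`. -/
theorem sum_width_add_one (T : PlanarTree) (R : ℕ) :
    (∑ k ∈ Finset.range R, T.width (k + 2)) + 1 =
      (∑ k ∈ Finset.range R, T.width (k + 1)) + T.width (R + 1) := by
  rw [← Finset.sum_range_succ (fun k => T.width (k + 1)),
    Finset.sum_range_succ' (fun k => T.width (k + 1)), zero_add, T.width_one]

theorem dvd_sum_width {p : ℕ → ℝ≥0} {d : ℕ} (hd : ∀ n, p n ≠ 0 → d ∣ n) {R : ℕ} {T : PlanarTree}
    (h : levelWeight p R T ≠ 0) : d ∣ ∑ k ∈ Finset.range R, T.width (k + 2) := by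
  refine Finset.dvd_sum fun k hk => ?_
  rw [width_succ]
  refine Finset.dvd_sum fun i hi => hd _ ?_
  exact Finset.prod_ne_zero_iff.1 (Finset.prod_ne_zero_iff.1 h k hk) i hi

/-- The ratio limit theorem that gives the limit of the ball probabilities; it holds because the
constant in the local limit theorem does not depend on the residue `m`. -/
theorem IsCriticalLaw.tendsto_ratio {p : ℕ → ℝ≥0} {d : ℕ} (hd0 : 0 < d) {L : ℝ} (hL : 0 < L)
    (h : ∀ m : ℕ, Tendsto (fun K : ℕ => √((d * K + m : ℕ) : ℝ) *
      (convPow p (d * K + m) (d * K) : ℝ)) atTop (𝓝 L)) {m n e : ℕ} (hmn : d * e + 1 = n + m) :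
    Tendsto (fun K : ℕ => ((n + (d * K + m) : ℕ) : ℝ) / ((d * K + m : ℕ) : ℝ) *
      (convPow p (d * K + m) (d * K) / convPow p (n + (d * K + m)) (n + (d * K + m) - 1)))
      atTop (𝓝 1) := by
  have hM : Tendsto (fun K : ℕ => ((d * K + m : ℕ) : ℝ)) atTop atTop :=
    tendsto_natCast_atTop_atTop.comp
      (tendsto_atTop_mono (fun K => (Nat.le_mul_of_pos_left K hd0).trans (Nat.le_add_right _ m))
        tendsto_id)
  have hr : Tendsto (fun K : ℕ => ((n + (d * K + m) : ℕ) : ℝ) / ((d * K + m : ℕ) : ℝ)) atTop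
      (𝓝 1) := by
    have h1 := (hM.const_div_atTop (n : ℝ)).add_const 1
    rw [zero_add] at h1
    refine h1.congr' ?_
    filter_upwards [hM.eventually_gt_atTop 0] with K hK
    rw [Nat.cast_add n, add_div, div_self hK.ne']
  have h1 := (h 1).comp (tendsto_add_atTop_nat e)
  have h2 := hr.mul (((h m).div h1 hL.ne').mul hr.sqrt)
  rw [div_self hL.ne', Real.sqrt_one, mul_one, mul_one] at h2
  refine h2.congr' ?_
  filter_upwards [hM.eventually_gt_atTop 0] with K hK
  have hN : d * (K + e) + 1 = n + (d * K + m) := by rw [mul_add]; omega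
  have hN' : d * (K + e) = n + (d * K + m) - 1 := by omega
  simp only [Pi.div_apply, Function.comp_apply]
  rw [hN, hN']
  have hs1 : √((d * K + m : ℕ) : ℝ) ≠ 0 := (Real.sqrt_pos.2 hK).ne'
  have hs2 : √((n + (d * K + m) : ℕ) : ℝ) ≠ 0 := by
    refine (Real.sqrt_pos.2 (hK.trans_le ?_)).ne'
    exact_mod_cast Nat.le_add_left _ _
  rw [Real.sqrt_div' _ hK.le]
  congr 1
  field_simp

/-- The probability at finite volume that a tree coincides with `T` up to height `R + 1` tends to
the probability of this event for the critical branching process, biased by the number of vertices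
at height `R + 1`. The limit is taken along `N = d K + 1`, where `d` is the period of the offspring
law. -/
theorem IsGeneric.exists_tendsto_ball {w : ℕ → ℝ≥0} (hw : IsGeneric w) :
    ∃ p : ℕ → ℝ≥0, (∀ n, offspringProb w n = p n) ∧ IsCriticalLaw p ∧
      (atTop ⊓ 𝓟 {N | partitionFunction w N ≠ 0}).NeBot ∧
      ∀ (R : ℕ) (T : PlanarTree),
        Tendsto (fun N => finiteVolumeMeasure w N (ball (R + 1) T))
          (atTop ⊓ 𝓟 {N | partitionFunction w N ≠ 0})
          (𝓝 (T.width (R + 1) * levelWeight p R T : ℝ≥0∞)) := by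
  obtain ⟨p, a, z, ha, hz, hpw, hoff, hp⟩ := hw.exists_isCriticalLaw
  set v : ℕ → ℝ≥0 := fun n => w (n + 1)
  have htilt : ∀ n, p n = a / z * (v n * z ^ n) := hpw
  obtain ⟨d, hd0, hd, L, hL, hlim⟩ := hp.tendsto_sqrt_mul_convPow
  -- the number of forests in terms of the offspring law
  have hforest : ∀ M m : ℕ, 0 < M → m ≤ M →
      forestSum v m M * a ^ M = m / M * convPow p M (M - m) * z ^ m := by
    intro M m hM hmM
    rw [forestSum_of_le v hM hmM, convPow_of_tilt htilt, div_pow]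
    have : z ^ M = z ^ (M - m) * z ^ m := by rw [← pow_add, Nat.sub_add_cancel hmM]
    rw [this]
    field_simp
  have hZ : ∀ N, partitionFunction w N ≠ 0 → 0 < N ∧ d ∣ N - 1 := by
    intro N hN
    rw [partitionFunction_eq, ENNReal.coe_ne_zero] at hN
    have hN0 : 0 < N := by
      refine Nat.pos_of_ne_zero ?_
      rintro rfl
      exact hN (by simp [forestSum_zero_right])
    refine ⟨hN0, IsCriticalLaw.dvd_of_convPow_ne_zero hd N (k := N - 1) fun h => hN ?_⟩
    have := hforest N 1 hN0 hN0
    rw [h, mul_zero, zero_mul] at this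
    exact (mul_eq_zero.1 this).resolve_right (by positivity)
  have hpos : ∀ᶠ K in atTop, 0 < convPow p (d * K + 1) (d * K) := by
    filter_upwards [(hlim 1).eventually_const_lt hL] with K hK
    exact_mod_cast pos_of_mul_pos_right hK (Real.sqrt_nonneg _)
  have hZpos : ∀ᶠ K in atTop, 0 < forestSum v 1 (d * K + 1) := by
    filter_upwards [hpos] with K hK
    rw [forestSum_of_le v (by omega) (by omega)]
    rw [convPow_of_tilt htilt] at hK
    have : 0 < convPow v (d * K + 1) (d * K) := by
      refine pos_iff_ne_zero.2 fun h => ?_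
      simp [h] at hK
    rw [Nat.add_sub_cancel]
    positivity
  refine ⟨p, hoff, hp, ?_, fun R T => ?_⟩
  · rw [← frequently_mem_iff_neBot, frequently_atTop]
    intro N
    obtain ⟨K, hK, hNK⟩ := (hZpos.and (eventually_ge_atTop N)).exists
    refine ⟨d * K + 1, ?_, ?_⟩
    · have := Nat.le_mul_of_pos_left K hd0
      omega
    · rw [Set.mem_ofPred_eq, partitionFunction_eq, ENNReal.coe_ne_zero]
      exact hK.ne'
  set n := ∑ k ∈ Finset.range R, T.width (k + 1) with hn
  set m := T.width (R + 1) with hm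
  have hW := levelWeight_of_tilt htilt R T
  have hnm := sum_width_add_one T R
  -- if the limit is zero, so are the ball probabilities themselves
  by_cases hP : (m : ℝ≥0) * levelWeight p R T = 0
  · have hlim0 : (m * levelWeight p R T : ℝ≥0∞) = 0 := by exact_mod_cast hP
    rw [hlim0]
    refine tendsto_const_nhds.congr' (EventuallyEq.filter_mono ?_ inf_le_left)
    filter_upwards [eventually_gt_atTop n] with N hN
    obtain ⟨M, rfl⟩ := Nat.exists_eq_add_of_le hN.le
    rw [hn, finiteVolumeMeasure_ball]
    rcases mul_eq_zero.1 hP with h | h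
    · have h0 : T.width (R + 1) = 0 := by exact_mod_cast h
      rw [h0, forestSum_zero_left, if_neg (by omega)]
      simp
    · rw [hW] at h
      have h0 : levelWeight v R T = 0 := by
        by_contra hne
        have : 0 < levelWeight v R T := pos_iff_ne_zero.2 hne
        exact absurd h (by positivity)
      rw [h0]
      simp
  · obtain ⟨hm0, hP0⟩ := mul_ne_zero_iff.1 hP
    have hm0 : m ≠ 0 := by exact_mod_cast hm0
    obtain ⟨e, he⟩ := dvd_sum_width hd hP0
    rw [he] at hnm hW
    have key : Tendsto (fun K : ℕ => finiteVolumeMeasure w (n + (d * K + m)) (ball (R + 1) T))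
        atTop (𝓝 (m * levelWeight p R T : ℝ≥0∞)) := by
      have h1 := (IsCriticalLaw.tendsto_ratio hd0 hL hlim hnm).const_mul
        ((m : ℝ) * levelWeight p R T)
      rw [mul_one] at h1
      have h2 : Tendsto (fun K : ℕ => (m : ℝ≥0) * levelWeight p R T *
          (((n + (d * K + m) : ℕ) : ℝ≥0) / ((d * K + m : ℕ) : ℝ≥0) *
          (convPow p (d * K + m) (d * K) /
            convPow p (n + (d * K + m)) (n + (d * K + m) - 1)))) atTop
          (𝓝 ((m : ℝ≥0) * levelWeight p R T)) := by
        rw [← NNReal.tendsto_coe]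
        simpa only [NNReal.coe_mul, NNReal.coe_div, NNReal.coe_natCast] using h1
      have h3 := ENNReal.tendsto_coe.2 h2
      rw [ENNReal.coe_mul, ENNReal.coe_natCast] at h3
      refine h3.congr' ?_
      filter_upwards [(tendsto_add_atTop_nat e).eventually hpos] with K hK
      have hN : d * (K + e) + 1 = n + (d * K + m) := by rw [mul_add]; omega
      have hN' : d * (K + e) = n + (d * K + m) - 1 := by omega
      rw [hN, hN'] at hK
      set M := d * K + m with hM
      have hM0 : 0 < M := by omega
      have hf1 := hforest (n + M) 1 (by omega) (by omega)
      have hf2 := hforest M m hM0 (by omega)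
      rw [show M - m = d * K by omega] at hf2
      have hz' : z ^ m * z ^ n = z ^ (d * e) * z := by rw [← pow_succ, hnm, ← pow_add, add_comm]
      rw [finiteVolumeMeasure_ball]
      have hF1 : forestSum v 1 (n + M) = (1 / (n + M : ℕ) *
          convPow p (n + M) (n + M - 1) * z) / a ^ (n + M) := by
        rw [eq_div_iff (by positivity), hf1, Nat.cast_one, pow_one]
      have hF2 : forestSum v m M = (m / M * convPow p M (d * K) * z ^ m) / a ^ M := by
        rw [eq_div_iff (by positivity), hf2]
      have hF1pos : forestSum v 1 (n + M) ≠ 0 := by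
        rw [hF1]; positivity
      have hnM : ((n + M : ℕ) : ℝ≥0) ≠ 0 := by
        have : 0 < n + M := by omega
        positivity
      rw [← hn, ← hm, ← ENNReal.coe_inv hF1pos, ← ENNReal.coe_mul, ← ENNReal.coe_mul,
        ENNReal.coe_inj, hF1, hF2, hW, div_pow]
      have hKne := hK.ne'
      have hMne : (M : ℝ≥0) ≠ 0 := by positivity
      field_simp
      rw [← hn, pow_add a n M]
      calc a ^ n * levelWeight v R T * z ^ (d * e) * convPow p M (d * K) * z * a ^ M
          = (z ^ (d * e) * z) * (a ^ n * levelWeight v R T * convPow p M (d * K) * a ^ M) := by ring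
        _ = _ := by rw [← hz']; ring
    -- all large `N` with nonzero partition function are of the form `d * (K + e) + 1`
    have hcomp : Tendsto (fun N : ℕ => (N - 1) / d - e) atTop atTop := by
      refine (tendsto_sub_atTop_nat e).comp ?_
      refine (Nat.tendsto_div_const_atTop hd0.ne').comp (tendsto_sub_atTop_nat 1)
    refine ((key.comp hcomp).mono_left inf_le_left).congr' ?_
    refine (eventually_inf_principal.2 ?_)
    filter_upwards [eventually_gt_atTop (d * e + 1)] with N hN hZN
    obtain ⟨-, K, hK⟩ := hZ N hZN
    have hKe : e ≤ K := by
      by_contra hlt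
      have := Nat.mul_le_mul_left d (show K ≤ e by omega)
      omega
    obtain ⟨K, rfl⟩ := Nat.exists_eq_add_of_le hKe
    simp only [Function.comp_apply]
    rw [hK, Nat.mul_div_cancel_left _ hd0, Nat.add_sub_cancel_left]
    congr 1
    rw [mul_add] at hK
    congr 1
    omega

/-! ### Moments of sums of offspring numbers -/

namespace IsCriticalLaw

variable {p : ℕ → ℝ≥0}

theorem tsum_convPow (hp : IsCriticalLaw p) (m : ℕ) :
    ∑' s, (convPow p m s : ℝ≥0∞) = 1 := by
  have := tsum_convPow_mul_pow p m 1
  simpa [hp.tsum_eq_one] using this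

theorem tsum_convPow_mul_cast (hp : IsCriticalLaw p) (m : ℕ) :
    ∑' s : ℕ, (convPow p m s : ℝ≥0∞) * s = m := by
  induction m with
  | zero =>
    rw [tsum_eq_single 0 (by intro s hs; simp [convPow_zero, hs])]
    simp
  | succ m ih =>
    rw [tsum_convPow_succ]
    have : ∀ i j : ℕ, (convPow p m i : ℝ≥0∞) * p j * ((i + j : ℕ) : ℝ≥0∞) =
        (convPow p m i * i) * p j + convPow p m i * (p j * j) := by
      intro i j
      push_cast
      ring
    simp only [this, ENNReal.tsum_add, ENNReal.tsum_mul_left, hp.tsum_eq_one, hp.tsum_mul_eq_one,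
      ih, hp.tsum_convPow, mul_one]
    push_cast
    rfl

theorem tsum_convPow_mul_sq (hp : IsCriticalLaw p) (m : ℕ) :
    ∑' s : ℕ, (convPow p m s : ℝ≥0∞) * (s : ℝ≥0∞) ^ 2 =
      (m : ℝ≥0∞) ^ 2 + ENNReal.ofReal (offspringVariance p) * m := by
  induction m with
  | zero =>
    rw [tsum_eq_single 0 (by intro s hs; simp [convPow_zero, hs])]
    simp
  | succ m ih =>
    rw [tsum_convPow_succ]
    have : ∀ i j : ℕ, (convPow p m i : ℝ≥0∞) * p j * ((i + j : ℕ) : ℝ≥0∞) ^ 2 =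
        (convPow p m i * (i : ℝ≥0∞) ^ 2) * p j + 2 * ((convPow p m i * i) * (p j * j)) +
          convPow p m i * (p j * (j : ℝ≥0∞) ^ 2) := by
      intro i j
      push_cast
      ring
    simp only [this, ENNReal.tsum_add, ENNReal.tsum_mul_left, ENNReal.tsum_mul_right,
      hp.tsum_eq_one, hp.tsum_mul_eq_one, ih, hp.tsum_convPow, mul_one, hp.tsum_convPow_mul_cast,
      hp.tsum_mul_sq]
    rw [ENNReal.ofReal_add zero_le_one hp.variance_pos.le, ENNReal.ofReal_one]
    push_cast
    ring

end IsCriticalLaw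

/-! ### Existence and uniqueness of the infinite volume limit -/

/-- The law of the tree obtained from the critical branching process by biasing the ball of radius
`R` by the number of vertices at height `R`. -/
def IsSizeBiased (p : ℕ → ℝ≥0) (μ : Measure PlanarTree) : Prop :=
  ∀ (R : ℕ) (T : PlanarTree), μ (ball (R + 1) T) = T.width (R + 1) * levelWeight p R T

/-- The law of the numbers of children of the `m` vertices at some height, biased by the total
number of children. For `m = 0`, where there is nothing to bias, it is the law of the empty
family. -/
noncomputable def biasedStep (p : ℕ → ℝ≥0) (m : ℕ) : Measure (Fin m → ℕ) :=
  Measure.sum fun c => ((∏ i, (p (c i) : ℝ≥0∞)) *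
    (if m = 0 then 1 else ((∑ i, c i : ℕ) : ℝ≥0∞) / m)) • Measure.dirac c

theorem biasedStep_singleton (p : ℕ → ℝ≥0) (m : ℕ) (c : Fin m → ℕ) :
    biasedStep p m {c} = (∏ i, (p (c i) : ℝ≥0∞)) *
      (if m = 0 then 1 else ((∑ i, c i : ℕ) : ℝ≥0∞) / m) := by
  rw [biasedStep, Measure.sum_apply _ (measurableSet_singleton c), tsum_eq_single c]
  · rw [Measure.smul_apply, Measure.dirac_apply' _ (measurableSet_singleton c)]
    simp
  · intro c' hc'
    rw [Measure.smul_apply, Measure.dirac_apply' _ (measurableSet_singleton c)]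
    simp [hc']

theorem IsCriticalLaw.isProbabilityMeasure_biasedStep {p : ℕ → ℝ≥0} (hp : IsCriticalLaw p)
    (m : ℕ) : IsProbabilityMeasure (biasedStep p m) := by
  constructor
  rw [biasedStep, Measure.sum_apply _ MeasurableSet.univ]
  simp only [Measure.smul_apply, measure_univ, smul_eq_mul, mul_one]
  have h := tsum_pi_prod_mul p m fun s => if m = 0 then 1 else (s : ℝ≥0∞) / m
  rw [h]
  split_ifs with hm
  · simp [hp.tsum_convPow]
  · simp only [div_eq_mul_inv, ← mul_assoc]
    rw [ENNReal.tsum_mul_right, hp.tsum_convPow_mul_cast]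
    exact ENNReal.mul_inv_cancel (by simpa using hm) (ENNReal.natCast_ne_top m)

/-- The width at height `k + 1` of the tree in which `ω (k, m)` are the numbers of children of the
vertices at height `k + 1` if there are `m` of them. -/
def widthOf (ω : ∀ i : ℕ × ℕ, Fin i.2 → ℕ) : ℕ → ℕ
  | 0 => 1
  | k + 1 => ∑ i, ω (k, widthOf ω k) i

/-- The numbers of children in the tree of `widthOf`. -/
def childrenOf (ω : ∀ i : ℕ × ℕ, Fin i.2 → ℕ) : ℕ → ℕ → ℕ
  | 0, i => if i = 0 then 1 else 0
  | k + 1, i => if h : i < widthOf ω k then ω (k, widthOf ω k) ⟨i, h⟩ else 0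

theorem levelWidth_childrenOf (ω : ∀ i : ℕ × ℕ, Fin i.2 → ℕ) (k : ℕ) :
    levelWidth (childrenOf ω) (k + 1) = widthOf ω k := by
  induction k with
  | zero => simp [levelWidth, childrenOf, widthOf]
  | succ k ih =>
    rw [levelWidth, ih, widthOf, Finset.sum_range]
    exact Finset.sum_congr rfl fun i _ => dif_pos i.2

/-- The tree in which `ω (k, m)` are the numbers of children of the vertices at height `k + 1` if
there are `m` of them. -/
def treeOf (ω : ∀ i : ℕ × ℕ, Fin i.2 → ℕ) : PlanarTree where
  children := childrenOf ω
  children_root := rfl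
  children_eq_zero k i h := by
    cases k with
    | zero => exact if_neg (by simp only [levelWidth] at h; omega)
    | succ k =>
      rw [levelWidth_childrenOf] at h
      exact dif_neg (by omega)

theorem mem_ball_succ_iff {R : ℕ} {S T : PlanarTree} :
    S ∈ ball (R + 2) T ↔ S ∈ ball (R + 1) T ∧
      ∀ i : Fin (T.width (R + 1)), S.children (R + 1) i = T.children (R + 1) i := by
  rw [← mem_ball_extend, ball_eq_of_mem (mem_ball_extend.2 ⟨mem_ball_self _ T, fun _ => rfl⟩)]

theorem treeOf_mem_ball (ω : ∀ i : ℕ × ℕ, Fin i.2 → ℕ) (R : ℕ) (T : PlanarTree) :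
    treeOf ω ∈ ball (R + 1) T ↔
      ∀ k < R, ω (k, T.width (k + 1)) =
        fun i : Fin (T.width (k + 1)) => T.children (k + 1) i := by
  induction R with
  | zero => simp [ball_one]
  | succ R ih =>
    rw [mem_ball_succ_iff, ih]
    have hstep : ∀ m (f : ℕ → ℕ), widthOf ω R = m →
        ((∀ i : Fin m, (treeOf ω).children (R + 1) i = f i) ↔
          ω (R, m) = fun i : Fin m => f i) := by
      rintro _ f rfl
      rw [funext_iff]
      refine forall_congr' fun i => ?_
      rw [show (treeOf ω).children (R + 1) i = ω (R, widthOf ω R) i from dif_pos i.2]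
    constructor
    · rintro ⟨h1, h2⟩ k hk
      rcases Nat.lt_succ_iff_lt_or_eq.1 hk with hk | rfl
      · exact h1 k hk
      · refine (hstep _ _ ?_).1 h2
        rw [← levelWidth_childrenOf]
        exact width_eq_of_mem_ball (ih.2 h1) le_rfl
    · intro h
      have h1 : ∀ k < R, ω (k, T.width (k + 1)) =
          fun i : Fin (T.width (k + 1)) => T.children (k + 1) i :=
        fun k hk => h k (by omega)
      refine ⟨h1, (hstep _ _ ?_).2 (h R (by omega))⟩
      rw [← levelWidth_childrenOf]
      exact width_eq_of_mem_ball (ih.2 h1) le_rfl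

theorem preimage_treeOf_ball (R : ℕ) (T : PlanarTree) :
    treeOf ⁻¹' ball (R + 1) T =
      Set.pi ((Finset.range R).image fun k => (k, T.width (k + 1)) : Finset (ℕ × ℕ))
        fun i : ℕ × ℕ => {fun j : Fin i.2 => T.children (i.1 + 1) j} := by
  ext ω
  simp [treeOf_mem_ball, Set.mem_pi]

theorem measurable_treeOf : Measurable treeOf := by
  refine measurable_generateFrom ?_
  rintro _ ⟨R, T, rfl⟩
  cases R with
  | zero => rw [ball_zero, Set.preimage_univ]; exact MeasurableSet.univ
  | succ R =>
    rw [preimage_treeOf_ball]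
    exact MeasurableSet.pi (Finset.countable_toSet _) fun i _ => measurableSet_singleton _

/-- The tree is built level by level from independent choices, one for every height and every
possible number of vertices at that height. -/
theorem IsCriticalLaw.exists_isSizeBiased {p : ℕ → ℝ≥0} (hp : IsCriticalLaw p) :
    ∃ μ : Measure PlanarTree, IsSizeBiased p μ := by
  have := hp.isProbabilityMeasure_biasedStep
  refine ⟨(Measure.infinitePi fun i : ℕ × ℕ => biasedStep p i.2).map treeOf, fun R T => ?_⟩
  rw [Measure.map_apply measurable_treeOf (measurableSet_ball _ _), preimage_treeOf_ball,
    Measure.infinitePi_pi _ fun i _ => measurableSet_singleton _,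
    Finset.prod_image fun k _ l _ h => congrArg Prod.fst h]
  induction R with
  | zero => simp [levelWeight, T.width_one]
  | succ R ih =>
    rw [Finset.prod_range_succ, ih, biasedStep_singleton]
    have hW : levelWeight p (R + 1) T =
        levelWeight p R T * ∏ i : Fin (T.width (R + 1)), p (T.children (R + 1) i) := by
      rw [levelWeight, Finset.prod_range_succ, ← levelWeight, Finset.prod_range]
    rw [hW, width_succ T (R + 1), Finset.sum_range]
    by_cases h0 : T.width (R + 1) = 0
    · have : IsEmpty (Fin (T.width (R + 1))) := by rw [h0]; infer_instance
      simp [h0]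
    · rw [if_neg h0]
      have h1 : (T.width (R + 1) : ℝ≥0∞) ≠ 0 := by simpa using h0
      have h2 := ENNReal.mul_div_cancel (b := ((∑ i : Fin (T.width (R + 1)),
        T.children (R + 1) i : ℕ) : ℝ≥0∞)) h1 (ENNReal.natCast_ne_top _)
      push_cast at h2 ⊢
      conv_rhs => rw [← h2]
      ring

theorem IsSizeBiased.isProbabilityMeasure {p : ℕ → ℝ≥0} {μ : Measure PlanarTree}
    (h : IsSizeBiased p μ) : IsProbabilityMeasure μ := by
  constructor
  have := h 0 (treeOf fun _ _ => 0)
  rw [ball_one, width_one] at this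
  simpa [levelWeight] using this

theorem IsSizeBiased.measure_width_eq_zero {p : ℕ → ℝ≥0} {μ : Measure PlanarTree}
    (h : IsSizeBiased p μ) (k : ℕ) : μ {T | T.width (k + 1) = 0} = 0 := by
  have key : ∀ (j R : ℕ) (T : PlanarTree),
      ∫⁻ S in ball (R + 1) T, {S : PlanarTree | S.width (R + 1 + j) = 0}.indicator 1 S ∂μ = 0 := by
    intro j
    induction j with
    | zero =>
      intro R T
      rw [setLIntegral_congr_fun (measurableSet_ball _ _) (g := fun _ =>
        if T.width (R + 1) = 0 then 1 else 0) fun S hS => by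
          simp [Set.indicator_apply, width_eq_of_mem_ball hS le_rfl]]
      rw [setLIntegral_const, h]
      split_ifs with h0 <;> simp [h0]
    | succ j ih =>
      intro R T
      rw [lintegral_ball, ENNReal.tsum_eq_zero]
      intro c
      have := ih (R + 1) (T.extend R c)
      rwa [show R + 1 + 1 + j = R + 1 + (j + 1) by ring] at this
  have := key k 0 (treeOf fun _ _ => 0)
  rw [ball_one, Measure.restrict_univ, zero_add, add_comm, lintegral_indicator_one] at this
  · exact this
  · exact measurable_width (k + 1) (measurableSet_singleton 0)

theorem IsSizeBiased.ae_infinite {p : ℕ → ℝ≥0} {μ : Measure PlanarTree}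
    (h : IsSizeBiased p μ) : ∀ᵐ T ∂μ, Infinite T.Vertex := by
  have : ∀ᵐ T : PlanarTree ∂μ, ∀ k, T.width (k + 1) ≠ 0 :=
    ae_all_iff.2 fun k => by
      rw [ae_iff]
      simpa using h.measure_width_eq_zero k
  filter_upwards [this] with T hT
  rw [infinite_vertex_iff]
  intro k
  cases k with
  | zero => exact Nat.one_pos
  | succ k => exact Nat.pos_of_ne_zero (hT k)

theorem measurableEmbedding_val :
    MeasurableEmbedding (Subtype.val : InfiniteTree → PlanarTree) :=
  MeasurableEmbedding.subtype_coe measurableSet_infinite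

/-- The infinite volume limits are the size-biased laws, seen as measures on infinite trees. -/
theorem isInfiniteVolumeLimit_iff {w p : ℕ → ℝ≥0}
    (hne : (atTop ⊓ 𝓟 {N | partitionFunction w N ≠ 0}).NeBot)
    (hlim : ∀ (R : ℕ) (T : PlanarTree),
        Tendsto (fun N => finiteVolumeMeasure w N (ball (R + 1) T))
          (atTop ⊓ 𝓟 {N | partitionFunction w N ≠ 0})
          (𝓝 (T.width (R + 1) * levelWeight p R T : ℝ≥0∞))) (ν : Measure InfiniteTree) :
    IsInfiniteVolumeLimit w ν ↔ IsSizeBiased p (ν.map Subtype.val) := by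
  have hmap : ∀ (R : ℕ) (T : PlanarTree),
      ν.map Subtype.val (ball R T) = ν {S : InfiniteTree | S.1 ∈ ball R T} :=
    fun R T => Measure.map_apply measurable_subtype_coe (measurableSet_ball R T)
  constructor
  · rintro ⟨-, h⟩ R T
    rw [hmap]
    exact tendsto_nhds_unique (h (R + 1) T) (hlim R T)
  · intro h
    have hp := h.isProbabilityMeasure
    refine ⟨⟨?_⟩, fun R T => ?_⟩
    · have := hp.measure_univ
      rwa [Measure.map_apply measurable_subtype_coe MeasurableSet.univ, Set.preimage_univ] at this
    · cases R with
      | zero =>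
        have h1 := hlim 0 T
        rw [← hmap, ball_zero, ← ball_one T, h]
        exact h1
      | succ R =>
        rw [← hmap, h]
        exact hlim R T

theorem IsGeneric.existsUnique_isInfiniteVolumeLimit {w : ℕ → ℝ≥0} (hw : IsGeneric w) :
    ∃! ν : Measure InfiniteTree, IsInfiniteVolumeLimit w ν := by
  obtain ⟨p, -, hp, hne, hlim⟩ := hw.exists_tendsto_ball
  obtain ⟨μ, hμ⟩ := hp.exists_isSizeBiased
  have hprob := hμ.isProbabilityMeasure
  have hν : (μ.comap (Subtype.val : InfiniteTree → PlanarTree)).map Subtype.val = μ := by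
    rw [measurableEmbedding_val.map_comap]
    refine Measure.restrict_eq_self_of_ae_mem ?_
    filter_upwards [hμ.ae_infinite] with T hT
    exact ⟨⟨T, hT⟩, rfl⟩
  refine ⟨μ.comap Subtype.val, (isInfiniteVolumeLimit_iff hne hlim _).2 (by rwa [hν]),
    fun ν' hν' => ?_⟩
  have hν' := (isInfiniteVolumeLimit_iff hne hlim ν').1 hν'
  -- the balls form a `π`-system
  have hmap : ν'.map Subtype.val = μ := by
    have hp' := hν'.isProbabilityMeasure
    refine ext_of_generate_finite {A | ∃ R T, A = ball R T} rfl ?_ ?_ (by simp)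
    · rintro _ ⟨R, T, rfl⟩ _ ⟨R', T', rfl⟩ ⟨S, hS, hS'⟩
      rw [← ball_eq_of_mem hS, ← ball_eq_of_mem hS']
      refine ⟨max R R', S, ?_⟩
      rcases le_total R R' with h | h
      · rw [max_eq_right h, Set.inter_eq_right]
        exact ball_subset_ball h S
      · rw [max_eq_left h, Set.inter_eq_left]
        exact ball_subset_ball h S
    · rintro _ ⟨R, T, rfl⟩
      cases R with
      | zero => rw [ball_zero]; simp
      | succ R => rw [hν', hμ]
  rw [← hmap, measurableEmbedding_val.comap_map]

/-! ### The widths under the size-biased law -/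

/-- The transition operator of the critical branching process: the expectation of `h` at the number
of children of `m` individuals. -/
noncomputable def branchOp (p : ℕ → ℝ≥0) (h : ℕ → ℝ≥0∞) (m : ℕ) : ℝ≥0∞ :=
  ∑' s, (convPow p m s : ℝ≥0∞) * h s

namespace IsSizeBiased

variable {p : ℕ → ℝ≥0} {μ : Measure PlanarTree}

/-- Removing the bias by the width turns the widths into the critical branching process. -/
theorem lintegral_ball_width_div (hμ : IsSizeBiased p μ) {h : ℕ → ℝ≥0∞} (h0 : h 0 = 0) (j : ℕ) :
    ∀ (R : ℕ) (T : PlanarTree), ∫⁻ S in ball (R + 1) T,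
      h (S.width (R + 1 + j)) / S.width (R + 1 + j) ∂μ =
        levelWeight p R T * (branchOp p)^[j] h (T.width (R + 1)) := by
  induction j with
  | zero =>
    intro R T
    rw [setLIntegral_congr_fun (measurableSet_ball _ _) (g := fun _ =>
      h (T.width (R + 1)) / T.width (R + 1)) fun S hS => by
        simp only [add_zero, width_eq_of_mem_ball hS le_rfl]]
    rw [setLIntegral_const, hμ, Function.iterate_zero, id]
    by_cases hw : T.width (R + 1) = 0
    · simp [hw, h0]
    · rw [← mul_assoc, ENNReal.div_mul_cancel (by simpa using hw) (ENNReal.natCast_ne_top _),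
        mul_comm]
  | succ j ih =>
    intro R T
    rw [lintegral_ball, Function.iterate_succ_apply', branchOp, ← tsum_pi_prod_mul,
      ← ENNReal.tsum_mul_left]
    refine tsum_congr fun c => ?_
    have h1 := ih (R + 1) (T.extend R c)
    rw [show R + 1 + 1 + j = R + 1 + (j + 1) by ring, levelWeight_extend, width_extend] at h1
    rw [h1]
    push_cast
    ring

theorem lintegral_width_div (hμ : IsSizeBiased p μ) {h : ℕ → ℝ≥0∞} (h0 : h 0 = 0) (j : ℕ) :
    ∫⁻ T, h (T.width (j + 1)) / T.width (j + 1) ∂μ = (branchOp p)^[j] h 1 := by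
  have := hμ.lintegral_ball_width_div h0 j 0 (treeOf fun _ _ => 0)
  rw [ball_one, Measure.restrict_univ, width_one, zero_add, add_comm 1 j] at this
  simpa [levelWeight] using this

/-- The mean width of the size-biased tree is a second moment of the branching process, hence grows
linearly with the height. -/
theorem lintegral_width (hp : IsCriticalLaw p) (hμ : IsSizeBiased p μ) (j : ℕ) :
    ∫⁻ T, (T.width (j + 1) : ℝ≥0∞) ∂μ = 1 + ENNReal.ofReal (offspringVariance p) * j := by
  have hit : ∀ j : ℕ, (branchOp p)^[j] (fun m : ℕ => (m : ℝ≥0∞) ^ 2) =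
      fun m : ℕ => (m : ℝ≥0∞) ^ 2 + ENNReal.ofReal (offspringVariance p) * j * m := by
    intro j
    induction j with
    | zero => simp
    | succ j ih =>
      rw [Function.iterate_succ_apply', ih]
      funext m
      simp only [branchOp, mul_add, ENNReal.tsum_add, hp.tsum_convPow_mul_sq]
      have : ∀ s : ℕ, (convPow p m s : ℝ≥0∞) * (ENNReal.ofReal (offspringVariance p) * j * s) =
          ENNReal.ofReal (offspringVariance p) * j * (convPow p m s * s) := fun s => by ring
      simp only [this, ENNReal.tsum_mul_left, hp.tsum_convPow_mul_cast]
      push_cast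
      ring
  have h := hμ.lintegral_width_div (h := fun m : ℕ => (m : ℝ≥0∞) ^ 2) (by simp) j
  rw [hit] at h
  simp only [Nat.cast_one, one_pow, mul_one] at h
  rw [← h]
  refine lintegral_congr fun T => ?_
  by_cases hw : T.width (j + 1) = 0
  · simp [hw]
  · rw [pow_two, ENNReal.mul_div_cancel_right (by simpa using hw) (ENNReal.natCast_ne_top _)]

end IsSizeBiased

/-- One generation of the survival probability `q`, in terms of the generating function `f` of the
offspring law: `f(1 - q) ≥ 1 - q + c q²`. By Bernoulli's inequality `f(1 - q) ≥ 1 - q`, and the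
quadratic gain comes from a single `a ≥ 2` with `p a > 0`. -/
theorem IsCriticalLaw.exists_le_tsum {p : ℕ → ℝ≥0} (hp : IsCriticalLaw p) :
    ∃ c : ℝ, 0 < c ∧ ∀ q : ℝ, 0 ≤ q → q ≤ 1 →
      1 - q + c * q ^ 2 ≤ ∑' n, (p n : ℝ) * (1 - q) ^ n := by
  obtain ⟨a, ha, hpa⟩ := hp.exists_pos
  refine ⟨p a, by exact_mod_cast hpa, fun q hq0 hq1 => ?_⟩
  have hbern : ∀ n : ℕ, 1 - n * q ≤ (1 - q) ^ n := by
    intro n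
    have := one_add_mul_le_pow (a := -q) (by linarith) n
    rw [← sub_eq_add_neg] at this
    linarith
  have hbern2 : ∀ n : ℕ, 2 ≤ n → 1 - n * q + q ^ 2 ≤ (1 - q) ^ n := by
    intro n hn
    induction n, hn using Nat.le_induction with
    | base => push_cast; nlinarith
    | succ n hn ih =>
      have hn' : (2 : ℝ) ≤ n := by exact_mod_cast hn
      rw [pow_succ (1 - q) n]
      have h1 := mul_le_mul_of_nonneg_right ih (sub_nonneg.2 hq1)
      have h2 : 0 ≤ q ^ 2 * (n - q) := mul_nonneg (sq_nonneg q) (by linarith)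
      push_cast
      linarith
  have hs : HasSum (fun n : ℕ => (p n : ℝ) - q * (p n * n) + if n = a then p a * q ^ 2 else 0)
      (1 - q * 1 + p a * q ^ 2) :=
    (hp.hasSum_one.sub (hp.hasSum_mul.mul_left q)).add (hasSum_ite_eq a _)
  rw [mul_one] at hs
  rw [← hs.tsum_eq]
  refine hs.summable.tsum_le_tsum (fun n => ?_) ?_
  · split_ifs with hn
    · subst hn
      nlinarith [mul_le_mul_of_nonneg_left (hbern2 n ha) (p n).coe_nonneg]
    · nlinarith [mul_le_mul_of_nonneg_left (hbern n) (p n).coe_nonneg]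
  · refine Summable.of_nonneg_of_le (fun n => ?_) (fun n => ?_) hp.hasSum_one.summable
    · have := sub_nonneg.2 hq1
      positivity
    · exact mul_le_of_le_one_right (p n).coe_nonneg
        (pow_le_one₀ (sub_nonneg.2 hq1) (by linarith))

/-- Kolmogorov's estimate: the survival probability of the critical branching process decays at
least like the inverse of the height. -/
theorem IsCriticalLaw.exists_survival_le {p : ℕ → ℝ≥0} (hp : IsCriticalLaw p) :
    ∃ C : ℝ≥0, ∀ j : ℕ, (branchOp p)^[j] (fun m => if m = 0 then 0 else 1) 1 ≤
      (C : ℝ≥0∞) / (j + 1 : ℕ) := by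
  set f : ℝ≥0∞ → ℝ≥0∞ := fun x => ∑' n, (p n : ℝ≥0∞) * x ^ n
  set q : ℕ → ℝ≥0∞ := fun j => (branchOp p)^[j] (fun m => if m = 0 then 0 else 1) 1
  -- the `m` lines of descent die out independently, each with probability `f^[j] 0`
  have hit : ∀ (j m : ℕ),
      (branchOp p)^[j] (fun m => if m = 0 then 0 else 1) m + (f^[j] 0) ^ m = 1 := by
    intro j
    induction j with
    | zero =>
      intro m
      rcases eq_or_ne m 0 with rfl | hm <;> simp [*]
    | succ j ih =>
      intro m
      rw [Function.iterate_succ_apply', Function.iterate_succ_apply', branchOp]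
      have : f (f^[j] 0) ^ m = ∑' s, (convPow p m s : ℝ≥0∞) * (f^[j] 0) ^ s :=
        (tsum_convPow_mul_pow p m _).symm
      rw [this, ← ENNReal.tsum_add]
      simp only [← mul_add, ih, mul_one, hp.tsum_convPow]
  obtain ⟨c, hc, hle⟩ := hp.exists_le_tsum
  have hx1 : ∀ j, q j + f^[j] 0 = 1 := fun j => by simpa using hit j 1
  have hxle : ∀ j, f^[j] 0 ≤ 1 := fun j => (hx1 j).symm ▸ le_add_self
  have hqle : ∀ j, q j ≤ 1 := fun j => (hx1 j).symm ▸ le_self_add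
  have hreal : ∀ j, (f^[j] 0).toReal = 1 - (q j).toReal := by
    intro j
    have h := congrArg ENNReal.toReal (hx1 j)
    rw [ENNReal.toReal_add (ne_top_of_le_ne_top ENNReal.one_ne_top (hqle j))
      (ne_top_of_le_ne_top ENNReal.one_ne_top (hxle j)), ENNReal.toReal_one] at h
    linarith
  have hq1 : ∀ j, (q j).toReal ≤ 1 := fun j => by
    have := ENNReal.toReal_mono ENNReal.one_ne_top (hqle j)
    simpa using this
  have hstep : ∀ j, (q (j + 1)).toReal ≤ (q j).toReal - c * (q j).toReal ^ 2 := by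
    intro j
    have h1 := hle (q j).toReal ENNReal.toReal_nonneg (hq1 j)
    have h2 : (f^[j + 1] 0).toReal = ∑' n, (p n : ℝ) * (1 - (q j).toReal) ^ n := by
      rw [Function.iterate_succ_apply', ← hreal]
      simp only [f]
      rw [ENNReal.tsum_toReal_eq]
      · simp
      · intro n
        exact ENNReal.mul_ne_top ENNReal.coe_ne_top
          (ENNReal.pow_ne_top (ne_top_of_le_ne_top ENNReal.one_ne_top (hxle j)))
    rw [← h2, hreal] at h1
    linarith
  have hbound : ∀ j : ℕ, (q j).toReal * (1 + c * j) ≤ 1 := by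
    intro j
    induction j with
    | zero => simpa using hq1 0
    | succ j ih =>
      have h0 : 0 ≤ (q (j + 1)).toReal := ENNReal.toReal_nonneg
      have h1 := hstep j
      rcases (ENNReal.toReal_nonneg (a := q j)).eq_or_lt with hz | hpos
      · rw [← hz] at h1
        have : (q (j + 1)).toReal = 0 := by nlinarith
        rw [this, zero_mul]
        exact zero_le_one
      · -- `1 / q` increases by at least `c` in each generation
        set a := (q j).toReal
        set b := (q (j + 1)).toReal
        have h2 : b * (1 + c * a) ≤ a := by nlinarith [mul_pos hc hpos, pow_pos hpos 3, sq_nonneg c]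
        have h3 : (a * (1 + c * j)) * b ≤ 1 * b := mul_le_mul_of_nonneg_right ih h0
        have h4 : a * (b * (1 + c * (j + 1 : ℕ))) ≤ a * 1 := by
          push_cast
          nlinarith
        exact le_of_mul_le_mul_left h4 hpos
  set e : ℝ := min 1 c
  have he : 0 < e := lt_min zero_lt_one hc
  refine ⟨Real.toNNReal (1 / e), fun j => ?_⟩
  change q j ≤ ENNReal.ofReal (1 / e) / _
  rw [← ENNReal.ofReal_toReal (ne_top_of_le_ne_top ENNReal.one_ne_top (hqle j)),
    ← ENNReal.ofReal_natCast,
    ← ENNReal.ofReal_div_of_pos (by positivity)]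
  refine ENNReal.ofReal_le_ofReal ?_
  rw [div_div, le_div_iff₀ (by positivity)]
  refine le_trans (mul_le_mul_of_nonneg_left ?_ ENNReal.toReal_nonneg) (hbound j)
  have h1 : e ≤ 1 := min_le_left _ _
  have h2 := mul_le_mul_of_nonneg_right (min_le_right 1 c) (Nat.cast_nonneg (α := ℝ) j)
  push_cast
  nlinarith

/-- The mean inverse width of the size-biased tree is the survival probability of the branching
process. -/
theorem IsSizeBiased.exists_lintegral_inv_le {p : ℕ → ℝ≥0} {μ : Measure PlanarTree}
    (hp : IsCriticalLaw p) (hμ : IsSizeBiased p μ) :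
    ∃ C : ℝ≥0, ∀ j : ℕ, ∫⁻ T, (T.width (j + 1) : ℝ≥0∞)⁻¹ ∂μ ≤ (C : ℝ≥0∞) / (j + 1 : ℕ) := by
  obtain ⟨C, hC⟩ := hp.exists_survival_le
  refine ⟨C, fun j => le_of_eq_of_le ?_ (hC j)⟩
  rw [← hμ.lintegral_width_div (by simp)]
  refine lintegral_congr_ae ?_
  filter_upwards [hμ.ae_infinite] with T hT
  rw [if_neg (T.width_pos (j + 1)).ne', one_div]

/-! ### The size of balls under the size-biased law -/

theorem PlanarTree.measurable_ballSize (R : ℕ) :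
    Measurable fun T : PlanarTree => T.ballSize R := by
  simp only [ballSize_eq]
  exact Finset.measurable_sum _ fun k _ => measurable_width (k + 1)

theorem PlanarTree.measurable_coe_width (k : ℕ) :
    Measurable fun T : PlanarTree => (T.width k : ℝ≥0∞) :=
  (measurable_from_nat (f := fun n : ℕ => (n : ℝ≥0∞))).comp (measurable_width k)

theorem PlanarTree.measurable_coe_ballSize (R : ℕ) :
    Measurable fun T : PlanarTree => (T.ballSize R : ℝ≥0∞) :=
  (measurable_from_nat (f := fun n : ℕ => (n : ℝ≥0∞))).comp (measurable_ballSize R)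

theorem PlanarTree.ballSize_mono (T : PlanarTree) : Monotone T.ballSize := by
  intro R R' h
  rw [ballSize_eq, ballSize_eq]
  exact Finset.sum_le_sum_of_subset (Finset.range_mono h)

theorem PlanarTree.le_ballSize (T : PlanarTree) [Infinite T.Vertex] (R : ℕ) :
    R ≤ T.ballSize R := by
  rw [ballSize_eq]
  simpa using Finset.sum_le_sum (s := Finset.range R) fun k _ =>
    Nat.one_le_iff_ne_zero.2 (T.width_pos (k + 1)).ne'

theorem IsSizeBiased.lintegral_ballSize {p : ℕ → ℝ≥0} {μ : Measure PlanarTree}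
    (hp : IsCriticalLaw p) (hμ : IsSizeBiased p μ) (R : ℕ) :
    ∫⁻ T, (T.ballSize R : ℝ≥0∞) ∂μ =
      ENNReal.ofReal (1 / 2 * offspringVariance p * (R * (R - 1)) + R) := by
  have hκ := hp.variance_pos
  have h1 : ∫⁻ T, (T.ballSize R : ℝ≥0∞) ∂μ =
      ∑ k ∈ Finset.range R, (1 + ENNReal.ofReal (offspringVariance p) * k) := by
    simp only [ballSize_eq, Nat.cast_sum]
    rw [lintegral_finsetSum _ fun k _ => measurable_coe_width (k + 1)]
    exact Finset.sum_congr rfl fun k _ => hμ.lintegral_width hp k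
  have h2 : ∀ k : ℕ, 1 + ENNReal.ofReal (offspringVariance p) * k =
      ENNReal.ofReal (1 + offspringVariance p * k) := fun k => by
    rw [ENNReal.ofReal_add zero_le_one (by positivity), ENNReal.ofReal_one,
      ENNReal.ofReal_mul hκ.le, ENNReal.ofReal_natCast]
  simp only [h1, h2]
  rw [← ENNReal.ofReal_sum_of_nonneg fun k _ => by positivity]
  congr 1
  clear h1
  induction R with
  | zero => simp
  | succ R ih =>
    rw [Finset.sum_range_succ, ih]
    push_cast
    ring

/-- Functions with bounded integrals grow at most quadratically, almost surely: the sum of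
`X j / (j + 1) ^ 2` has a finite integral. -/
theorem ae_eventually_le_sq {α : Type*} [MeasurableSpace α] {μ : Measure α}
    {X : ℕ → α → ℝ≥0∞} (hX : ∀ j, Measurable (X j)) {C : ℝ≥0∞} (hC : C ≠ ∞)
    (hle : ∀ j, ∫⁻ a, X j a ∂μ ≤ C) :
    ∀ᵐ a ∂μ, ∀ᶠ j : ℕ in atTop, X j a ≤ ((j + 1 : ℕ) : ℝ≥0∞) ^ 2 := by
  have hs : ∑' j : ℕ, ((((j + 1 : ℕ) : ℝ≥0∞) ^ 2)⁻¹) ≠ ∞ := by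
    have h1 : Summable fun j : ℕ => (((j + 1 : ℕ) : ℝ≥0) ^ 2)⁻¹ := by
      have := (summable_nat_add_iff (f := fun j : ℕ => ((j : ℝ) ^ 2)⁻¹) 1).2
        (Real.summable_nat_pow_inv.2 one_lt_two)
      refine NNReal.summable_coe.1 (this.congr fun j => ?_)
      push_cast
      rfl
    have h2 : ∀ j : ℕ, (((j + 1 : ℕ) : ℝ≥0∞) ^ 2)⁻¹ =
        (((((j + 1 : ℕ) : ℝ≥0) ^ 2)⁻¹ : ℝ≥0) : ℝ≥0∞) :=
      fun j => by
        rw [ENNReal.coe_inv (by positivity), ENNReal.coe_pow, ENNReal.coe_natCast]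
    simp only [h2]
    exact ENNReal.tsum_coe_ne_top_iff_summable.2 h1
  have hint : ∫⁻ a, ∑' j : ℕ, (((j + 1 : ℕ) : ℝ≥0∞) ^ 2)⁻¹ * X j a ∂μ ≠ ∞ := by
    rw [lintegral_tsum fun j => ((hX j).const_mul _).aemeasurable]
    refine ne_top_of_le_ne_top (ENNReal.mul_ne_top hs hC) ?_
    rw [← ENNReal.tsum_mul_right]
    refine ENNReal.tsum_le_tsum fun j => ?_
    rw [lintegral_const_mul _ (hX j)]
    exact mul_le_mul_right (hle j) _
  filter_upwards [ae_lt_top (Measurable.tsum fun j => (hX j).const_mul _) hint] with a ha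
  have h0 := ENNReal.tendsto_atTop_zero_of_tsum_ne_top ha.ne
  filter_upwards [h0.eventually_le_const zero_lt_one] with j hj
  rwa [mul_comm, ← div_eq_mul_inv, ENNReal.div_le_iff (by simp) (by simp), one_mul] at hj

namespace IsSizeBiased

variable {p : ℕ → ℝ≥0} {μ : Measure PlanarTree}

/-- This is `ae_eventually_le_sq` for `B(2 ^ j) / 4 ^ j`, where `B` is the size of balls. -/
theorem ae_eventually_ballSize_two_pow_le (hp : IsCriticalLaw p) (hμ : IsSizeBiased p μ) :
    ∀ᵐ T ∂μ, ∀ᶠ j : ℕ in atTop, (T.ballSize (2 ^ j) : ℝ) ≤ 4 ^ j * (j + 1) ^ 2 := by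
  have hκ := hp.variance_pos
  have h := ae_eventually_le_sq (μ := μ)
    (X := fun j T => (T.ballSize (2 ^ j) : ℝ≥0∞) / 4 ^ j)
    (fun j => (measurable_coe_ballSize (2 ^ j)).div_const _)
    (C := ENNReal.ofReal (1 + offspringVariance p)) ENNReal.ofReal_ne_top ?_
  · filter_upwards [h] with T hT
    filter_upwards [hT] with j hj
    rw [ENNReal.div_le_iff (by simp) (by simp)] at hj
    have hj : T.ballSize (2 ^ j) ≤ (j + 1) ^ 2 * 4 ^ j := by exact_mod_cast hj
    rw [mul_comm]
    exact_mod_cast hj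
  · intro j
    simp only [div_eq_mul_inv]
    rw [lintegral_mul_const _ (measurable_coe_ballSize (2 ^ j)), hμ.lintegral_ballSize hp,
      ← div_eq_mul_inv,
      ENNReal.div_le_iff (by simp) (by simp),
      show (4 : ℝ≥0∞) ^ j = ENNReal.ofReal (4 ^ j) by
        rw [ENNReal.ofReal_pow (by norm_num)]; norm_num,
      ← ENNReal.ofReal_mul (by positivity)]
    refine ENNReal.ofReal_le_ofReal ?_
    have h4 : (4 : ℝ) ^ j = 2 ^ j * 2 ^ j := by rw [← mul_pow]; norm_num
    have h1 : (1 : ℝ) ≤ 2 ^ j := one_le_pow₀ (by norm_num)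
    rw [h4]
    push_cast
    nlinarith [mul_nonneg hκ.le (mul_nonneg (zero_le_one.trans h1) (zero_le_one.trans h1))]

/-- The sum of the inverse widths at the heights between `2 ^ j` and `2 ^ (j + 1)` has a bounded
mean, and by the Cauchy-Schwarz inequality an upper bound on it is a lower bound on the sum of the
widths. -/
theorem ae_eventually_le_ballSize_two_pow (hp : IsCriticalLaw p) (hμ : IsSizeBiased p μ) :
    ∀ᵐ T ∂μ, ∀ᶠ j : ℕ in atTop, (4 : ℝ) ^ j ≤ (j + 1) ^ 2 * T.ballSize (2 ^ (j + 1)) := by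
  obtain ⟨C, hC⟩ := hμ.exists_lintegral_inv_le hp
  have hmeas : ∀ k, Measurable fun T : PlanarTree => (T.width (k + 1) : ℝ≥0∞)⁻¹ := fun k =>
    (measurable_coe_width (k + 1)).inv
  have h := ae_eventually_le_sq (μ := μ)
    (X := fun j T => ∑ k ∈ Finset.Ico (2 ^ j) (2 ^ (j + 1)), (T.width (k + 1) : ℝ≥0∞)⁻¹)
    (fun j => Finset.measurable_sum _ fun k _ => hmeas k) (C := C) ENNReal.coe_ne_top ?_
  · filter_upwards [h, hμ.ae_infinite] with T hT hinf
    filter_upwards [hT] with j hj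
    have hpos : ∀ k, (0 : ℝ) < T.width (k + 1) := fun k => by exact_mod_cast T.width_pos (k + 1)
    have h1 : ∀ k, (T.width (k + 1) : ℝ≥0∞)⁻¹ =
        ENNReal.ofReal (T.width (k + 1) : ℝ)⁻¹ := fun k => by
      rw [ENNReal.ofReal_inv_of_pos (hpos k), ENNReal.ofReal_natCast]
    simp only [h1] at hj
    rw [← ENNReal.ofReal_sum_of_nonneg fun k _ => (inv_pos.2 (hpos k)).le, ← ENNReal.ofReal_natCast,
      ← ENNReal.ofReal_pow (by positivity), ENNReal.ofReal_le_ofReal_iff (by positivity)] at hj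
    have hcs := Finset.sum_sq_le_sum_mul_sum_of_sq_le_mul (Finset.Ico (2 ^ j) (2 ^ (j + 1)))
      (r := fun _ => (1 : ℝ)) (f := fun k => (T.width (k + 1) : ℝ)⁻¹)
      (g := fun k => (T.width (k + 1) : ℝ)) (fun k _ => (inv_pos.2 (hpos k)).le)
      (fun k _ => (hpos k).le) (fun k _ => by simp [(hpos k).ne'])
    have hcard : (∑ _k ∈ Finset.Ico (2 ^ j) (2 ^ (j + 1)), (1 : ℝ)) ^ 2 = 4 ^ j := by
      simp only [Finset.sum_const, Nat.card_Ico, nsmul_eq_mul, mul_one]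
      rw [show 2 ^ (j + 1) - 2 ^ j = 2 ^ j by rw [pow_succ]; omega]
      push_cast
      rw [← pow_mul, mul_comm, pow_mul]
      norm_num
    have hsub : ∑ k ∈ Finset.Ico (2 ^ j) (2 ^ (j + 1)), (T.width (k + 1) : ℝ) ≤
        T.ballSize (2 ^ (j + 1)) := by
      rw [ballSize_eq, ← Nat.cast_sum]
      exact_mod_cast Finset.sum_le_sum_of_subset fun k hk =>
        Finset.mem_range.2 (Finset.mem_Ico.1 hk).2
    rw [hcard] at hcs
    refine hcs.trans ?_
    push_cast at hj
    exact mul_le_mul hj hsub (Finset.sum_nonneg fun k _ => (hpos k).le) (by positivity)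
  · intro j
    rw [lintegral_finsetSum _ fun k _ => hmeas k]
    calc ∑ k ∈ Finset.Ico (2 ^ j) (2 ^ (j + 1)), ∫⁻ T, (T.width (k + 1) : ℝ≥0∞)⁻¹ ∂μ
        ≤ ∑ _k ∈ Finset.Ico (2 ^ j) (2 ^ (j + 1)), (C : ℝ≥0∞) / (2 ^ j : ℕ) := by
          refine Finset.sum_le_sum fun k hk => (hC k).trans ?_
          refine ENNReal.div_le_div_left ?_ _
          have := (Finset.mem_Ico.1 hk).1
          exact_mod_cast this.trans (Nat.le_succ k)
      _ = C := by
          rw [Finset.sum_const, Nat.card_Ico,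
            show 2 ^ (j + 1) - 2 ^ j = 2 ^ j by rw [pow_succ]; omega, nsmul_eq_mul]
          exact ENNReal.mul_div_cancel (by simp) (ENNReal.natCast_ne_top _)

end IsSizeBiased

/-! ### Growth and Hausdorff dimension -/

theorem tendsto_log_natCast : Tendsto (fun R : ℕ => Real.log R) atTop atTop :=
  Real.tendsto_log_atTop.comp tendsto_natCast_atTop_atTop

/-- Bounds along the powers of two interpolate to all radii, as the size is monotone. The two are
compared at `2 ^ (j + 1) ≤ R < 2 ^ (j + 2)`, where `j + 1 ≤ 2 log R` because `log 2 ≥ 1 / 2`. -/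
theorem eventually_growth_bounds {b : ℕ → ℝ} (hb : Monotone b)
    (hup : ∀ᶠ j : ℕ in atTop, b (2 ^ j) ≤ 4 ^ j * (j + 1) ^ 2)
    (hlo : ∀ᶠ j : ℕ in atTop, (4 : ℝ) ^ j ≤ (j + 1) ^ 2 * b (2 ^ (j + 1))) :
    ∀ᶠ R : ℕ in atTop, 1 / 64 * (R : ℝ) ^ 2 / Real.log R ^ 2 ≤ b R ∧
      b R ≤ 64 * (R : ℝ) ^ 2 * Real.log R ^ 3 := by
  obtain ⟨J, hJ⟩ := eventually_atTop.1 (hup.and hlo)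
  filter_upwards [eventually_ge_atTop (2 ^ (J + 1)), tendsto_log_natCast.eventually_ge_atTop 1]
    with R hR hlog
  have hR0 : R ≠ 0 := by
    rintro rfl
    simp at hR
  obtain ⟨j, hj⟩ : ∃ j, Nat.log 2 R = j + 1 := ⟨Nat.log 2 R - 1, by
    have := Nat.le_log_of_pow_le (by norm_num) hR
    omega⟩
  have hJj : J ≤ j := by
    have := Nat.le_log_of_pow_le (by norm_num) hR
    omega
  have h1 : 2 ^ (j + 1) ≤ R := hj ▸ Nat.pow_log_le_self 2 hR0
  have h2 : R < 2 ^ (j + 2) := by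
    have := Nat.lt_pow_succ_log_self (b := 2) (by norm_num) R
    rwa [hj] at this
  have hjlog : ((j : ℝ) + 1) ≤ 2 * Real.log R := by
    have h3 : Real.log (2 ^ (j + 1)) ≤ Real.log R :=
      Real.log_le_log (by positivity) (by exact_mod_cast h1)
    rw [Real.log_pow] at h3
    push_cast at h3
    have h4 := Real.log_two_gt_d9
    have h5 : (0 : ℝ) ≤ j + 1 := by positivity
    nlinarith
  have h1r : (2 : ℝ) ^ (j + 1) ≤ R := by exact_mod_cast h1
  have h2r : (R : ℝ) ≤ 2 ^ (j + 2) := by exact_mod_cast h2.le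
  have hpow : ∀ n : ℕ, (4 : ℝ) ^ n = (2 ^ n) ^ 2 := fun n => by
    rw [← pow_mul, mul_comm, pow_mul]; norm_num
  have hlog0 : 0 < Real.log R := by linarith
  constructor
  · have h3 := (hJ j hJj).2
    have h4 : b (2 ^ (j + 1)) ≤ b R := hb h1
    have h5 : (R : ℝ) ^ 2 ≤ 16 * 4 ^ j := by
      calc (R : ℝ) ^ 2 ≤ (2 ^ (j + 2)) ^ 2 := by gcongr
        _ = 16 * 4 ^ j := by rw [← hpow, pow_add]; ring
    have h6 : ((j : ℝ) + 1) ^ 2 ≤ 4 * Real.log R ^ 2 := by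
      calc ((j : ℝ) + 1) ^ 2 ≤ (2 * Real.log R) ^ 2 := by gcongr
        _ = _ := by ring
    have h7 : 0 ≤ b (2 ^ (j + 1)) := by
      by_contra hneg
      have : (0 : ℝ) < 4 ^ j := by positivity
      nlinarith [sq_nonneg ((j : ℝ) + 1)]
    rw [div_le_iff₀ (by positivity)]
    calc 1 / 64 * (R : ℝ) ^ 2 ≤ 1 / 64 * (16 * ((j + 1) ^ 2 * b (2 ^ (j + 1)))) := by
          linarith
      _ ≤ 1 / 64 * (16 * (4 * Real.log R ^ 2 * b (2 ^ (j + 1)))) := by gcongr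
      _ = b (2 ^ (j + 1)) * Real.log R ^ 2 := by ring
      _ ≤ b R * Real.log R ^ 2 := by gcongr
  · have h3 := (hJ (j + 2) (by omega)).1
    push_cast at h3
    calc b R ≤ b (2 ^ (j + 2)) := hb h2.le
      _ ≤ 4 ^ (j + 2) * ((j : ℝ) + 2 + 1) ^ 2 := h3
      _ = 4 * (2 ^ (j + 1)) ^ 2 * ((j : ℝ) + 1 + 2) ^ 2 := by rw [← hpow, pow_succ]; ring
      _ ≤ 4 * (R : ℝ) ^ 2 * (2 * Real.log R + 2 * Real.log R) ^ 2 := by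
          gcongr
          linarith
      _ = 64 * (R : ℝ) ^ 2 * Real.log R ^ 2 := by ring
      _ ≤ 64 * (R : ℝ) ^ 2 * Real.log R ^ 3 := by
          exact mul_le_mul_of_nonneg_left (pow_le_pow_right₀ hlog (by norm_num)) (by positivity)

/-- Logarithmic corrections do not affect the dimension. -/
theorem hasHausdorffDim_two_of_bounds {b : ℕ → ℝ} {C₁ C₂ : ℝ} (h₁ : 0 < C₁) (h₂ : 0 < C₂)
    (h : ∀ᶠ R : ℕ in atTop, C₁ * (R : ℝ) ^ 2 / Real.log R ^ 2 ≤ b R ∧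
      b R ≤ C₂ * (R : ℝ) ^ 2 * Real.log R ^ 3) : HasHausdorffDim b 2 := by
  have hll : Tendsto (fun R : ℕ => Real.log (Real.log R) / Real.log R) atTop (𝓝 0) :=
    (Real.isLittleO_log_id_atTop.tendsto_div_nhds_zero).comp tendsto_log_natCast
  have hc : ∀ c : ℝ, Tendsto (fun R : ℕ => c / Real.log R) atTop (𝓝 0) := fun c =>
    tendsto_const_nhds.div_atTop tendsto_log_natCast
  have hlow : Tendsto (fun R : ℕ => Real.log C₁ / Real.log R + 2 -
      2 * (Real.log (Real.log R) / Real.log R)) atTop (𝓝 2) := by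
    simpa using ((hc (Real.log C₁)).add_const 2).sub (hll.const_mul 2)
  have hupp : Tendsto (fun R : ℕ => Real.log C₂ / Real.log R + 2 +
      3 * (Real.log (Real.log R) / Real.log R)) atTop (𝓝 2) := by
    simpa using ((hc (Real.log C₂)).add_const 2).add (hll.const_mul 3)
  refine tendsto_of_tendsto_of_tendsto_of_le_of_le' hlow hupp ?_ ?_
  · filter_upwards [h, eventually_gt_atTop 0, tendsto_log_natCast.eventually_gt_atTop 0]
      with R hR hR0 hlog
    have hR0 : (0 : ℝ) < R := by exact_mod_cast hR0
    have h3 := Real.log_le_log (by positivity) hR.1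
    rw [Real.log_div (by positivity) (by positivity), Real.log_mul (by positivity) (by positivity),
      Real.log_pow, Real.log_pow] at h3
    rw [le_div_iff₀ hlog]
    field_simp
    push_cast at h3
    linarith
  · filter_upwards [h, eventually_gt_atTop 0, tendsto_log_natCast.eventually_gt_atTop 0]
      with R hR hR0 hlog
    have hR0 : (0 : ℝ) < R := by exact_mod_cast hR0
    have hb : 0 < b R := lt_of_lt_of_le (by positivity) hR.1
    have h3 := Real.log_le_log hb hR.2
    rw [Real.log_mul (by positivity) (by positivity), Real.log_mul (by positivity) (by positivity),
      Real.log_pow, Real.log_pow] at h3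
    rw [div_le_iff₀ hlog]
    field_simp
    push_cast at h3
    linarith

theorem hasHausdorffDim_two_of_quadratic {b : ℕ → ℝ} {C₁ C₂ : ℝ} (h₁ : 0 < C₁) (h₂ : 0 < C₂)
    (h : ∀ᶠ R : ℕ in atTop, C₁ * (R : ℝ) ^ 2 ≤ b R ∧ b R ≤ C₂ * (R : ℝ) ^ 2) :
    HasHausdorffDim b 2 := by
  refine hasHausdorffDim_two_of_bounds h₁ h₂ ?_
  filter_upwards [h, tendsto_log_natCast.eventually_ge_atTop 1] with R hR hlog
  exact ⟨(div_le_self (by positivity) (one_le_pow₀ hlog)).trans hR.1,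
    hR.2.trans (le_mul_of_one_le_right (by positivity) (one_le_pow₀ hlog))⟩

/-! ### The generic random trees -/

theorem IsGeneric.exists_isSizeBiased_map {w : ℕ → ℝ≥0} (hw : IsGeneric w)
    {ν : Measure InfiniteTree} (hν : IsInfiniteVolumeLimit w ν) :
    ∃ p : ℕ → ℝ≥0, IsCriticalLaw p ∧ deriv (deriv (offspringGF w)) 1 = offspringVariance p ∧
      IsSizeBiased p (ν.map Subtype.val) := by
  obtain ⟨p, hoff, hp, hne, hlim⟩ := hw.exists_tendsto_ball
  refine ⟨p, hp, ?_, (isInfiniteVolumeLimit_iff hne hlim ν).1 hν⟩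
  rw [← hp.deriv_deriv]
  have : offspringGF w = fun s => ∑' n, (p n : ℝ) * s ^ n := by
    funext s
    simp only [offspringGF, hoff]
  rw [this]

namespace InfiniteTree

variable {p : ℕ → ℝ≥0} {ν : Measure InfiniteTree}

theorem measurable_ballSize (R : ℕ) : Measurable fun T : InfiniteTree => (T.1.ballSize R : ℝ) :=
  (measurable_from_nat (f := fun n : ℕ => (n : ℝ))).comp
    ((PlanarTree.measurable_ballSize R).comp measurable_subtype_coe)

theorem lintegral_ballSize (hp : IsCriticalLaw p) (hν : IsSizeBiased p (ν.map Subtype.val))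
    (R : ℕ) : ∫⁻ T : InfiniteTree, ENNReal.ofReal (T.1.ballSize R) ∂ν =
      ENNReal.ofReal (1 / 2 * offspringVariance p * (R * (R - 1)) + R) := by
  rw [← hν.lintegral_ballSize hp, lintegral_map (measurable_coe_ballSize R) measurable_subtype_coe]
  simp

theorem integrable_ballSize (hp : IsCriticalLaw p) (hν : IsSizeBiased p (ν.map Subtype.val))
    (R : ℕ) : Integrable (fun T : InfiniteTree => (T.1.ballSize R : ℝ)) ν := by
  refine (lintegral_ofReal_ne_top_iff_integrable
    (measurable_ballSize R).aestronglyMeasurable (ae_of_all _ fun T => Nat.cast_nonneg _)).1 ?_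
  rw [lintegral_ballSize hp hν]
  exact ENNReal.ofReal_ne_top

theorem natCast_mul_sub_one_nonneg (R : ℕ) : 0 ≤ (R : ℝ) * (R - 1) := by
  cases R with
  | zero => simp
  | succ R =>
    rw [Nat.cast_succ, add_sub_cancel_right]
    positivity

theorem integral_ballSize (hp : IsCriticalLaw p) (hν : IsSizeBiased p (ν.map Subtype.val))
    (R : ℕ) : ∫ T : InfiniteTree, (T.1.ballSize R : ℝ) ∂ν =
      1 / 2 * offspringVariance p * (R * (R - 1)) + R := by
  rw [integral_eq_lintegral_of_nonneg_ae (ae_of_all _ fun T => Nat.cast_nonneg _)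
    (measurable_ballSize R).aestronglyMeasurable, lintegral_ballSize hp hν,
    ENNReal.toReal_ofReal]
  have h0 := natCast_mul_sub_one_nonneg R
  have := hp.variance_pos
  positivity

theorem exists_integral_ballSize_bounds (hp : IsCriticalLaw p)
    (hν : IsSizeBiased p (ν.map Subtype.val)) :
    ∃ C₁ : ℝ, 0 < C₁ ∧ ∃ C₂ : ℝ, 0 < C₂ ∧ ∀ R : ℕ,
      C₁ * (R : ℝ) ^ 2 ≤ ∫ T : InfiniteTree, (T.1.ballSize R : ℝ) ∂ν ∧
        ∫ T : InfiniteTree, (T.1.ballSize R : ℝ) ∂ν ≤ C₂ * (R : ℝ) ^ 2 := by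
  have hκ := hp.variance_pos
  set κ := offspringVariance p
  refine ⟨min (1 / 2 * κ) 1, lt_min (by positivity) one_pos, 1 / 2 * κ + 1, by positivity,
    fun R => ?_⟩
  rw [integral_ballSize hp hν]
  have h0 := natCast_mul_sub_one_nonneg R
  have hR : (0 : ℝ) ≤ R := Nat.cast_nonneg R
  constructor
  · have h1 := mul_le_mul_of_nonneg_right (min_le_left (1 / 2 * κ) 1) h0
    have h2 := mul_le_mul_of_nonneg_right (min_le_right (1 / 2 * κ) 1) hR
    linear_combination h1 + h2
  · linear_combination mul_nonneg (mul_nonneg one_half_pos.le hκ.le) hR + h0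

theorem ae_growth_bounds (hp : IsCriticalLaw p) (hν : IsSizeBiased p (ν.map Subtype.val)) :
    ∀ᵐ T : InfiniteTree ∂ν, ∀ᶠ R : ℕ in atTop,
      1 / 64 * (R : ℝ) ^ 2 / Real.log R ^ 2 ≤ (T.1.ballSize R : ℝ) ∧
        (T.1.ballSize R : ℝ) ≤ 64 * (R : ℝ) ^ 2 * Real.log R ^ 3 := by
  refine ae_of_ae_map (f := Subtype.val) (p := fun T : PlanarTree => ∀ᶠ R : ℕ in atTop,
    1 / 64 * (R : ℝ) ^ 2 / Real.log R ^ 2 ≤ (T.ballSize R : ℝ) ∧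
      (T.ballSize R : ℝ) ≤ 64 * (R : ℝ) ^ 2 * Real.log R ^ 3)
    measurable_subtype_coe.aemeasurable ?_
  filter_upwards [hν.ae_eventually_ballSize_two_pow_le hp,
    hν.ae_eventually_le_ballSize_two_pow hp] with T h1 h2
  exact eventually_growth_bounds (fun R R' h => Nat.cast_le.2 (T.ballSize_mono h)) h1 h2

end InfiniteTree

/-! ### The uniform infinite causal triangulation -/

namespace PlanarTree

variable {T : PlanarTree}

/-- The vertices of the triangulation up to height `R`, including the central one, are the vertices
of the tree up to height `R + 1` other than the root. -/
theorem ncard_nvertex (T : PlanarTree) (R : ℕ) :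
    {v : T.NVertex | v.lev < R}.ncard + 1 = T.ballSize (R + 1) := by
  have hbij : Set.BijOn (fun v : T.NVertex => (⟨v.lev, v.idx⟩ : Σ _ : ℕ, ℕ)) {v | v.lev < R}
      ((Finset.range R).sigma fun k => Finset.range (T.width (k + 2))) := by
    refine ⟨?_, ?_, ?_⟩
    · intro v hv
      have hv : v.lev < R := hv
      simp [hv, v.lt]
    · intro u _ v _ h
      simp only [Sigma.mk.injEq, heq_eq_eq] at h
      exact NVertex.ext h.1 h.2
    · rintro ⟨k, i⟩ h
      simp only [Finset.coe_sigma, Set.mem_sigma_iff, Finset.coe_range, Set.mem_Iio] at h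
      exact ⟨⟨k, i, h.2⟩, h.1, rfl⟩
  rw [← hbij.injOn.ncard_image, hbij.image_eq, Set.ncard_coe_finset, Finset.card_sigma,
    ballSize_eq, Finset.sum_range_succ', T.width_one]
  simp

theorem finite_nvertex (T : PlanarTree) (R : ℕ) : {v : T.NVertex | v.lev < R}.Finite := by
  refine Set.Finite.of_finite_image (f := fun v : T.NVertex => (⟨v.lev, v.idx⟩ : Σ _ : ℕ, ℕ))
    (((Finset.range R).sigma fun k => Finset.range (T.width (k + 2))).finite_toSet.subset ?_) ?_
  · rintro _ ⟨v, hv, rfl⟩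
    have hv : v.lev < R := hv
    simp [hv, v.lt]
  · intro u _ v _ h
    simp only [Sigma.mk.injEq, heq_eq_eq] at h
    exact NVertex.ext h.1 h.2

/-- Every vertex up to height `R` other than the central one contributes its tree edge and a cycle
edge, and those up to height `R - 1` also contribute the edge added to them. For `R = 0` the
term `R - 1 + 1` is `1`. -/
theorem ballSize_toTriangulation (T : PlanarTree) [Infinite T.Vertex] (R : ℕ) :
    T.toTriangulation.ballSize R + 3 = 2 * T.ballSize (R + 1) + T.ballSize (R - 1 + 1) := by
  have hdist : ∀ v : T.CVertex,
      T.toTriangulation.graph.edist T.toTriangulation.center v ≤ R ↔ v.height ≤ R := by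
    intro v
    have h : T.cgraph.edist T.toTriangulation.center v = v.height :=
      edist_eq_height (r := (T.toTriangulation.center : T.CVertex)) rfl v
    exact (h ▸ Iff.rfl : _ ↔ ((v.height : ℕ) : ℕ∞) ≤ R).trans Nat.cast_le
  set f₁ : T.NVertex → Sym2 T.CDart := fun v => s(.treeUp v, .treeDown v)
  set f₂ : T.NVertex → Sym2 T.CDart := fun v => s(.cycRight v, .cycLeft v)
  set f₃ : T.NVertex → Sym2 T.CDart := fun v => s(.extUp v, .extDown v)
  have hset : {e : Sym2 T.CDart | ∃ d : T.CDart, e = s(d, d.opp) ∧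
      T.toTriangulation.graph.edist T.toTriangulation.center d.org ≤ R ∧
      T.toTriangulation.graph.edist T.toTriangulation.center d.opp.org ≤ R} =
      (f₁ '' {v | v.lev < R} ∪ f₂ '' {v | v.lev < R}) ∪ f₃ '' {v | v.lev < R - 1} := by
    ext e
    simp only [hdist, Set.mem_union, Set.mem_image, Set.mem_ofPred_eq]
    constructor
    · rintro ⟨d, rfl, h1, h2⟩
      cases d with
      | treeUp v => exact Or.inl (Or.inl ⟨v, h2, rfl⟩)
      | treeDown v => exact Or.inl (Or.inl ⟨v, h1, Sym2.eq_swap⟩)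
      | cycRight v => exact Or.inl (Or.inr ⟨v, h1, rfl⟩)
      | cycLeft v => exact Or.inl (Or.inr ⟨v, h2, Sym2.eq_swap⟩)
      | extUp v =>
        refine Or.inr ⟨v, ?_, rfl⟩
        change v.lev + 1 + 1 ≤ R at h2
        omega
      | extDown v =>
        refine Or.inr ⟨v, ?_, Sym2.eq_swap⟩
        change v.lev + 1 + 1 ≤ R at h1
        omega
    · rintro ((⟨v, hv, rfl⟩ | ⟨v, hv, rfl⟩) | ⟨v, hv, rfl⟩)
      · exact ⟨.treeUp v, rfl, hv.le, hv⟩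
      · exact ⟨.cycRight v, rfl, hv, hv⟩
      · refine ⟨.extUp v, rfl, ?_, ?_⟩
        · change v.lev + 1 ≤ R
          omega
        · change v.lev + 1 + 1 ≤ R
          omega
  have hinj₁ : Function.Injective f₁ := fun u v h => by simpa [f₁] using h
  have hinj₂ : Function.Injective f₂ := fun u v h => by simpa [f₂] using h
  have hinj₃ : Function.Injective f₃ := fun u v h => by simpa [f₃] using h
  have hfin := T.finite_nvertex R
  have hfin' := T.finite_nvertex (R - 1)
  change {e : Sym2 T.CDart | ∃ d : T.CDart, e = s(d, d.opp) ∧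
      T.toTriangulation.graph.edist T.toTriangulation.center d.org ≤ R ∧
      T.toTriangulation.graph.edist T.toTriangulation.center d.opp.org ≤ R}.ncard + 3 = _
  rw [hset, Set.ncard_union_eq ?_ ((hfin.image f₁).union (hfin.image f₂)) (hfin'.image f₃),
    Set.ncard_union_eq ?_ (hfin.image f₁) (hfin.image f₂), Set.ncard_image_of_injective _ hinj₁,
    Set.ncard_image_of_injective _ hinj₂, Set.ncard_image_of_injective _ hinj₃,
    ← ncard_nvertex, ← ncard_nvertex]
  · ring
  · rw [Set.disjoint_left]
    rintro _ ⟨u, -, rfl⟩ ⟨v, -, h⟩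
    simp [f₁, f₂] at h
  · rw [Set.disjoint_left]
    rintro _ (⟨u, -, rfl⟩ | ⟨u, -, rfl⟩) ⟨v, -, h⟩
    · simp [f₁, f₃] at h
    · simp [f₂, f₃] at h

theorem ballSize_le_ballSize_toTriangulation (T : PlanarTree) [Infinite T.Vertex] (R : ℕ) :
    T.ballSize R ≤ T.toTriangulation.ballSize R := by
  have h := T.ballSize_toTriangulation R
  cases R with
  | zero => simp [ballSize_eq]
  | succ R =>
    have h1 := T.le_ballSize (R + 1 + 1)
    rw [Nat.add_sub_cancel] at h
    omega

theorem ballSize_toTriangulation_le (T : PlanarTree) [Infinite T.Vertex] (R : ℕ) :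
    T.toTriangulation.ballSize R ≤ 3 * T.ballSize (R + 1) := by
  have h := T.ballSize_toTriangulation R
  have h1 := T.ballSize_mono (show R - 1 + 1 ≤ R + 1 by omega)
  omega

end PlanarTree

/-- For `w_n = 1` one has `Z (1 - Z) = ζ`, so that `Z` cannot increase beyond `1 / 2`. -/
theorem isGeneric_one : IsGeneric fun _ => 1 := by
  have hφ : ∀ z, weightSeries (fun _ => 1) z = (1 - z)⁻¹ := fun z => by
    simp [weightSeries, ENNReal.tsum_geometric]
  have hz : ((3 / 4 : ℝ≥0) : ℝ≥0∞) ≤ zCrit fun _ => 1 := by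
    refine le_iSup₂_of_le (3 / 4 : ℝ≥0) ?_ le_rfl
    rw [hφ]
    refine ENNReal.inv_ne_top.2 (tsub_pos_of_lt ?_).ne'
    rw [← ENNReal.coe_one, ENNReal.coe_lt_coe, div_lt_one (by norm_num)]
    norm_num
  have hZ : ZZero (fun _ => 1) ≤ ((1 / 2 : ℝ≥0) : ℝ≥0∞) := by
    set Z := partitionSeries fun _ => 1
    have hfin : ∀ ζ < zetaZero (fun _ => 1), Z ζ ≠ ∞ := by
      intro ζ hζ
      obtain ⟨r, hr⟩ := lt_iSup_iff.1 hζ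
      obtain ⟨h1, h2⟩ := lt_iSup_iff.1 hr
      exact ne_top_of_le_ne_top h1 (partitionSeries_mono _ h2.le)
    -- the functional equation in the real numbers
    have hreal : ∀ ζ < zetaZero (fun _ => 1), (Z ζ).toReal * (1 - (Z ζ).toReal) = ζ.toReal := by
      intro ζ hζ
      have h1 : Z ζ = ζ * (1 - Z ζ)⁻¹ := by
        rw [← hφ]
        exact partitionSeries_eq_mul_weightSeries _ ζ
      rcases lt_or_ge (Z ζ) 1 with hlt | hge
      · have h2 : 1 - Z ζ ≠ 0 := (tsub_pos_of_lt hlt).ne'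
        have h3 : Z ζ * (1 - Z ζ) = ζ := by
          refine (congrArg (· * (1 - Z ζ)) h1).trans ?_
          rw [mul_assoc, ENNReal.inv_mul_cancel h2 (ENNReal.sub_ne_top ENNReal.one_ne_top),
            mul_one]
        have h4 := congrArg ENNReal.toReal h3
        rwa [ENNReal.toReal_mul, ENNReal.toReal_sub_of_le hlt.le ENNReal.one_ne_top,
          ENNReal.toReal_one] at h4
      · rw [tsub_eq_zero_of_le hge, ENNReal.inv_zero] at h1
        have h0 : ζ = 0 := by
          by_contra h0
          rw [ENNReal.mul_top h0] at h1
          exact hfin ζ hζ h1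
        rw [h0, zero_mul] at h1
        rw [h0, h1]
        simp
    refine iSup₂_le fun ζ hζ => ?_
    by_contra hlt
    rw [not_le] at hlt
    obtain ⟨ζ', h1, h2⟩ := exists_between hζ
    have h3 := ENNReal.toReal_mono (hfin ζ' h2) (partitionSeries_mono _ h1.le : Z ζ ≤ Z ζ')
    have h4 := (ENNReal.toReal_lt_toReal (hζ.ne_top) h2.ne_top).2 h1
    have h5 := (ENNReal.toReal_lt_toReal ENNReal.coe_ne_top (hfin ζ hζ)).2 hlt
    rw [← hreal ζ hζ, ← hreal ζ' h2] at h4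
    simp only [ENNReal.coe_toReal, NNReal.coe_div, NNReal.coe_one, NNReal.coe_ofNat] at h5
    nlinarith
  have hlt : ((1 / 2 : ℝ≥0) : ℝ≥0∞) < ((3 / 4 : ℝ≥0) : ℝ≥0∞) := by
    rw [ENNReal.coe_lt_coe, ← NNReal.coe_lt_coe]
    norm_num
  exact ⟨one_pos, ⟨3, le_rfl, one_pos⟩, (ENNReal.coe_pos.2 (by positivity)).trans_le hz,
    hZ.trans_lt (hlt.trans_le hz)⟩

/-- The events of causal triangulations are those whose preimages are events of trees. -/
theorem measurable_toCausal : Measurable InfiniteTree.toCausal := fun _ hs => hs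

theorem measurable_causalTriangulation_iff {f : CausalTriangulation → ℝ} :
    Measurable f ↔ Measurable fun T : InfiniteTree => f T.toCausal :=
  Iff.rfl

theorem ballSize_le_ballSize_toCausal (T : InfiniteTree) (R : ℕ) :
    (T.1.ballSize R : ℝ) ≤ T.toCausal.1.ballSize R := by
  have := T.2
  exact_mod_cast T.1.ballSize_le_ballSize_toTriangulation R

theorem ballSize_toCausal_le (T : InfiniteTree) (R : ℕ) :
    (T.toCausal.1.ballSize R : ℝ) ≤ 3 * T.1.ballSize (R + 1) := by
  have := T.2
  exact_mod_cast T.1.ballSize_toTriangulation_le R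

theorem measurable_ballSize_causal (R : ℕ) :
    Measurable fun G : CausalTriangulation => (G.1.ballSize R : ℝ) := by
  rw [measurable_causalTriangulation_iff]
  have : (fun T : InfiniteTree => (T.toCausal.1.ballSize R : ℝ)) =
      fun T => 2 * (T.1.ballSize (R + 1) : ℝ) + T.1.ballSize (R - 1 + 1) - 3 := by
    funext T
    have := T.2
    rw [eq_sub_iff_add_eq]
    exact_mod_cast T.1.ballSize_toTriangulation R
  rw [this]
  exact (((InfiniteTree.measurable_ballSize _).const_mul 2).add
    (InfiniteTree.measurable_ballSize _)).sub_const 3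

theorem integrable_ballSize_causal {p : ℕ → ℝ≥0} {ν : Measure InfiniteTree} (hp : IsCriticalLaw p)
    (hν : IsSizeBiased p (ν.map Subtype.val)) (R : ℕ) :
    Integrable (fun G : CausalTriangulation => (G.1.ballSize R : ℝ)) (causalMeasure ν) := by
  rw [causalMeasure, integrable_map_measure (measurable_ballSize_causal R).aestronglyMeasurable
    measurable_toCausal.aemeasurable]
  refine ((InfiniteTree.integrable_ballSize hp hν (R + 1)).const_mul 3).mono'
    ((measurable_ballSize_causal R).comp measurable_toCausal).aestronglyMeasurable
    (ae_of_all _ fun T => ?_)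
  rw [Function.comp_apply, Real.norm_of_nonneg (Nat.cast_nonneg _)]
  exact ballSize_toCausal_le T R

theorem exists_integral_ballSize_causal_bounds {p : ℕ → ℝ≥0} {ν : Measure InfiniteTree}
    (hp : IsCriticalLaw p) (hν : IsSizeBiased p (ν.map Subtype.val)) :
    ∃ C₁ : ℝ, 0 < C₁ ∧ ∃ C₂ : ℝ, 0 < C₂ ∧ ∀ᶠ R : ℕ in atTop,
      C₁ * (R : ℝ) ^ 2 ≤ ∫ G : CausalTriangulation, (G.1.ballSize R : ℝ) ∂(causalMeasure ν) ∧
        ∫ G : CausalTriangulation, (G.1.ballSize R : ℝ) ∂(causalMeasure ν) ≤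
          C₂ * (R : ℝ) ^ 2 := by
  obtain ⟨C₁, h₁, C₂, h₂, h⟩ := InfiniteTree.exists_integral_ballSize_bounds hp hν
  refine ⟨C₁, h₁, 12 * C₂, by positivity, ?_⟩
  filter_upwards [eventually_ge_atTop 1] with R hR
  have hint := integrable_ballSize_causal hp hν R
  rw [causalMeasure, integrable_map_measure (measurable_ballSize_causal R).aestronglyMeasurable
    measurable_toCausal.aemeasurable] at hint
  rw [causalMeasure, integral_map measurable_toCausal.aemeasurable
    (measurable_ballSize_causal R).aestronglyMeasurable]
  constructor
  · exact (h R).1.trans (integral_mono (InfiniteTree.integrable_ballSize hp hν R) hint fun T =>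
      ballSize_le_ballSize_toCausal T R)
  · refine (integral_mono hint ((InfiniteTree.integrable_ballSize hp hν (R + 1)).const_mul 3)
      fun T => ballSize_toCausal_le T R).trans ?_
    rw [integral_const_mul]
    have h3 := (h (R + 1)).2
    have hR : (1 : ℝ) ≤ R := by exact_mod_cast hR
    have h4 : ((R + 1 : ℕ) : ℝ) ^ 2 ≤ 4 * (R : ℝ) ^ 2 := by
      push_cast
      nlinarith
    have h5 := mul_le_mul_of_nonneg_left h4 h₂.le
    linarith

theorem ae_growth_bounds_causal {p : ℕ → ℝ≥0} {ν : Measure InfiniteTree} (hp : IsCriticalLaw p)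
    (hν : IsSizeBiased p (ν.map Subtype.val)) :
    ∃ C₁ : ℝ, 0 < C₁ ∧ ∃ C₂ : ℝ, 0 < C₂ ∧
      ∀ᵐ G : CausalTriangulation ∂(causalMeasure ν), ∀ᶠ R : ℕ in atTop,
        C₁ * (R : ℝ) ^ 2 / Real.log R ^ 2 ≤ (G.1.ballSize R : ℝ) ∧
          (G.1.ballSize R : ℝ) ≤ C₂ * (R : ℝ) ^ 2 * Real.log R ^ 3 := by
  -- a factor `3` from `ballSize_toCausal_le`, and `4` and `8` from the radius `R + 1 ≤ 2 * R`
  refine ⟨1 / 64, by norm_num, 3 * 64 * 4 * 8, by norm_num, ?_⟩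
  have hmeas : MeasurableSet {G : CausalTriangulation | ∀ᶠ R : ℕ in atTop,
      1 / 64 * (R : ℝ) ^ 2 / Real.log R ^ 2 ≤ (G.1.ballSize R : ℝ) ∧
        (G.1.ballSize R : ℝ) ≤ 3 * 64 * 4 * 8 * (R : ℝ) ^ 2 * Real.log R ^ 3} := by
    simp only [eventually_atTop, Set.ofPred_exists, Set.ofPred_forall]
    refine MeasurableSet.iUnion fun N => MeasurableSet.iInter fun R => MeasurableSet.iInter fun _ =>
      ?_
    exact (measurableSet_le measurable_const (measurable_ballSize_causal R)).inter
      (measurableSet_le (measurable_ballSize_causal R) measurable_const)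
  rw [causalMeasure, ae_map_iff measurable_toCausal.aemeasurable hmeas]
  filter_upwards [InfiniteTree.ae_growth_bounds hp hν] with T hT
  filter_upwards [hT, (tendsto_add_atTop_nat 1).eventually hT, eventually_ge_atTop 2]
    with R hR hR' hR2
  refine ⟨hR.1.trans (ballSize_le_ballSize_toCausal T R), (ballSize_toCausal_le T R).trans ?_⟩
  have hR2 : (2 : ℝ) ≤ R := by exact_mod_cast hR2
  have h1 : Real.log (R + 1 : ℕ) ≤ 2 * Real.log R := by
    have : Real.log (R + 1 : ℕ) ≤ Real.log ((R : ℝ) ^ 2) := by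
      refine Real.log_le_log (by positivity) ?_
      push_cast
      nlinarith
    rwa [Real.log_pow, Nat.cast_ofNat] at this
  have h0 : 0 ≤ Real.log (R + 1 : ℕ) := Real.log_natCast_nonneg _
  calc (3 : ℝ) * T.1.ballSize (R + 1)
      ≤ 3 * (64 * ((R + 1 : ℕ) : ℝ) ^ 2 * Real.log (R + 1 : ℕ) ^ 3) := by
        gcongr
        exact hR'.2
    _ ≤ 3 * (64 * (2 * (R : ℝ)) ^ 2 * (2 * Real.log R) ^ 3) := by
        gcongr
        push_cast
        linarith
    _ = _ := by ring

theorem IsGeneric.ballSize_growth {w : ℕ → ℝ≥0} (hw : IsGeneric w) {ν : Measure InfiniteTree}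
    (hν : IsInfiniteVolumeLimit w ν) :
    (∀ R : ℕ, Integrable (fun T : InfiniteTree => (T.1.ballSize R : ℝ)) ν ∧
      ∫ T : InfiniteTree, (T.1.ballSize R : ℝ) ∂ν =
        1 / 2 * deriv (deriv (offspringGF w)) 1 * ((R : ℝ) * ((R : ℝ) - 1)) + (R : ℝ)) ∧
    HasHausdorffDim (fun R => ∫ T : InfiniteTree, (T.1.ballSize R : ℝ) ∂ν) 2 ∧
    (∃ C₁ : ℝ, 0 < C₁ ∧ ∃ C₂ : ℝ, 0 < C₂ ∧
      ∀ᵐ T : InfiniteTree ∂ν, ∀ᶠ R : ℕ in atTop,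
        C₁ * (R : ℝ) ^ 2 / Real.log R ^ 2 ≤ (T.1.ballSize R : ℝ) ∧
        (T.1.ballSize R : ℝ) ≤ C₂ * (R : ℝ) ^ 2 * Real.log R ^ 3) ∧
    ∀ᵐ T : InfiniteTree ∂ν, HasHausdorffDim (fun R => (T.1.ballSize R : ℝ)) 2 := by
  obtain ⟨p, hp, hκ, hbias⟩ := hw.exists_isSizeBiased_map hν
  have hae := InfiniteTree.ae_growth_bounds hp hbias
  obtain ⟨C₁, h₁, C₂, h₂, h⟩ := InfiniteTree.exists_integral_ballSize_bounds hp hbias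
  refine ⟨fun R => ⟨InfiniteTree.integrable_ballSize hp hbias R, ?_⟩,
    hasHausdorffDim_two_of_quadratic h₁ h₂ (Eventually.of_forall h),
    ⟨1 / 64, by norm_num, 64, by norm_num, hae⟩, ?_⟩
  · rw [hκ]
    exact InfiniteTree.integral_ballSize hp hbias R
  · filter_upwards [hae] with T hT
    exact hasHausdorffDim_two_of_bounds (by norm_num) (by norm_num) hT

theorem causalMeasure_ballSize_growth {p : ℕ → ℝ≥0} {ν : Measure InfiniteTree}
    (hp : IsCriticalLaw p) (hν : IsSizeBiased p (ν.map Subtype.val)) :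
    (∀ R : ℕ, Integrable (fun G : CausalTriangulation => (G.1.ballSize R : ℝ))
      (causalMeasure ν)) ∧
    (fun R : ℕ => ∫ G : CausalTriangulation, (G.1.ballSize R : ℝ) ∂(causalMeasure ν))
      =Θ[atTop] (fun R : ℕ => (R : ℝ) ^ 2) ∧
    HasHausdorffDim
      (fun R => ∫ G : CausalTriangulation, (G.1.ballSize R : ℝ) ∂(causalMeasure ν)) 2 ∧
    (∃ C₁ : ℝ, 0 < C₁ ∧ ∃ C₂ : ℝ, 0 < C₂ ∧
      ∀ᵐ G : CausalTriangulation ∂(causalMeasure ν), ∀ᶠ R : ℕ in atTop,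
        C₁ * (R : ℝ) ^ 2 / Real.log R ^ 2 ≤ (G.1.ballSize R : ℝ) ∧
        (G.1.ballSize R : ℝ) ≤ C₂ * (R : ℝ) ^ 2 * Real.log R ^ 3) ∧
    ∀ᵐ G : CausalTriangulation ∂(causalMeasure ν),
      HasHausdorffDim (fun R => (G.1.ballSize R : ℝ)) 2 := by
  obtain ⟨C₁, h₁, C₂, h₂, h⟩ := exists_integral_ballSize_causal_bounds hp hν
  have hae := ae_growth_bounds_causal hp hν
  refine ⟨integrable_ballSize_causal hp hν, ⟨?_, ?_⟩, hasHausdorffDim_two_of_quadratic h₁ h₂ h,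
    hae, ?_⟩
  · refine Asymptotics.IsBigO.of_bound C₂ ?_
    filter_upwards [h] with R hR
    rw [Real.norm_of_nonneg (integral_nonneg fun G => Nat.cast_nonneg _),
      Real.norm_of_nonneg (by positivity)]
    exact hR.2
  · refine Asymptotics.IsBigO.of_bound C₁⁻¹ ?_
    filter_upwards [h] with R hR
    rw [Real.norm_of_nonneg (integral_nonneg fun G => Nat.cast_nonneg _),
      Real.norm_of_nonneg (by positivity), le_inv_mul_iff₀ h₁]
    exact hR.1
  · obtain ⟨c₁, k₁, c₂, k₂, hae⟩ := hae
    filter_upwards [hae] with G hG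
    exact hasHausdorffDim_two_of_bounds k₁ k₂ hG

theorem mainTheorem6 :
    (∀ w : ℕ → ℝ≥0, IsGeneric w →
      (∃! ν : Measure InfiniteTree, IsInfiniteVolumeLimit w ν) ∧
      ∀ ν : Measure InfiniteTree, IsInfiniteVolumeLimit w ν →
        (∀ R : ℕ, Integrable (fun T : InfiniteTree => (T.1.ballSize R : ℝ)) ν ∧
          ∫ T : InfiniteTree, (T.1.ballSize R : ℝ) ∂ν =
            1 / 2 * deriv (deriv (offspringGF w)) 1 * ((R : ℝ) * ((R : ℝ) - 1)) + (R : ℝ)) ∧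
        HasHausdorffDim (fun R => ∫ T : InfiniteTree, (T.1.ballSize R : ℝ) ∂ν) 2 ∧
        (∃ C₁ : ℝ, 0 < C₁ ∧ ∃ C₂ : ℝ, 0 < C₂ ∧
          ∀ᵐ T : InfiniteTree ∂ν, ∀ᶠ R : ℕ in atTop,
            C₁ * (R : ℝ) ^ 2 / Real.log R ^ 2 ≤ (T.1.ballSize R : ℝ) ∧
            (T.1.ballSize R : ℝ) ≤ C₂ * (R : ℝ) ^ 2 * Real.log R ^ 3) ∧
        ∀ᵐ T : InfiniteTree ∂ν, HasHausdorffDim (fun R => (T.1.ballSize R : ℝ)) 2) ∧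
    ((∃! ν : Measure InfiniteTree, IsInfiniteVolumeLimit (fun _ => 1) ν) ∧
      ∀ ν : Measure InfiniteTree, IsInfiniteVolumeLimit (fun _ => 1) ν →
        (∀ R : ℕ, Integrable (fun G : CausalTriangulation => (G.1.ballSize R : ℝ))
          (causalMeasure ν)) ∧
        (fun R : ℕ => ∫ G : CausalTriangulation, (G.1.ballSize R : ℝ) ∂(causalMeasure ν))
          =Θ[atTop] (fun R : ℕ => (R : ℝ) ^ 2) ∧
        HasHausdorffDim
          (fun R => ∫ G : CausalTriangulation, (G.1.ballSize R : ℝ) ∂(causalMeasure ν)) 2 ∧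
        (∃ C₁ : ℝ, 0 < C₁ ∧ ∃ C₂ : ℝ, 0 < C₂ ∧
          ∀ᵐ G : CausalTriangulation ∂(causalMeasure ν), ∀ᶠ R : ℕ in atTop,
            C₁ * (R : ℝ) ^ 2 / Real.log R ^ 2 ≤ (G.1.ballSize R : ℝ) ∧
            (G.1.ballSize R : ℝ) ≤ C₂ * (R : ℝ) ^ 2 * Real.log R ^ 3) ∧
        ∀ᵐ G : CausalTriangulation ∂(causalMeasure ν),
          HasHausdorffDim (fun R => (G.1.ballSize R : ℝ)) 2) := by
  refine ⟨fun w hw => ⟨hw.existsUnique_isInfiniteVolumeLimit, fun ν hν => hw.ballSize_growth hν⟩,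
    isGeneric_one.existsUnique_isInfiniteVolumeLimit, fun ν hν => ?_⟩
  obtain ⟨p, hp, -, hbias⟩ := isGeneric_one.exists_isSizeBiased_map hν
  exact causalMeasure_ballSize_growth hp hbias
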